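/- **Setting.** Let $G$ be a finite group and let $\mathcal L$ be a finite graph with oriented edges $E$ drawn on a closed oriented surface (of any genus) so that all faces (plaquettes) are discs. Every edge carries a qudit $\mathbb C^{|G|}$ with orthonormal basis $\{|g\rangle\}_{g\in G}$; reversing an edge replaces $|g\rangle$ by $|g^{-1}\rangle$. A site $s=(v,p)$ is a corner of a plaquette $p$ at a vertex $v$. On basis states, $A_s^k$ multiplies every edge at $v$ by $k$ on the side of $v$ (an edge leaving $v$: $x\mapsto kx$; an edge entering $v$: $x\mapsto xk^{-1}$), and $B_s^h$ projects onto the configurations whose ordered product counterclockwise around $p$, starting from $v$, equals $h$. A ground state is a nonzero vector $\Psi$ with $A_v\Psi=\Psi$ and $B_p\Psi=\Psi$ for all vertices $v$ and plaquettes $p$, where $A_v=\frac1{|G|}\sum_{g}A_s^g$ and $B_p=B_s^{1}$. A ribbon $\xi$ from a site $s_0$ to a site $s_1$ is a contiguous sequence of pairwise non-overlapping triangles. A primary triangle moves along an edge, with the plaquette on its right, from one site of that plaquette to the next; a dual triangle crosses an edge at a vertex, counterclockwise, from one site of that vertex to the next. Non-overlapping means that no triangle is repeated and no edge is used by both a primary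 and a dual triangle. The ribbon operators are defined by $F_\tau^{h,g}|x\rangle=\delta_{g,y}|x\rangle$ for a primary triangle $\tau$ along whose edge one reads the group element $y$, by $F_\tau^{h,g}=\delta_{g,1}L^h$ for a dual triangle, where $L^h$ multiplies its edge by $h$ on the side of its vertex, and by $F^{h,g}_{\xi_1\xi_2}=\sum_{k\in G}F^{h,k}_{\xi_1}F^{k^{-1}hk,\,k^{-1}g}_{\xi_2}$. An anyon label $(C,\pi)$ consists of a conjugacy class $C$ of $G$ with a chosen representative $r_C$ and an irreducible unitary matrix representation $\Gamma_\pi$, of dimension $d_\pi$, of $E(C)=\{g\in G: gr_C=r_Cg\}$. Put $$F_\xi^{(C,\pi)}=\frac{d_\pi}{|E(C)|}\sum_{k\in E(C)}\bigl(\Gamma_\pi(k)^{-1}\bigr)_{1,1}\,F_\xi^{r_C^{-1},k}.$$ A local circuit of depth $t$ and range $\ell$ is a product of $t$ layers. Each layer is a product of unitary gates with pairwise disjoint supports, and each gate acts on a set of edges with mutual distances at most $\ell$ (edges sharing a vertex are neighbours, and distance is the path distance). We say that $\mathcal L$ is a square lattice out to distance $R$ around the site $s_1$ if its vertex is the centre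 of an embedded copy in $\mathcal L$ of the grid $[-R,R]^2\subset\mathbb Z^2$, that is: each of the $(2R+1)^2$ grid points is a vertex of degree four of $\mathcal L$, distinct grid points being distinct vertices; the four edge-ends at each of them point east, north, west and south in counterclockwise order; and neighbouring grid points are joined by the corresponding edges. **Theorem.** For every $\ell\in\mathbb N$ there is a constant $c>0$, depending only on $\ell$, with the following property. Let $G$, $\mathcal L$, $(C,\pi)$ be as above and suppose that $|\Gamma_\pi(r)_{1,1}|<1$ for some $r\in E(C)$. Let $\xi$ be a ribbon from $s_0$ to $s_1$, and suppose that $\mathcal L$ is a square lattice out to distance $R$ around $s_1$ and that the vertex of $s_0$ is not one of the points of this grid. Let $\Psi$ be a ground state, and let $U$ be a local circuit of range $\ell$ and depth $t$ such that $U\Psi$ is proportional to $F_\xi^{(C,\pi)}\Psi$. Then $$t\ \ge\ c\,R .$$ In other words, the circuit depth is extensive: it grows at least linearly with the linear size $R$ of the lattice region that surrounds one anyon and does not contain the other. -/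

import Mathlib

open scoped Matrix

namespace QuantumDouble

/-! ### The lattice -/

/-- A dart is an edge with a direction of travel: `(e, true)` runs along the chosen orientation of
the edge `e` (from tail to head), `(e, false)` runs against it. -/
abbrev Dart (E : Type*) := E × Bool

/-- The same edge travelled in the opposite direction. -/
def Dart.rev {E : Type*} (d : Dart E) : Dart E := (d.1, !d.2)

/-- A graph with oriented edges `E`, drawn on a closed oriented surface so that all faces are
discs. This is encoded by its rotation system: `next d` is the dart that follows `d` in
counterclockwise order among the darts leaving the starting point of `d`. Vertices are the orbits
of `next`, and plaquettes are the orbits of `faceNext` below. -/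
structure Lattice (E : Type*) where
  next : Equiv.Perm (Dart E)

namespace Lattice

variable {E : Type*} (L : Lattice E)

/-- The dart that follows `d` when one walks counterclockwise around the plaquette to the left
of `d`. -/
def faceNext (d : Dart E) : Dart E := L.next.symm d.rev

/-- Two darts start at the same vertex. -/
def SameVertex (d d' : Dart E) : Prop := L.next.SameCycle d d'

/-- Two distinct edges are neighbours if they share a vertex. -/
def edgeGraph : SimpleGraph E where
  Adj e e' := e ≠ e' ∧ ∃ b b' : Bool, L.SameVertex (e, b) (e', b')
  symm := ⟨fun _ _ h => ⟨h.1.symm, by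
    obtain ⟨b, b', hb⟩ := h.2
    exact ⟨b', b, hb.symm⟩⟩⟩
  loopless := ⟨fun _ h => h.1 rfl⟩

/-- A site `(v, p)` is a corner of the cell decomposition: a plaquette `p` together with one of
the corners of `p`, located at the vertex `v`. The corner between `d` and `next d`, which lies at
the starting point of `d` and in the plaquette to the left of `d`, is encoded by `d`. -/
abbrev Site (_ : Lattice E) := Dart E

end Lattice

/-! ### Operators on the qudits: one copy of `ℂ^G` for every edge -/

section Operators

variable {E G : Type*} [Group G]

/-- The group element that the basis configuration `x` assigns to a dart: reversing an edge
replaces `g` by `g⁻¹`. -/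
def val (x : E → G) (d : Dart E) : G := if d.2 then x d.1 else (x d.1)⁻¹

variable [Fintype E] [DecidableEq E] [Fintype G] [DecidableEq G]

/-- Operators on the Hilbert space `⨂_{e ∈ E} ℂ^G`, in the orthonormal basis `|x⟩`, `x : E → G`. -/
abbrev Op (E G : Type*) := Matrix (E → G) (E → G) ℂ

/-- State vectors, as families of amplitudes in the basis `|x⟩`, `x : E → G`. -/
abbrev Vec (E G : Type*) := (E → G) → ℂ

/-- The operator `|y⟩ ↦ |f y⟩`. -/
def moveOp (f : (E → G) → (E → G)) : Op E G := fun x y => if x = f y then 1 else 0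

/-- The operator `|x⟩ ↦ δ_{f x, g} |x⟩`. -/
def testOp (f : (E → G) → G) (g : G) : Op E G := Matrix.diagonal fun x => if f x = g then 1 else 0

namespace Lattice

variable (L : Lattice E)

open Classical in
/-- Every edge at the vertex of `s` is multiplied by `k` on the side of that vertex. -/
noncomputable def vertexAct (s : L.Site) (k : G) (x : E → G) : E → G := fun e =>
  (if L.SameVertex s (e, true) then k else 1) * x e *
    (if L.SameVertex s (e, false) then k⁻¹ else 1)

/-- The site-operator `A_s^k`. -/
noncomputable def siteA (s : L.Site) (k : G) : Op E G := moveOp (L.vertexAct s k)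

/-- The product of the group elements around the plaquette of the site `s`, counterclockwise from
the vertex of `s`. -/
noncomputable def holonomy (s : L.Site) (x : E → G) : G :=
  ((List.range (Function.minimalPeriod L.faceNext s)).map
    fun i => val x (L.faceNext^[i] s)).prod

/-- The site-operator `B_s^h`. -/
noncomputable def siteB (s : L.Site) (h : G) : Op E G := testOp (L.holonomy s) h

/-- The vertex operator `A_s = |G|⁻¹ ∑_g A_s^g`. -/
noncomputable def vertexOp (G : Type*) [Group G] [Fintype G] [DecidableEq G] (s : L.Site) :
    Op E G := (Fintype.card G : ℂ)⁻¹ • ∑ g : G, L.siteA s g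

/-- The plaquette operator `B_s = B_s^1`. -/
noncomputable def plaquetteOp (G : Type*) [Group G] [Fintype G] [DecidableEq G] (s : L.Site) :
    Op E G := L.siteB s 1

/-- Ground states of `H = -∑_v A_v - ∑_p B_p`: nonzero vectors in the common eigenspace with
eigenvalue `1` of all (commuting) vertex and plaquette operators. -/
def IsGroundState (ψ : Vec E G) : Prop :=
  ψ ≠ 0 ∧ ∀ s : L.Site, L.vertexOp G s *ᵥ ψ = ψ ∧ L.plaquetteOp G s *ᵥ ψ = ψ

end Lattice

/-! ### Ribbons and ribbon operators -/

/-- A primary triangle is a pair of an edge and an adjacent plaquette; it is encoded by the dart on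
that edge which has the plaquette on its right. A dual triangle is a pair of an edge and one of
its endpoints; it is encoded by the dart on that edge which starts at this endpoint. -/
structure Triangle (E : Type*) where
  isDual : Bool
  dart : Dart E

namespace Lattice

/-- The site at which a triangle starts. -/
def triangleStart {E : Type*} (L : Lattice E) (τ : Triangle E) : L.Site := L.next.symm τ.dart

/-- The site at which a triangle ends: a primary triangle keeps the plaquette and moves along its
dart to the next vertex, a dual triangle keeps the vertex and moves across its dart to the next
plaquette. -/
def triangleEnd {E : Type*} (L : Lattice E) (τ : Triangle E) : L.Site :=
  if τ.isDual then τ.dart else τ.dart.rev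

/-- Contiguous sequences of triangles from the site `s₀` to the site `s₁`. -/
def IsStrip {E : Type*} (L : Lattice E) : L.Site → L.Site → List (Triangle E) → Prop
  | s₀, s₁, [] => s₀ = s₁
  | s₀, s₁, τ :: ξ => L.triangleStart τ = s₀ ∧ L.IsStrip (L.triangleEnd τ) s₁ ξ

/-- Ribbons: strips whose triangles do not overlap. No triangle occurs twice, and no edge carries
both a primary and a dual triangle. -/
def IsRibbon {E : Type*} (L : Lattice E) (s₀ s₁ : L.Site) (ξ : List (Triangle E)) : Prop :=
  L.IsStrip s₀ s₁ ξ ∧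
    ξ.Pairwise fun τ τ' => τ ≠ τ' ∧ (τ.dart.1 = τ'.dart.1 → τ.isDual = τ'.isDual)

end Lattice

/-- Multiply the edge of `d` by `h` on the side of the starting point of `d`. -/
def multDart (d : Dart E) (h : G) (x : E → G) : E → G :=
  Function.update x d.1 (if d.2 then h * x d.1 else x d.1 * h⁻¹)

/-- The operator `F_τ^{h,g}` of a single triangle. -/
def triangleOp (τ : Triangle E) (h g : G) : Op E G :=
  if τ.isDual then (if g = 1 then moveOp (multDart τ.dart h) else 0)
  else testOp (fun x => val x τ.dart) g

/-- The basic ribbon operator `F_ξ^{h,g}`, by the comultiplication rule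
`F_{ξ₁ξ₂}^{h,g} = ∑_k F_{ξ₁}^{h,k} F_{ξ₂}^{k⁻¹hk, k⁻¹g}`. -/
def ribbonOp : List (Triangle E) → G → G → Op E G
  | [], _, g => if g = 1 then 1 else 0
  | τ :: ξ, h, g => ∑ k : G, triangleOp τ h k * ribbonOp ξ (k⁻¹ * h * k) (k⁻¹ * g)

end Operators

/-! ### Anyon labels and anyonic ribbon operators -/

/-- The representation on `ℂⁿ` given by unitary matrices. -/
noncomputable def matrixRep {H : Type*} [Group H] {n : ℕ}
    (Γ : H →* Matrix.unitaryGroup (Fin n) ℂ) : Representation ℂ H (Fin n → ℂ) :=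
  ((Matrix.toLinAlgEquiv' : Matrix (Fin n) (Fin n) ℂ ≃ₐ[ℂ] _) :
    Matrix (Fin n) (Fin n) ℂ →* ((Fin n → ℂ) →ₗ[ℂ] (Fin n → ℂ))).comp
      ((Submonoid.subtype _).comp Γ)

/-- An anyon label `(C, π)`: a conjugacy class `C` with a chosen representative `r_C`, and an
irreducible unitary matrix representation `Γ_π` of the centralizer `E(C) = {g | g r_C = r_C g}`. -/
structure AnyonLabel (G : Type*) [Group G] where
  C : ConjClasses G
  r : G
  r_mem : r ∈ C.carrier
  dim : ℕ
  neZero : NeZero dim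
  Γ : Subgroup.centralizer ({r} : Set G) →* Matrix.unitaryGroup (Fin dim) ℂ
  irreducible : (matrixRep Γ).IsIrreducible

attribute [instance] AnyonLabel.neZero

/-- The matrix entry `Γ_π(k)_{1,1}`. -/
def AnyonLabel.entry {G : Type*} [Group G] (ρ : AnyonLabel G)
    (k : Subgroup.centralizer ({ρ.r} : Set G)) : ℂ :=
  (ρ.Γ k : Matrix (Fin ρ.dim) (Fin ρ.dim) ℂ) 0 0

open Classical in
/-- The anyonic ribbon operator
`F_ξ^{(C,π)} = d_π / |E(C)| ∑_{k ∈ E(C)} (Γ_π⁻¹(k))_{1,1} F_ξ^{r_C⁻¹, k}`. -/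
noncomputable def anyonRibbonOp {E G : Type*} [Fintype E] [DecidableEq E] [Group G] [Fintype G]
    [DecidableEq G] (ρ : AnyonLabel G) (ξ : List (Triangle E)) : Op E G :=
  ((ρ.dim : ℂ) / (Nat.card (Subgroup.centralizer ({ρ.r} : Set G)) : ℂ)) •
    ∑ k : Subgroup.centralizer ({ρ.r} : Set G), ρ.entry k⁻¹ • ribbonOp ξ ρ.r⁻¹ (k : G)

/-! ### Local unitary circuits -/

section Circuits

variable {E G : Type*} [Fintype E] [DecidableEq E] [Fintype G] [DecidableEq G]

/-- `W` is of the form `w ⊗ 1` with `w` acting on the qudits in `S` only. -/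
def ActsOn (S : Finset E) (W : Op E G) : Prop :=
  ∃ w : Matrix (S → G) (S → G) ℂ, ∀ x y : E → G,
    W x y = if ∀ e, e ∉ S → x e = y e then w (fun e => x e) (fun e => y e) else 0

/-- A unitary gate of range `ℓ`: it acts on a set of qudits whose mutual distances are at
most `ℓ`. -/
def Lattice.IsGate (L : Lattice E) (ℓ : ℕ) (S : Finset E) (W : Op E G) : Prop :=
  W ∈ Matrix.unitaryGroup (E → G) ℂ ∧ ActsOn S W ∧
    ∀ e ∈ S, ∀ e' ∈ S, L.edgeGraph.edist e e' ≤ (ℓ : ℕ∞)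

/-- A layer: a product of gates of range `ℓ` with pairwise disjoint supports. -/
def Lattice.IsLayer (L : Lattice E) (ℓ : ℕ) (V : Op E G) : Prop :=
  ∃ gates : List (Finset E × Op E G), (∀ g ∈ gates, L.IsGate ℓ g.1 g.2) ∧
    gates.Pairwise (fun g g' => Disjoint g.1 g'.1) ∧ V = (gates.map Prod.snd).prod

/-- `U` is realized by a local unitary circuit of depth `t` with gates of range `ℓ`. -/
def Lattice.IsLocalCircuit (L : Lattice E) (ℓ t : ℕ) (U : Op E G) : Prop :=
  ∃ layers : List (Op E G), layers.length = t ∧ (∀ V ∈ layers, L.IsLayer ℓ V) ∧ U = layers.prod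

end Circuits

/-! ### Square-lattice neighbourhoods -/

/-- The vertices of `ℤ²` at sup-distance at most `R` from the origin. -/
def box (R : ℕ) : Set (ℤ × ℤ) := {p | |p.1| ≤ (R : ℤ) ∧ |p.2| ≤ (R : ℤ)}

/-- The unit steps of `ℤ²` in counterclockwise order: east, north, west, south. -/
def unitStep : Fin 4 → ℤ × ℤ := ![(1, 0), (0, 1), (-1, 0), (0, -1)]

/-- Around the vertex of the site `s`, the lattice is a square lattice out to distance `R`:
`dart p k` is the dart that leaves the grid point `p ∈ box R` in direction `k`. -/
structure Lattice.SquarePatch {E : Type*} (L : Lattice E) (s : L.Site) (R : ℕ) where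
  dart : ℤ × ℤ → Fin 4 → Dart E
  center : dart 0 0 = s
  inj : ∀ p ∈ box R, ∀ q ∈ box R, ∀ k l : Fin 4, dart p k = dart q l → p = q ∧ k = l
  next_dart : ∀ p ∈ box R, ∀ k : Fin 4, L.next (dart p k) = dart p (k + 1)
  rev_dart : ∀ p ∈ box R, ∀ k : Fin 4, p + unitStep k ∈ box R →
    (dart p k).rev = dart (p + unitStep k) (k + 2)

end QuantumDouble

/-! Suppose that a shallow circuit `U` takes the ground state `Ψ` to a multiple of `Φ`, the state
with flux `h = r_C⁻¹` and a charge vector `u` at the centre of the patch. The configurations in the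
support of `Φ` are flat on the patch except at one plaquette, so each has a potential `κ` with `κ 0
= 1` and a cut along the positive axis (`exists_isFluxPotential_of_ribbonState_ne_zero`). Gauge
transformations that are trivial at the centre fix `Φ`, and an element of `E(C)` at the centre acts
on `u` through `Γ` (`ribbonState_gact`).

Fix `k` commuting with `h`, and a point `b` far from the centre. `twistState` acts at the centre
with `k` conjugated by the transporter `(κ b)⁻¹`; it exchanges charge between the centre and `b`. By
gauge invariance this action can be spread over any region `W` that contains the centre but not `b`,
and then only edges across the boundary of `W` change. Choosing `W` suitably makes the twist
invisible to a given projection (`mulVec_twistState`). Now the stabilizers of `Ψ`, conjugated with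
`U`, fix `Φ`, and they are still local by the light cone (`Lattice.IsLocalCircuit.conj_local`). So
they fix the twisted state when they sit on small squares away from `b`, or on an annulus that
encloses both the centre and `b`. Undoing the circuit gives a state with no excitation outside a
hole at `b` and with trivial total charge (`vacuum_conjTranspose_mulVec`).

On an annulus around the hole all such states look like `Ψ`: a projection there that fixes `Ψ` fixes
each of them (`Vacuum.mulVec_eq`). The annulus projection around `b` alone fixes `Φ`, so its
pullback by `U` fixes `Ψ`, hence also the untwisted-by-`U` state. Therefore the twisted state
carries no charge at `b` either. This frees the value of `κ b`, so all `g * k * g⁻¹` with `g`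
commuting with `h` act at the centre of `Φ` in the same way (`Excited.apply_conj`).

In terms of the representation, `Γ (e * k * e⁻¹)` and `Γ k` agree on the nonzero vector `u`.
Irreducibility and Schur's lemma then make every `Γ r` a scalar of modulus one
(`norm_entry_eq_one_of_conj`), against `|Γ(r)₁₁| < 1`. -/

set_option linter.unusedSectionVars false

namespace QuantumDouble

/-! ### Local operators -/

section Locality

variable {E G : Type*}

/-- The operator `W` acts on the qudits in `S` only, expressed through matrix entries. -/
def LocalOn (S : Set E) (W : Op E G) : Prop :=
  (∀ x y, W x y ≠ 0 → ∀ e ∉ S, x e = y e) ∧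
  ∀ x y x' y' : E → G, (∀ e ∈ S, x e = x' e) → (∀ e ∈ S, y e = y' e) → (∀ e ∉ S, x e = y e) →
    (∀ e ∉ S, x' e = y' e) → W x y = W x' y'

theorem ActsOn.localOn [Fintype E] [DecidableEq E] [Fintype G] [DecidableEq G] {S : Finset E} {W : Op E G} (h : ActsOn S W) : LocalOn (S : Set E) W := by
  classical
  obtain ⟨w, hw⟩ := h
  refine ⟨fun x y hxy e he => ?_, fun x y x' y' h1 h2 h3 h4 => ?_⟩
  · rw [hw] at hxy
    by_contra hne
    exact hxy (if_neg fun h => hne (h e (by simpa using he)))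
  · rw [hw, hw, if_pos (fun e he => h3 e (by simpa using he)),
      if_pos (fun e he => h4 e (by simpa using he))]
    congr 1
    · ext e; exact h1 e e.2
    · ext e; exact h2 e e.2

theorem LocalOn.mono {S T : Set E} {W : Op E G} (h : LocalOn S W) (hST : S ⊆ T) :
    LocalOn T W := by
  refine ⟨fun x y hxy e he => h.1 x y hxy e fun h' => he (hST h'),
    fun x y x' y' h1 h2 h3 h4 => ?_⟩
  by_cases hxy : ∀ e ∉ S, x e = y e
  · have hxy' : ∀ e ∉ S, x' e = y' e := by
      intro e he
      by_cases heT : e ∈ T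
      · rw [← h1 e heT, ← h2 e heT, hxy e he]
      · exact h4 e heT
    exact h.2 x y x' y' (fun e he => h1 e (hST he)) (fun e he => h2 e (hST he)) hxy hxy'
  · have hxy' : ¬ ∀ e ∉ S, x' e = y' e := by
      intro hh
      apply hxy
      intro e he
      by_cases heT : e ∈ T
      · rw [h1 e heT, h2 e heT, hh e he]
      · exact h3 e heT
    have a1 : W x y = 0 := by
      by_contra hne; exact hxy (h.1 x y hne)
    have a2 : W x' y' = 0 := by
      by_contra hne; exact hxy' (h.1 x' y' hne)
    rw [a1, a2]

theorem LocalOn.conjTranspose {S : Set E} {W : Op E G} (h : LocalOn S W) : LocalOn S Wᴴ := by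
  refine ⟨fun x y hxy e he => ?_, fun x y x' y' h1 h2 h3 h4 => ?_⟩
  · rw [Matrix.conjTranspose_apply] at hxy
    exact (h.1 y x (fun h0 => hxy (by rw [h0, star_zero])) e he).symm
  · rw [Matrix.conjTranspose_apply, Matrix.conjTranspose_apply,
      h.2 y x y' x' h2 h1 (fun e he => (h3 e he).symm) (fun e he => (h4 e he).symm)]

/-- The edges within distance `r` of the set `S`. -/
def Lattice.nbhd (L : Lattice E) (r : ℕ) (S : Set E) : Set E :=
  {e | ∃ s ∈ S, L.edgeGraph.edist s e ≤ (r : ℕ∞)}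

theorem Lattice.subset_nbhd (L : Lattice E) (r : ℕ) (S : Set E) : S ⊆ L.nbhd r S :=
  fun e he => ⟨e, he, by simp⟩

theorem Lattice.nbhd_nbhd (L : Lattice E) (r r' : ℕ) (S : Set E) :
    L.nbhd r (L.nbhd r' S) ⊆ L.nbhd (r + r') S := by
  rintro e ⟨s, ⟨s', hs', h'⟩, h⟩
  refine ⟨s', hs', (SimpleGraph.edist_triangle (v := s)).trans ?_⟩
  rw [add_comm r r', Nat.cast_add]
  exact add_le_add h' h

variable [Fintype E] [DecidableEq E] [Fintype G]

open Classical in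
theorem LocalOn.mul [Group G] {S : Set E} {W V : Op E G} (hW : LocalOn S W) (hV : LocalOn S V) :
    LocalOn S (W * V) := by
  refine ⟨fun x y hxy e he => ?_, fun x y x' y' h1 h2 h3 h4 => ?_⟩
  · rw [Matrix.mul_apply] at hxy
    obtain ⟨z, -, hz⟩ := Finset.exists_ne_zero_of_sum_ne_zero hxy
    rw [hW.1 x z (left_ne_zero_of_mul hz) e he, hV.1 z y (right_ne_zero_of_mul hz) e he]
  · rw [Matrix.mul_apply, Matrix.mul_apply]
    -- Translating by `x⁻¹ x'` off `S` carries the intermediate configurations that agree with `x`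
    -- there to those that agree with `x'`.
    let φ : (E → G) ≃ (E → G) := Equiv.piCongrRight fun e =>
      if e ∈ S then Equiv.refl G else Equiv.mulRight ((x e)⁻¹ * x' e)
    have φS : ∀ z, ∀ e ∈ S, φ z e = z e := fun z e he => by simp [φ, he]
    have φS' : ∀ z, ∀ e ∉ S, φ z e = z e * ((x e)⁻¹ * x' e) := fun z e he => by simp [φ, he, mul_assoc]
    refine Fintype.sum_equiv φ _ _ fun z => ?_
    by_cases hz : ∀ e ∉ S, x e = z e
    · have hz' : ∀ e ∉ S, x' e = φ z e := fun e he => by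
        rw [φS' z e he, ← hz e he, mul_inv_cancel_left]
      rw [hW.2 x z x' (φ z) h1 (fun e he => (φS z e he).symm) hz hz',
        hV.2 z y (φ z) y' (fun e he => (φS z e he).symm) h2
          (fun e he => by rw [← hz e he, h3 e he]) (fun e he => by rw [← hz' e he, h4 e he])]
    · have hz' : ¬ ∀ e ∉ S, x' e = φ z e := by
        intro hh
        apply hz
        intro e he
        have := hh e he
        rw [φS' z e he] at this
        rw [← mul_assoc] at this
        exact (mul_inv_eq_one.1 (right_eq_mul.1 this)).symm
      have a1 : W x z = 0 := by
        by_contra hne; exact hz (hW.1 x z hne)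
      have a2 : W x' (φ z) = 0 := by
        by_contra hne; exact hz' (hW.1 x' _ hne)
      rw [a1, a2, zero_mul, zero_mul]

open Classical in
-- In either product at most one intermediate configuration contributes: the hybrid of `x` and `y`
-- in which only the first operator to act has changed its own support.
theorem LocalOn.mul_comm_of_disjoint {S T : Set E} {W V : Op E G} (hW : LocalOn S W)
    (hV : LocalOn T V) (hST : Disjoint S T) : W * V = V * W := by
  ext x y
  rw [Matrix.mul_apply, Matrix.mul_apply]
  have hT : ∀ e, e ∈ S → e ∉ T := fun e h1 h2 => Set.disjoint_left.1 hST h1 h2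
  rw [Finset.sum_eq_single (fun e => if e ∈ S then y e else x e),
    Finset.sum_eq_single (fun e => if e ∈ T then y e else x e)]
  · by_cases hxy : ∀ e, e ∉ S → e ∉ T → x e = y e
    · rw [mul_comm]
      congr 1
      · apply hV.2
        · intro e he; simp [show e ∉ S from fun h => hT e h he]
        · intro e he; simp [he]
        · intro e he
          by_cases heS : e ∈ S <;> simp [heS]
          exact hxy e heS he
        · intro e he; simp [he]
      · apply hW.2
        · intro e he; simp [hT e he]
        · intro e he; simp [he]
        · intro e he; simp [he]
        · intro e he
          by_cases heS : e ∈ T <;> simp [heS]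
          exact hxy e he heS
    · have a1 : ∀ z, W x z * V z y = 0 := by
        intro z
        by_contra hne
        exact hxy fun e h1 h2 => (hW.1 x z (left_ne_zero_of_mul hne) e h1).trans
          (hV.1 z y (right_ne_zero_of_mul hne) e h2)
      have a2 : ∀ z, V x z * W z y = 0 := by
        intro z
        by_contra hne
        exact hxy fun e h1 h2 => (hV.1 x z (left_ne_zero_of_mul hne) e h2).trans
          (hW.1 z y (right_ne_zero_of_mul hne) e h1)
      rw [a1, a2]
  · intro z _ hz
    by_contra hne
    apply hz
    ext e
    by_cases heT : e ∈ T
    · have heS : e ∉ S := fun h => hT e h heT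
      simp only [heT, if_true]
      exact hW.1 z y (right_ne_zero_of_mul hne) e heS
    · simp only [heT, if_false]
      exact (hV.1 x z (left_ne_zero_of_mul hne) e heT).symm
  · simp
  · intro z _ hz
    by_contra hne
    apply hz
    ext e
    by_cases heS : e ∈ S
    · simp only [heS, if_true]
      exact hV.1 z y (right_ne_zero_of_mul hne) e (hT e heS)
    · simp only [heS, if_false]
      exact (hW.1 x z (left_ne_zero_of_mul hne) e heS).symm
  · simp

end Locality

/-! ### Light cones of local circuits -/

section Layers

variable {E G : Type*} [Fintype E] [DecidableEq E] [Fintype G] [DecidableEq G] [Group G]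
  {L : Lattice E} {ℓ t : ℕ}

theorem Lattice.IsGate.conj_local {T : Finset E} {W M : Op E G} {S : Set E} (hW : L.IsGate ℓ T W)
    (hM : LocalOn S M) (hST : Disjoint (T : Set E) S) : W * M * Wᴴ = M := by
  rw [hW.2.1.localOn.mul_comm_of_disjoint hM hST, mul_assoc,
    show W * Wᴴ = 1 from (Matrix.mem_unitaryGroup_iff.1 hW.1), mul_one]

/-- A gate that misses `S` also misses the supports of the other gates, so it commutes with
everything inside and cancels against its adjoint. Only gates that meet `S` enlarge the support, and
each does so by its own support alone; there is no chaining within a layer. -/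
theorem gates_conj_local {S : Set E} {M : Op E G} (hM : LocalOn S M) :
    ∀ gates : List (Finset E × Op E G), (∀ g ∈ gates, L.IsGate ℓ g.1 g.2) →
      gates.Pairwise (fun g g' => Disjoint g.1 g'.1) →
      LocalOn (S ∪ {e | ∃ g ∈ gates, e ∈ g.1 ∧ ∃ s ∈ S, s ∈ g.1})
        ((gates.map Prod.snd).prod * M * ((gates.map Prod.snd).prod)ᴴ) := by
  intro gates
  induction gates with
  | nil => intro _ _; simpa using hM
  | cons g gates ih =>
    intro hg hp
    rw [List.pairwise_cons] at hp
    have ih := ih (fun g' hg' => hg g' (List.mem_cons_of_mem _ hg')) hp.2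
    have hgate := hg g List.mem_cons_self
    rw [List.map_cons, List.prod_cons, Matrix.conjTranspose_mul]
    set V := (gates.map Prod.snd).prod
    have e1 : g.2 * V * M * (Vᴴ * g.2ᴴ) = g.2 * (V * M * Vᴴ) * g.2ᴴ := by
      simp only [mul_assoc]
    rw [e1]
    have sub : (S ∪ {e | ∃ g' ∈ gates, e ∈ g'.1 ∧ ∃ s ∈ S, s ∈ g'.1}) ⊆
        (S ∪ {e | ∃ g' ∈ g :: gates, e ∈ g'.1 ∧ ∃ s ∈ S, s ∈ g'.1}) := by
      rintro e (he | ⟨g', hg', he⟩)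
      · exact Or.inl he
      · exact Or.inr ⟨g', List.mem_cons_of_mem _ hg', he⟩
    by_cases hd : Disjoint (g.1 : Set E) S
    · rw [Lattice.IsGate.conj_local hgate ih]
      · exact ih.mono sub
      · rw [Set.disjoint_union_right]
        refine ⟨hd, Set.disjoint_left.2 ?_⟩
        rintro e he ⟨g', hg', he', -⟩
        exact Finset.disjoint_left.1 (hp.1 g' hg') he he'
    · obtain ⟨s, hs1, hs2⟩ := Set.not_disjoint_iff.1 hd
      have hgl : LocalOn (S ∪ {e | ∃ g' ∈ g :: gates, e ∈ g'.1 ∧ ∃ s ∈ S, s ∈ g'.1}) g.2 :=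
        hgate.2.1.localOn.mono fun e he =>
          Or.inr ⟨g, List.mem_cons_self, he, s, hs2, hs1⟩
      exact (hgl.mul (ih.mono sub)).mul hgl.conjTranspose

theorem Lattice.IsLayer.conj_local {S : Set E} {V M : Op E G} (hV : L.IsLayer ℓ V) (hM : LocalOn S M) :
    LocalOn (L.nbhd ℓ S) (V * M * Vᴴ) := by
  obtain ⟨gates, h1, h2, rfl⟩ := hV
  refine (gates_conj_local hM gates h1 h2).mono ?_
  rintro e (he | ⟨g, hg, he, s, hs, hsg⟩)
  · exact L.subset_nbhd ℓ S he
  · exact ⟨s, hs, (h1 g hg).2.2 s hsg e he⟩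

theorem ActsOn.conjTranspose {T : Finset E} {W : Op E G} (h : ActsOn T W) : ActsOn T Wᴴ := by
  obtain ⟨w, hw⟩ := h
  refine ⟨wᴴ, fun x y => ?_⟩
  rw [Matrix.conjTranspose_apply, hw]
  by_cases hxy : ∀ e, e ∉ T → x e = y e
  · rw [if_pos hxy, if_pos (fun e he => (hxy e he).symm), Matrix.conjTranspose_apply]
  · rw [if_neg hxy, if_neg (fun h => hxy fun e he => (h e he).symm), star_zero]

theorem Lattice.IsLayer.conjTranspose {V : Op E G} (hV : L.IsLayer ℓ V) : L.IsLayer ℓ Vᴴ := by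
  obtain ⟨gates, h1, h2, rfl⟩ := hV
  refine ⟨(gates.map fun g => (g.1, g.2ᴴ)).reverse, ?_, ?_, ?_⟩
  · intro g hg
    rw [List.mem_reverse, List.mem_map] at hg
    obtain ⟨g', hg', rfl⟩ := hg
    exact ⟨Unitary.star_mem (h1 g' hg').1, (h1 g' hg').2.1.conjTranspose, (h1 g' hg').2.2⟩
  · rw [List.pairwise_reverse, List.pairwise_map]
    exact h2.imp fun h => h.symm
  · rw [Matrix.conjTranspose_list_prod, List.map_reverse, List.map_map, List.map_map]
    rfl

theorem Lattice.IsLayer.mem_unitary {V : Op E G} (hV : L.IsLayer ℓ V) :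
    V ∈ Matrix.unitaryGroup (E → G) ℂ := by
  obtain ⟨gates, h1, -, rfl⟩ := hV
  refine Submonoid.list_prod_mem _ fun W hW => ?_
  obtain ⟨g, hg, rfl⟩ := List.mem_map.1 hW
  exact (h1 g hg).1

theorem Lattice.IsLocalCircuit.mem_unitary {U : Op E G} (hU : L.IsLocalCircuit ℓ t U) :
    U ∈ Matrix.unitaryGroup (E → G) ℂ := by
  obtain ⟨layers, -, h, rfl⟩ := hU
  exact Submonoid.list_prod_mem _ fun V hV => (h V hV).mem_unitary

theorem Lattice.IsLocalCircuit.conjTranspose {U : Op E G} (hU : L.IsLocalCircuit ℓ t U) :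
    L.IsLocalCircuit ℓ t Uᴴ := by
  obtain ⟨layers, h1, h2, rfl⟩ := hU
  refine ⟨(layers.map Matrix.conjTranspose).reverse, by simpa using h1, ?_, ?_⟩
  · intro V hV
    rw [List.mem_reverse, List.mem_map] at hV
    obtain ⟨V', hV', rfl⟩ := hV
    exact (h2 V' hV').conjTranspose
  · rw [Matrix.conjTranspose_list_prod]

/-- Conjugation with a local circuit enlarges supports by at most `t * ℓ`. -/
theorem Lattice.IsLocalCircuit.conj_local {S : Set E} {U M : Op E G} (hU : L.IsLocalCircuit ℓ t U)
    (hM : LocalOn S M) : LocalOn (L.nbhd (t * ℓ) S) (U * M * Uᴴ) := by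
  obtain ⟨layers, rfl, h2, rfl⟩ := hU
  induction layers with
  | nil => simpa using hM.mono (L.subset_nbhd 0 S)
  | cons V layers ih =>
    have ih := ih fun V' hV' => h2 V' (List.mem_cons_of_mem _ hV')
    have := (h2 V List.mem_cons_self).conj_local ih
    rw [List.prod_cons, Matrix.conjTranspose_mul]
    have e1 : V * layers.prod * M * (layers.prodᴴ * Vᴴ) =
      V * (layers.prod * M * layers.prodᴴ) * Vᴴ := by simp only [mul_assoc]
    rw [e1]
    refine this.mono ((L.nbhd_nbhd _ _ _).trans ?_)
    rw [List.length_cons, add_mul, one_mul, add_comm]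

end Layers

/-! ### Orthogonal projections -/

section Projections

variable {X : Type*} [Fintype X] [DecidableEq X]

/-- Orthogonal projections, as matrices. -/
def IsProj (P : Matrix X X ℂ) : Prop := Pᴴ = P ∧ P * P = P

theorem IsProj.conj {P U : Matrix X X ℂ} (hP : IsProj P) (hU : U ∈ Matrix.unitaryGroup X ℂ) :
    IsProj (U * P * Uᴴ) := by
  have hU' : Uᴴ * U = 1 := Matrix.mem_unitaryGroup_iff'.1 hU
  refine ⟨?_, ?_⟩
  · rw [Matrix.conjTranspose_mul, Matrix.conjTranspose_mul, Matrix.conjTranspose_conjTranspose,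
      hP.1, mul_assoc]
  · calc U * P * Uᴴ * (U * P * Uᴴ) = U * P * (Uᴴ * U) * P * Uᴴ := by simp only [mul_assoc]
      _ = U * (P * P) * Uᴴ := by rw [hU', mul_one, mul_assoc U P P]
      _ = _ := by rw [hP.2]

open scoped ComplexOrder in
/-- A projection fixes a vector as soon as it does not change its nonzero entries. -/
theorem IsProj.mulVec_eq_self {P : Matrix X X ℂ} (hP : IsProj P) {v : X → ℂ}
    (h : ∀ x, v x ≠ 0 → (P *ᵥ v) x = v x) : P *ᵥ v = v := by
  -- Entries outside the support of `v` drop out of this inner product; for a projection it already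
  -- determines `‖P v - v‖² = 0`.
  have h1 : star v ⬝ᵥ (P *ᵥ v) = star v ⬝ᵥ v := by
    refine Finset.sum_congr rfl fun x _ => ?_
    by_cases hx : v x = 0
    · simp [hx]
    · rw [h x hx]
  have h2 : star (P *ᵥ v) ⬝ᵥ v = star v ⬝ᵥ v := by
    rw [Matrix.star_mulVec, ← Matrix.dotProduct_mulVec, hP.1, h1]
  have h3 : star (P *ᵥ v) ⬝ᵥ (P *ᵥ v) = star v ⬝ᵥ v := by
    rw [Matrix.star_mulVec, ← Matrix.dotProduct_mulVec, hP.1, Matrix.mulVec_mulVec, hP.2, h1]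
  have h4 : star (P *ᵥ v - v) ⬝ᵥ (P *ᵥ v - v) = 0 := by
    rw [star_sub, sub_dotProduct, dotProduct_sub, dotProduct_sub, h1, h2, h3]
    ring
  exact sub_eq_zero.1 (dotProduct_star_self_eq_zero.1 h4)

open Classical in
/-- The projection onto the vectors that are supported on the domain of a partial equivalence
relation and constant on its classes. -/
noncomputable def relProj (r : X → X → Prop) : Matrix X X ℂ := fun x y =>
  if r x y then ((Finset.univ.filter fun z => r x z).card : ℂ)⁻¹ else 0

variable {r : X → X → Prop} (hs : ∀ x y, r x y → r y x) (ht : ∀ x y z, r x y → r y z → r x z)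

include hs ht in
theorem relProj_isProj : IsProj (relProj r) := by
  classical
  have key : ∀ x y, r x y → ∀ z, r x z ↔ r y z := fun x y h z =>
    ⟨fun h' => ht _ _ _ (hs _ _ h) h', fun h' => ht _ _ _ h h'⟩
  refine ⟨?_, ?_⟩
  · ext x y
    rw [Matrix.conjTranspose_apply]
    unfold relProj
    by_cases h : r x y
    · rw [if_pos h, if_pos (hs _ _ h)]
      simp [key x y h]
    · rw [if_neg h, if_neg fun h' => h (hs _ _ h'), star_zero]
  · ext x y
    rw [Matrix.mul_apply]
    by_cases h : r x y
    · have : ∀ z, relProj r x z * relProj r z y = if r x z then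
          ((Finset.univ.filter fun z => r x z).card : ℂ)⁻¹ *
            ((Finset.univ.filter fun z => r x z).card : ℂ)⁻¹ else 0 := by
        intro z
        unfold relProj
        by_cases hz : r x z
        · rw [if_pos hz, if_pos hz, if_pos ((key x z hz y).1 h)]
          simp [key x z hz]
        · rw [if_neg hz, if_neg hz, zero_mul]
      rw [Finset.sum_congr rfl fun z _ => this z, ← Finset.sum_filter, Finset.sum_const,
        nsmul_eq_mul]
      unfold relProj
      rw [if_pos h, ← mul_assoc, mul_inv_cancel₀, one_mul]
      exact Nat.cast_ne_zero.2 (Finset.card_pos.2 ⟨y, by simpa using h⟩).ne'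
    · have h0 : relProj r x y = 0 := if_neg h
      rw [h0]
      refine Finset.sum_eq_zero fun z _ => ?_
      unfold relProj
      by_cases hz : r x z
      · rw [if_neg fun h' => h (ht _ _ _ hz h'), mul_zero]
      · rw [if_neg hz, zero_mul]

include hs ht in
-- This translates stabilizer conditions into pointwise statements about amplitudes, the form in
-- which they are used for gauge, flatness and annulus projections.
theorem relProj_mulVec_eq_iff {v : X → ℂ} :
    relProj r *ᵥ v = v ↔ (∀ x, v x ≠ 0 → r x x) ∧ ∀ x y, r x y → v x = v y := by
  classical
  have key : ∀ x y, r x y → ∀ z, r x z ↔ r y z := fun x y h z =>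
    ⟨fun h' => ht _ _ _ (hs _ _ h) h', fun h' => ht _ _ _ h h'⟩
  constructor
  · intro h
    have hx : ∀ x, v x = ∑ y, relProj r x y * v y := fun x => (congrFun h x).symm
    refine ⟨fun x hne => ?_, fun x y hxy => ?_⟩
    · rw [hx x] at hne
      obtain ⟨y, -, hy⟩ := Finset.exists_ne_zero_of_sum_ne_zero hne
      have hxy : r x y := by
        by_contra h0
        exact hy (by unfold relProj; rw [if_neg h0, zero_mul])
      exact ht _ _ _ hxy (hs _ _ hxy)
    · rw [hx x, hx y]
      refine Finset.sum_congr rfl fun z _ => ?_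
      unfold relProj
      simp [key x y hxy]
  · rintro ⟨h1, h2⟩
    refine (relProj_isProj hs ht).mulVec_eq_self fun x hx => ?_
    have hxx := h1 x hx
    have : ∀ y, relProj r x y * v y = if r x y then
        ((Finset.univ.filter fun z => r x z).card : ℂ)⁻¹ * v x else 0 := by
      intro y
      unfold relProj
      by_cases hy : r x y
      · rw [if_pos hy, if_pos hy, h2 x y hy]
      · rw [if_neg hy, if_neg hy, zero_mul]
    calc (relProj r *ᵥ v) x = ∑ y, relProj r x y * v y := rfl
      _ = _ := by
        rw [Finset.sum_congr rfl fun y _ => this y, ← Finset.sum_filter, Finset.sum_const,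
          nsmul_eq_mul, ← mul_assoc, mul_inv_cancel₀, one_mul]
        exact Nat.cast_ne_zero.2 (Finset.card_pos.2 ⟨x, by simpa using hxx⟩).ne'

end Projections

/-- The entries involve the sizes of classes, so these must also depend only on the qudits in `S`; a
translation off `S` matches the two classes. -/
theorem relProj_localOn {E G : Type*} [Fintype E] [DecidableEq E] [Fintype G] [Group G]
    [DecidableEq G] {r : (E → G) → (E → G) → Prop} {S : Set E}
    (h1 : ∀ x y, r x y → ∀ e ∉ S, x e = y e)
    (h2 : ∀ x y x' y', r x y → (∀ e ∈ S, x e = x' e) → (∀ e ∈ S, y e = y' e) →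
      (∀ e ∉ S, x e = y e) → (∀ e ∉ S, x' e = y' e) → r x' y') :
    LocalOn S (relProj r) := by
  classical
  refine ⟨fun x y hxy => h1 x y ?_, fun x y x' y' a1 a2 a3 a4 => ?_⟩
  · by_contra h0
    exact hxy (if_neg h0)
  · have hiff : r x y ↔ r x' y' :=
      ⟨fun h => h2 x y x' y' h a1 a2 a3 a4, fun h => h2 x' y' x y h (fun e he => (a1 e he).symm)
        (fun e he => (a2 e he).symm) a4 a3⟩
    unfold relProj
    by_cases h : r x y
    · rw [if_pos h, if_pos (hiff.1 h)]
      congr 2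
      let φ : (E → G) ≃ (E → G) := Equiv.piCongrRight fun e =>
        if e ∈ S then Equiv.refl G else Equiv.mulRight ((x e)⁻¹ * x' e)
      have φS : ∀ z, ∀ e ∈ S, φ z e = z e := fun z e he => by simp [φ, he]
      have φS' : ∀ z, ∀ e ∉ S, φ z e = z e * ((x e)⁻¹ * x' e) := fun z e he => by
        simp [φ, he, mul_assoc]
      refine Finset.card_equiv φ fun z => ?_
      simp only [Finset.mem_filter, Finset.mem_univ, true_and]
      constructor
      · intro hz
        refine h2 x z x' (φ z) hz a1 (fun e he => (φS z e he).symm) (h1 x z hz) fun e he => ?_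
        rw [φS' z e he, ← h1 x z hz e he, mul_inv_cancel_left]
      · intro hz
        have hz' : ∀ e ∉ S, x e = z e := by
          intro e he
          have := h1 x' _ hz e he
          rw [φS' z e he, ← mul_assoc] at this
          exact (mul_inv_eq_one.1 (right_eq_mul.1 this)).symm
        exact h2 x' (φ z) x z hz (fun e he => (a1 e he).symm) (φS z) (h1 x' _ hz) hz'
    · rw [if_neg h, if_neg fun h' => h (hiff.2 h')]

/-! ### Lattice connections on squares in `ℤ²` -/

section Connections

/-- The points at sup-distance at most `r` from `b`. -/
def sq (b : ℤ × ℤ) (r : ℤ) : Set (ℤ × ℤ) :=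
  {p | b.1 - r ≤ p.1 ∧ p.1 ≤ b.1 + r ∧ b.2 - r ≤ p.2 ∧ p.2 ≤ b.2 + r}

theorem mem_sq {b p : ℤ × ℤ} {r : ℤ} :
    p ∈ sq b r ↔ b.1 - r ≤ p.1 ∧ p.1 ≤ b.1 + r ∧ b.2 - r ≤ p.2 ∧ p.2 ≤ b.2 + r := Iff.rfl

theorem eq_of_forall_step {α : Type*} {f : ℤ → α} {lo hi : ℤ}
    (h : ∀ i, lo ≤ i → i < hi → f i = f (i + 1)) {i j : ℤ} (hi1 : lo ≤ i) (hi2 : i ≤ hi)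
    (hj1 : lo ≤ j) (hj2 : j ≤ hi) : f i = f j := by
  have key : ∀ i, lo ≤ i → i ≤ hi → f lo = f i := by
    intro i hi
    induction i, hi using Int.leInduction with
    | base => intro _; rfl
    | succ k hk ih => intro hk'; rw [ih (by omega), h k hk (by omega)]
  rw [← key i hi1 hi2, key j hj1 hj2]

/-- Parallel transport along a line, solved by recursion in both directions from `i₀`. -/
theorem exists_potential {G : Type*} [Group G] (e : ℤ → G) (i₀ : ℤ) (c : G) :
    ∃ κ : ℤ → G, κ i₀ = c ∧ ∀ i, κ i = e i * κ (i + 1) := by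
  let f : ℕ → G := fun n => Nat.rec c (fun n x => (e (i₀ + n))⁻¹ * x) n
  let g : ℕ → G := fun n => Nat.rec c (fun n x => e (i₀ - (n + 1)) * x) n
  refine ⟨fun i => if i₀ ≤ i then f (i - i₀).toNat else g (i₀ - i).toNat, by simp [f], fun i => ?_⟩
  by_cases h : i₀ ≤ i
  · have e1 : (i + 1 - i₀).toNat = (i - i₀).toNat + 1 := by omega
    have e2 : i₀ + ((i - i₀).toNat : ℤ) = i := by omega
    have : f ((i - i₀).toNat + 1) = (e (i₀ + ((i - i₀).toNat : ℤ)))⁻¹ * f (i - i₀).toNat := rfl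
    simp only [h, if_true, show i₀ ≤ i + 1 by omega, e1, this, e2, mul_inv_cancel_left]
  · have e1 : (i₀ - i).toNat = (i₀ - (i + 1)).toNat + 1 := by omega
    have e2 : i₀ - (((i₀ - (i + 1)).toNat : ℤ) + 1) = i := by omega
    have h3 : g ((i₀ - (i + 1)).toNat + 1) =
      e (i₀ - (((i₀ - (i + 1)).toNat : ℤ) + 1)) * g (i₀ - (i + 1)).toNat := rfl
    by_cases h' : i₀ ≤ i + 1
    · have e3 : i + 1 = i₀ := by omega
      have e4 : (i₀ - i).toNat = 1 := by omega
      have : g 1 = e (i₀ - ((0 : ℕ) + 1)) * f 0 := rfl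
      simp only [h, if_false, e4, e3, sub_self, Int.toNat_zero, this, le_refl, if_true]
      congr 2
      push_cast; omega
    · simp only [h, if_false, h', e1, h3, e2]

variable {G : Type*} [Group G]

/-- `κ` is a potential on `V` of the connection with value `a p` on the eastward edge and `n p` on
the northward edge at `p`. -/
def IsPotential (V : Set (ℤ × ℤ)) (a n κ : ℤ × ℤ → G) : Prop :=
  (∀ i j, (i, j) ∈ V → (i + 1, j) ∈ V → a (i, j) = κ (i, j) * (κ (i + 1, j))⁻¹) ∧
  ∀ i j, (i, j) ∈ V → (i, j + 1) ∈ V → n (i, j) = κ (i, j) * (κ (i, j + 1))⁻¹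

/-- `κ` is a potential on the square of radius `R` around the origin, up to a flux `h` that enters
at the plaquette to the north-east of the origin and leaves along the positive axis. -/
def IsFluxPotential (R : ℤ) (h : G) (a n κ : ℤ × ℤ → G) : Prop :=
  κ (0, 0) = 1 ∧
  (∀ i j, (i, j) ∈ sq 0 R → (i + 1, j) ∈ sq 0 R → a (i, j) = κ (i, j) * (κ (i + 1, j))⁻¹) ∧
  ∀ i j, (i, j) ∈ sq 0 R → (i, j + 1) ∈ sq 0 R →
    n (i, j) = κ (i, j) * (if j = 0 ∧ 1 ≤ i then h else 1) * (κ (i, j + 1))⁻¹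

/-- Transport along the central column and then along the rows makes all horizontal edges and the
central column trivial. The remaining vertical defect is constant across flat plaquettes, so it
changes only at the plaquette with flux, which starts the cut. -/
theorem exists_isFluxPotential {R : ℤ} (hR : 1 ≤ R) {h : G} {a n : ℤ × ℤ → G}
    (hflat : ∀ i j, -R ≤ i → i < R → -R ≤ j → j < R → (i, j) ≠ (0, 0) →
      a (i, j) * n (i + 1, j) = n (i, j) * a (i, j + 1))
    (hflux : a (0, 0) * n (1, 0) = h * (n (0, 0) * a (0, 1))) :
    ∃ κ, IsFluxPotential R h a n κ := by
  obtain ⟨c, hc0, hc⟩ := exists_potential (fun j => n (0, j)) 0 1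
  choose κ hκ0 hκ using fun j => exists_potential (fun i => a (i, j)) 0 (c j)
  -- The value of the northward edge in the gauge `κ`.
  let δ : ℤ → ℤ → G := fun j i => (κ j i)⁻¹ * n (i, j) * κ (j + 1) i
  have hδ0 : ∀ j, δ j 0 = 1 := by
    intro j
    simp only [δ, hκ0]
    rw [hc j]; group
  have hδ : ∀ i j, a (i, j) * n (i + 1, j) = n (i, j) * a (i, j + 1) → δ j i = δ j (i + 1) := by
    intro i j hf
    simp only [δ]
    rw [hκ j i, hκ (j + 1) i, mul_inv_rev]
    calc _ = (κ j (i + 1))⁻¹ * (a (i, j))⁻¹ * (n (i, j) * a (i, j + 1)) * κ (j + 1) (i + 1) := by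
            simp only [mul_assoc]
      _ = _ := by rw [← hf]; group
  have hδ1 : δ 0 1 = h := by
    have e1 : κ 0 1 = (a (0, 0))⁻¹ := by
      have := hκ 0 0
      rw [hκ0, hc0, zero_add] at this
      exact eq_inv_of_mul_eq_one_right this.symm
    have e2 : κ 1 1 = (a (0, 1))⁻¹ * (n (0, 0))⁻¹ := by
      have h1 := hκ 1 0
      have h2 := hc 0
      rw [hκ0] at h1
      rw [hc0] at h2
      simp only [zero_add] at h1 h2
      rw [eq_inv_of_mul_eq_one_right h2.symm] at h1
      rw [h1]; group
    simp only [δ, zero_add]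
    rw [e1, e2, inv_inv, hflux]; group
  refine ⟨fun p => κ p.2 p.1, by simp [hκ0, hc0], fun i j _ _ => ?_, fun i j h1 h2 => ?_⟩
  · simp only [hκ j i]; group
  · simp only [mem_sq, Prod.fst_zero, Prod.snd_zero] at h1 h2
    have key : δ j i = if j = 0 ∧ 1 ≤ i then h else 1 := by
      by_cases hj : j = 0 ∧ 1 ≤ i
      · obtain ⟨rfl, hi⟩ := hj
        rw [if_pos ⟨rfl, hi⟩, ← hδ1]
        exact eq_of_forall_step (lo := 1) (hi := R) (fun i' h1' h2' => hδ i' 0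
          (hflat _ _ (by omega) (by omega) (by omega) (by omega) (by simp; omega)))
          hi (by omega) le_rfl hR
      · rw [if_neg hj, ← hδ0 j]
        by_cases hi : i ≤ 0
        · exact eq_of_forall_step (lo := -R) (hi := 0) (fun i' h1' h2' => hδ i' j
            (hflat _ _ (by omega) (by omega) (by omega) (by omega) (by simp; omega)))
            (by omega) (by omega) (by omega) le_rfl
        · exact eq_of_forall_step (lo := 0) (hi := R) (fun i' h1' h2' => hδ i' j
            (hflat _ _ (by omega) (by omega) (by omega) (by omega) (by simp; omega)))
            (by omega) (by omega) le_rfl (by omega)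
    rw [← key]
    simp only [δ]; group

/-- Constancy along the boundary of a square, cut open at one edge. -/
theorem ring_const {α : Type*} {f : ℤ × ℤ → α} {b : ℤ × ℤ} {q : ℤ}
    (h1 : ∀ i j, (i, j) ∈ sq b q → (i + 1, j) ∈ sq b q → (i, j) ∉ sq b (q - 1) →
      (i + 1, j) ∉ sq b (q - 1) → f (i, j) = f (i + 1, j))
    (h2 : ∀ i j, (i, j) ∈ sq b q → (i, j + 1) ∈ sq b q → (i, j) ∉ sq b (q - 1) →
      (i, j + 1) ∉ sq b (q - 1) → ¬ (j = b.2 ∧ b.1 < i) → f (i, j) = f (i, j + 1))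
    {p : ℤ × ℤ} (hp : p ∈ sq b q) (hp' : p ∉ sq b (q - 1)) : f p = f (b.1 - q, b.2 - q) := by
  obtain ⟨b1, b2⟩ := b
  obtain ⟨i, j⟩ := p
  simp only [mem_sq] at *
  have bottom : ∀ i, b1 - q ≤ i → i ≤ b1 + q → f (i, b2 - q) = f (b1 - q, b2 - q) := fun i hi hi' =>
    eq_of_forall_step (f := fun i => f (i, b2 - q)) (lo := b1 - q) (hi := b1 + q)
      (fun i' _ _ => h1 i' _ (by omega) (by omega) (by omega) (by omega)) hi hi' le_rfl (by omega)
  have left : ∀ j, b2 - q ≤ j → j ≤ b2 + q → f (b1 - q, j) = f (b1 - q, b2 - q) := fun j hj hj' =>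
    eq_of_forall_step (f := fun j => f (b1 - q, j)) (lo := b2 - q) (hi := b2 + q)
      (fun j' _ _ => h2 _ j' (by omega) (by omega) (by omega) (by omega) (by omega)) hj hj' le_rfl
      (by omega)
  have top : ∀ i, b1 - q ≤ i → i ≤ b1 + q → f (i, b2 + q) = f (b1 - q, b2 - q) := fun i hi hi' =>
    (eq_of_forall_step (f := fun i => f (i, b2 + q)) (lo := b1 - q) (hi := b1 + q)
      (fun i' _ _ => h1 i' _ (by omega) (by omega) (by omega) (by omega)) hi hi' le_rfl
      (by omega)).trans (left _ (by omega) (by omega))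
  by_cases c1 : j = b2 - q
  · subst c1; exact bottom i (by omega) (by omega)
  by_cases c2 : i = b1 - q
  · subst c2; exact left j (by omega) (by omega)
  by_cases c3 : j = b2 + q
  · subst c3; exact top i (by omega) (by omega)
  have c4 : i = b1 + q := by omega
  subst c4
  by_cases c5 : j ≤ b2
  · exact (eq_of_forall_step (f := fun j => f (b1 + q, j)) (lo := b2 - q) (hi := b2)
      (fun j' _ _ => h2 _ j' (by omega) (by omega) (by omega) (by omega) (by omega))
      (by omega) (by omega) le_rfl (by omega)).trans (bottom _ (by omega) (by omega))
  · exact (eq_of_forall_step (f := fun j => f (b1 + q, j)) (lo := b2 + 1) (hi := b2 + q)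
      (fun j' _ _ => h2 _ j' (by omega) (by omega) (by omega) (by omega) (by omega))
      (by omega) (by omega) (j := b2 + q) (by omega) (by omega)).trans (top _ (by omega) (by omega))

/-- A connection on a square annulus that is flat, and pure gauge along the outer boundary, is pure
gauge. -/
theorem exists_isPotential_annulus {b : ℤ × ℤ} {r N : ℤ} (hr : 0 ≤ r) (hN : r < N)
    {a n κ₀ : ℤ × ℤ → G}
    (hflat : ∀ i j, b.1 - N ≤ i → i < b.1 + N → b.2 - N ≤ j → j < b.2 + N → (i, j) ∉ sq b r →
      a (i, j) * n (i + 1, j) = n (i, j) * a (i, j + 1))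
    (h₀ : IsPotential (sq b N \ sq b (N - 1)) a n κ₀) :
    ∃ κ, IsPotential (sq b N \ sq b r) a n κ := by
  obtain ⟨b1, b2⟩ := b
  simp only [IsPotential, mem_sq, Set.mem_sdiff] at *
  obtain ⟨h0a, h0n⟩ := h₀
  -- Flatness alone would allow a holonomy around the hole. Two gauges are used, transported inwards
  -- from the left and the right side of the outer boundary, so that no row is transported through
  -- the hole; `κ₀` fixes their relative normalization.
  choose l hl0 hl using fun j => exists_potential (fun i => a (i, j)) (b1 - N) (κ₀ (b1 - N, j))
  choose m hm0 hm using fun j => exists_potential (fun i => a (i, j)) (b1 + N) (κ₀ (b1 + N, j))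
  have step : ∀ κ : ℤ → ℤ → G, (∀ j i, κ j i = a (i, j) * κ j (i + 1)) → ∀ i j,
      a (i, j) * n (i + 1, j) = n (i, j) * a (i, j + 1) →
      (κ j i)⁻¹ * n (i, j) * κ (j + 1) i = (κ j (i + 1))⁻¹ * n (i + 1, j) * κ (j + 1) (i + 1) := by
    intro κ hκ i j hf
    rw [hκ j i, hκ (j + 1) i, mul_inv_rev]
    calc _ = (κ j (i + 1))⁻¹ * (a (i, j))⁻¹ * (n (i, j) * a (i, j + 1)) * κ (j + 1) (i + 1) := by
            simp only [mul_assoc]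
      _ = _ := by rw [← hf]; group
  have one : ∀ x y z : G, x⁻¹ * z * y = 1 ↔ z = x * y⁻¹ := by
    intro x y z
    rw [mul_eq_one_iff_eq_inv, inv_mul_eq_iff_eq_mul]
  have left : ∀ i j, b1 - N ≤ i → i ≤ b1 → b2 - N ≤ j → j < b2 + N →
      ¬ (b1 - r ≤ i ∧ i ≤ b1 + r ∧ b2 - r ≤ j ∧ j ≤ b2 + r) →
      n (i, j) = l j i * (l (j + 1) i)⁻¹ := by
    intro i j h1 h2 h3 h4 h5
    rw [← one]
    rw [eq_of_forall_step (f := fun i => (l j i)⁻¹ * n (i, j) * l (j + 1) i) (lo := b1 - N)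
      (hi := i) (fun i' _ _ => step l hl i' j (hflat _ _ (by omega) (by omega) (by omega) (by omega)
        (by omega))) h1 le_rfl le_rfl h1, one, hl0, hl0]
    exact h0n _ _ (by omega) (by omega)
  have right : ∀ i j, b1 < i → i ≤ b1 + N → b2 - N ≤ j → j < b2 + N →
      ¬ (b1 - r ≤ i ∧ i ≤ b1 + r ∧ b2 - r ≤ j ∧ j ≤ b2 + r) →
      n (i, j) = m j i * (m (j + 1) i)⁻¹ := by
    intro i j h1 h2 h3 h4 h5
    rw [← one]
    rw [eq_of_forall_step (f := fun i => (m j i)⁻¹ * n (i, j) * m (j + 1) i) (lo := i)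
      (hi := b1 + N) (fun i' _ _ => step m hm i' j (hflat _ _ (by omega) (by omega) (by omega)
        (by omega) (by omega))) le_rfl h2 h2 le_rfl, one, hm0, hm0]
    exact h0n _ _ (by omega) (by omega)
  -- On the bottom and top rows both gauges coincide with `κ₀`, so they match across the middle
  -- column; `vert` carries this to the rows below and above the hole.
  have outer : ∀ j, (j = b2 - N ∨ j = b2 + N) → a (b1, j) = l j b1 * (m j (b1 + 1))⁻¹ := by
    intro j hj
    have e1 : (l j b1)⁻¹ * κ₀ (b1, j) = 1 := by
      rw [eq_of_forall_step (f := fun i => (l j i)⁻¹ * κ₀ (i, j)) (lo := b1 - N) (hi := b1)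
        (fun i' _ _ => ?_) (by omega) le_rfl (j := b1 - N) le_rfl (by omega), hl0, inv_mul_cancel]
      rw [hl j i', h0a i' j (by omega) (by omega)]; group
    have e2 : (m j (b1 + 1))⁻¹ * κ₀ (b1 + 1, j) = 1 := by
      rw [eq_of_forall_step (f := fun i => (m j i)⁻¹ * κ₀ (i, j)) (lo := b1 + 1) (hi := b1 + N)
        (fun i' _ _ => ?_) le_rfl (by omega) (j := b1 + N) (by omega) (by omega), hm0,
        inv_mul_cancel]
      rw [hm j i', h0a i' j (by omega) (by omega)]; group
    rw [h0a b1 j (by omega) (by omega), inv_mul_eq_one.1 e1, inv_mul_eq_one.1 e2]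
  have vert : ∀ j, b2 - N ≤ j → j < b2 + N → (j + 1 < b2 - r ∨ b2 + r < j) →
      (l j b1)⁻¹ * a (b1, j) * m j (b1 + 1) =
        (l (j + 1) b1)⁻¹ * a (b1, j + 1) * m (j + 1) (b1 + 1) := by
    intro j h1 h2 h3
    have f1 := left b1 j (by omega) (by omega) h1 h2 (by omega)
    have f2 := right (b1 + 1) j (by omega) (by omega) h1 h2 (by omega)
    have f3 := hflat b1 j (by omega) (by omega) h1 h2 (by omega)
    rw [f1, f2] at f3
    calc (l j b1)⁻¹ * a (b1, j) * m j (b1 + 1)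
        = (l j b1)⁻¹ * (a (b1, j) * (m j (b1 + 1) * (m (j + 1) (b1 + 1))⁻¹)) *
          m (j + 1) (b1 + 1) := by group
      _ = _ := by rw [f3]; group
  have mid : ∀ j, b2 - N ≤ j → j ≤ b2 + N → (j < b2 - r ∨ b2 + r < j) →
      a (b1, j) = l j b1 * (m j (b1 + 1))⁻¹ := by
    intro j h1 h2 h3
    rw [← one]
    rcases h3 with h3 | h3
    · rw [eq_of_forall_step (f := fun j => (l j b1)⁻¹ * a (b1, j) * m j (b1 + 1)) (lo := b2 - N)
        (hi := j) (fun j' _ _ => vert j' (by omega) (by omega) (by omega)) h1 le_rfl le_rfl h1, one]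
      exact outer _ (Or.inl rfl)
    · rw [eq_of_forall_step (f := fun j => (l j b1)⁻¹ * a (b1, j) * m j (b1 + 1)) (lo := j)
        (hi := b2 + N) (fun j' _ _ => vert j' (by omega) (by omega) (by omega)) le_rfl h2 h2 le_rfl,
        one]
      exact outer _ (Or.inr rfl)
  refine ⟨fun p => if p.1 ≤ b1 then l p.2 p.1 else m p.2 p.1, fun i j h1 h2 => ?_,
    fun i j h1 h2 => ?_⟩
  · by_cases c1 : i + 1 ≤ b1
    · simp only [c1, show i ≤ b1 by omega, if_true]
      rw [hl j i]; group
    · by_cases c2 : i ≤ b1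
      · have c3 : i = b1 := by omega
        subst c3
        simp only [c1, le_refl, if_true, if_false]
        exact mid j (by omega) (by omega) (by omega)
      · simp only [c1, c2, if_false]
        rw [hm j i]; group
  · by_cases c2 : i ≤ b1
    · simp only [c2, if_true]
      exact left i j (by omega) c2 (by omega) (by omega) (by omega)
    · simp only [c2, if_false]
      exact right i j (by omega) (by omega) (by omega) (by omega) (by omega)

end Connections

/-! ### Gauge transformations -/

section Gauge

variable {E G : Type*} [Group G]

/-- The gauge transformation with the group element `γ d` at the starting point of `d`. -/
def act (γ : Dart E → G) (x : E → G) : E → G := fun e => γ (e, true) * x e * (γ (e, false))⁻¹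

theorem val_act (γ : Dart E → G) (x : E → G) (d : Dart E) :
    val (act γ x) d = γ d * val x d * (γ d.rev)⁻¹ := by
  obtain ⟨e, b⟩ := d
  cases b <;> simp [val, act, Dart.rev, mul_assoc]

theorem val_rev (x : E → G) (d : Dart E) : val x d.rev = (val x d)⁻¹ := by
  obtain ⟨e, b⟩ := d
  cases b <;> simp [val, Dart.rev]

theorem val_eq_iff {x y : E → G} {d : Dart E} : val x d = val y d ↔ x d.1 = y d.1 := by
  obtain ⟨e, b⟩ := d
  cases b <;> simp [val]

theorem rev_rev (d : Dart E) : d.rev.rev = d := by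
  obtain ⟨e, b⟩ := d
  simp [Dart.rev]

theorem fst_rev (d : Dart E) : d.rev.1 = d.1 := rfl

theorem fst_eq_iff {d d' : Dart E} : d.1 = d'.1 ↔ d = d' ∨ d = d'.rev := by
  obtain ⟨e, b⟩ := d
  obtain ⟨e', b'⟩ := d'
  cases b <;> cases b' <;> simp [Dart.rev]

theorem act_mul (γ γ' : Dart E → G) (x : E → G) : act (γ * γ') x = act γ (act γ' x) := by
  ext e
  simp [act, mul_assoc]

end Gauge

/-! ### Coordinates on a square patch -/

theorem mem_box_iff {R : ℕ} {p : ℤ × ℤ} : p ∈ box R ↔ p ∈ sq 0 R := by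
  simp only [box, mem_sq, Set.mem_ofPred_eq, abs_le, Prod.fst_zero, Prod.snd_zero]
  omega

namespace Lattice.SquarePatch

section Coordinates

variable {E G : Type*} [Group G] {L : Lattice E} {s : L.Site} {R : ℕ} (P : L.SquarePatch s R)

theorem dart_inj {p q : ℤ × ℤ} (hp : p ∈ sq 0 R) (hq : q ∈ sq 0 R) {k l : Fin 4} :
    P.dart p k = P.dart q l ↔ p = q ∧ k = l :=
  ⟨P.inj p (mem_box_iff.2 hp) q (mem_box_iff.2 hq) k l, by rintro ⟨rfl, rfl⟩; rfl⟩

theorem next_dart' {p : ℤ × ℤ} (hp : p ∈ sq 0 R) (k : Fin 4) :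
    L.next (P.dart p k) = P.dart p (k + 1) := P.next_dart p (mem_box_iff.2 hp) k

theorem rev_dart' {p : ℤ × ℤ} (hp : p ∈ sq 0 R) (k : Fin 4) (h : p + unitStep k ∈ sq 0 R) :
    (P.dart p k).rev = P.dart (p + unitStep k) (k + 2) :=
  P.rev_dart p (mem_box_iff.2 hp) k (mem_box_iff.2 h)

theorem rev_east {i j : ℤ} (h : (i, j) ∈ sq 0 R) (h' : (i + 1, j) ∈ sq 0 R) :
    (P.dart (i, j) 0).rev = P.dart (i + 1, j) 2 := by
  have := P.rev_dart' h 0 (by simpa [unitStep] using h')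
  simpa [unitStep] using this

theorem rev_north {i j : ℤ} (h : (i, j) ∈ sq 0 R) (h' : (i, j + 1) ∈ sq 0 R) :
    (P.dart (i, j) 1).rev = P.dart (i, j + 1) 3 := by
  have := P.rev_dart' h 1 (by simpa [unitStep] using h')
  simpa [unitStep] using this

/-- The gauge field on darts that is given by `c` on the patch, and trivial elsewhere. -/
noncomputable def gauge (c : ℤ × ℤ → G) (d : Dart E) : G :=
  open Classical in if h : ∃ p ∈ sq 0 R, ∃ k, P.dart p k = d then c h.choose else 1

theorem gauge_dart (c : ℤ × ℤ → G) {p : ℤ × ℤ} (hp : p ∈ sq 0 R) (k : Fin 4) :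
    P.gauge c (P.dart p k) = c p := by
  have h : ∃ q ∈ sq 0 (R : ℤ), ∃ l, P.dart q l = P.dart p k := ⟨p, hp, k, rfl⟩
  unfold gauge
  rw [dif_pos h]
  obtain ⟨l, hl⟩ := h.choose_spec.2
  rw [((P.dart_inj h.choose_spec.1 hp).1 hl).1]

theorem gauge_of_not_mem (c : ℤ × ℤ → G) {d : Dart E}
    (h : ∀ p ∈ sq 0 (R : ℤ), ∀ k, P.dart p k ≠ d) : P.gauge c d = 1 := by
  unfold gauge
  rw [dif_neg]
  rintro ⟨p, hp, k, hk⟩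
  exact h p hp k hk

theorem gauge_next (c : ℤ × ℤ → G) (d : Dart E) : P.gauge c (L.next d) = P.gauge c d := by
  by_cases h : ∃ p ∈ sq 0 (R : ℤ), ∃ k, P.dart p k = d
  · obtain ⟨p, hp, k, rfl⟩ := h
    rw [P.next_dart' hp, P.gauge_dart c hp, P.gauge_dart c hp]
  · push Not at h
    rw [P.gauge_of_not_mem c h, P.gauge_of_not_mem c]
    intro p hp k hk
    refine h p hp (k - 1) (L.next.injective ?_)
    rw [P.next_dart' hp, sub_add_cancel, hk]

theorem gauge_mul (c c' : ℤ × ℤ → G) : P.gauge (c * c') = P.gauge c * P.gauge c' := by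
  ext d
  by_cases h : ∃ p ∈ sq 0 (R : ℤ), ∃ k, P.dart p k = d
  · obtain ⟨p, hp, k, rfl⟩ := h
    simp [P.gauge_dart _ hp]
  · push Not at h
    simp [P.gauge_of_not_mem _ h]

/-- The gauge transformation of configurations by group elements at the points of the patch. -/
noncomputable def gact (c : ℤ × ℤ → G) (x : E → G) : E → G := act (P.gauge c) x

theorem gact_mul (c c' : ℤ × ℤ → G) (x : E → G) : P.gact (c * c') x = P.gact c (P.gact c' x) := by
  rw [gact, gauge_mul, act_mul]; rfl

theorem gact_one (x : E → G) : P.gact 1 x = x := by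
  ext e
  have h : ∀ d, P.gauge (1 : ℤ × ℤ → G) d = 1 := fun d => by
    by_cases h : ∃ p ∈ sq 0 (R : ℤ), ∃ k, P.dart p k = d
    · obtain ⟨p, hp, k, rfl⟩ := h
      simp [P.gauge_dart _ hp]
    · push Not at h
      simp [P.gauge_of_not_mem _ h]
  simp [gact, act, h]

theorem gact_inv_gact (c : ℤ × ℤ → G) (x : E → G) : P.gact c⁻¹ (P.gact c x) = x := by
  rw [← gact_mul, inv_mul_cancel, gact_one]

theorem gact_gact_inv (c : ℤ × ℤ → G) (x : E → G) : P.gact c (P.gact c⁻¹ x) = x := by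
  rw [← gact_mul, mul_inv_cancel, gact_one]

/-- The group elements on the eastward edges. -/
def east (x : E → G) (p : ℤ × ℤ) : G := val x (P.dart p 0)

/-- The group elements on the northward edges. -/
def north (x : E → G) (p : ℤ × ℤ) : G := val x (P.dart p 1)

theorem east_gact (c : ℤ × ℤ → G) (x : E → G) {i j : ℤ} (h : (i, j) ∈ sq 0 R)
    (h' : (i + 1, j) ∈ sq 0 R) :
    P.east (P.gact c x) (i, j) = c (i, j) * P.east x (i, j) * (c (i + 1, j))⁻¹ := by
  rw [east, gact, val_act, P.rev_east h h', P.gauge_dart c h, P.gauge_dart c h']; rfl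

theorem north_gact (c : ℤ × ℤ → G) (x : E → G) {i j : ℤ} (h : (i, j) ∈ sq 0 R)
    (h' : (i, j + 1) ∈ sq 0 R) :
    P.north (P.gact c x) (i, j) = c (i, j) * P.north x (i, j) * (c (i, j + 1))⁻¹ := by
  rw [north, gact, val_act, P.rev_north h h', P.gauge_dart c h, P.gauge_dart c h']; rfl

/-- The edges with an endpoint in `V`. -/
def star (V : Set (ℤ × ℤ)) : Set E := {e | ∃ p ∈ V, ∃ k, (P.dart p k).1 = e}

theorem star_mono {V W : Set (ℤ × ℤ)} (h : V ⊆ W) : P.star V ⊆ P.star W := by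
  rintro e ⟨p, hp, k, hk⟩
  exact ⟨p, h hp, k, hk⟩

theorem gact_apply_of_not_mem_star {c : ℤ × ℤ → G} {V : Set (ℤ × ℤ)}
    (hc : ∀ p ∉ V, c p = 1) (x : E → G) {e : E} (he : e ∉ P.star V) : P.gact c x e = x e := by
  have h : ∀ b, P.gauge c (e, b) = 1 := fun b => by
    by_cases h : ∃ p ∈ sq 0 (R : ℤ), ∃ k, P.dart p k = (e, b)
    · obtain ⟨p, hp, k, hk⟩ := h
      rw [← hk, P.gauge_dart c hp, hc]
      exact fun hpV => he ⟨p, hpV, k, by rw [hk]⟩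
    · push Not at h
      exact P.gauge_of_not_mem c h
  simp [gact, act, h]

theorem dart_fst_cases {i j : ℤ} (h : (i, j) ∈ sq 0 ((R : ℤ) - 1)) (k : Fin 4) :
    (P.dart (i, j) k).1 = (P.dart (i, j) 0).1 ∨ (P.dart (i, j) k).1 = (P.dart (i, j) 1).1 ∨
    (P.dart (i, j) k).1 = (P.dart (i - 1, j) 0).1 ∨
    (P.dart (i, j) k).1 = (P.dart (i, j - 1) 1).1 := by
  simp only [mem_sq, Prod.fst_zero, Prod.snd_zero] at h
  have h0 : (i, j) ∈ sq 0 (R : ℤ) := by simp only [mem_sq, Prod.fst_zero, Prod.snd_zero]; omega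
  have h1 : (i - 1, j) ∈ sq 0 (R : ℤ) := by simp only [mem_sq, Prod.fst_zero, Prod.snd_zero]; omega
  have h2 : (i, j - 1) ∈ sq 0 (R : ℤ) := by simp only [mem_sq, Prod.fst_zero, Prod.snd_zero]; omega
  fin_cases k
  · exact Or.inl rfl
  · exact Or.inr (Or.inl rfl)
  · have := P.rev_east h1 (by simpa using h0)
    rw [sub_add_cancel] at this
    exact Or.inr (Or.inr (Or.inl (by rw [← fst_rev (P.dart (i - 1, j) 0), this]; rfl)))
  · have := P.rev_north h2 (by simpa using h0)
    rw [sub_add_cancel] at this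
    exact Or.inr (Or.inr (Or.inr (by rw [← fst_rev (P.dart (i, j - 1) 1), this]; rfl)))

/-- Configurations are compared edge by edge in the coordinates of the patch. -/
theorem eq_on_star {V : Set (ℤ × ℤ)} (hV : V ⊆ sq 0 ((R : ℤ) - 1)) {x y : E → G}
    (h1 : ∀ i j, (i, j) ∈ V ∨ (i + 1, j) ∈ V → P.east x (i, j) = P.east y (i, j))
    (h2 : ∀ i j, (i, j) ∈ V ∨ (i, j + 1) ∈ V → P.north x (i, j) = P.north y (i, j)) :
    ∀ e ∈ P.star V, x e = y e := by
  rintro e ⟨⟨i, j⟩, hp, k, rfl⟩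
  rcases P.dart_fst_cases (hV hp) k with h | h | h | h <;> rw [h] <;> apply val_eq_iff.1
  · exact h1 i j (Or.inl hp)
  · exact h2 i j (Or.inl hp)
  · exact h1 (i - 1) j (Or.inr (by simpa using hp))
  · exact h2 i (j - 1) (Or.inr (by simpa using hp))

theorem fst_eq_iff_of_mem {p q r : ℤ × ℤ} {k l m : Fin 4} (hp : p ∈ sq 0 R) (hq : q ∈ sq 0 R)
    (hr : r ∈ sq 0 R) (h : (P.dart p k).rev = P.dart r m) :
    (P.dart q l).1 = (P.dart p k).1 ↔ (q = p ∧ l = k) ∨ (q = r ∧ l = m) := by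
  rw [fst_eq_iff, h, P.dart_inj hq hp, P.dart_inj hq hr]

theorem east_mem_star {V : Set (ℤ × ℤ)} (hV : V ⊆ sq 0 (R : ℤ)) {i j : ℤ} (h : (i, j) ∈ sq 0 R)
    (h' : (i + 1, j) ∈ sq 0 R) :
    (P.dart (i, j) 0).1 ∈ P.star V ↔ (i, j) ∈ V ∨ (i + 1, j) ∈ V := by
  constructor
  · rintro ⟨p, hp, k, hk⟩
    rcases (P.fst_eq_iff_of_mem h (hV hp) h' (P.rev_east h h')).1 hk with ⟨rfl, -⟩ | ⟨rfl, -⟩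
    · exact Or.inl hp
    · exact Or.inr hp
  · rintro (hp | hp)
    · exact ⟨_, hp, 0, rfl⟩
    · exact ⟨_, hp, 2, by rw [← P.rev_east h h', fst_rev]⟩

theorem north_mem_star {V : Set (ℤ × ℤ)} (hV : V ⊆ sq 0 (R : ℤ)) {i j : ℤ} (h : (i, j) ∈ sq 0 R)
    (h' : (i, j + 1) ∈ sq 0 R) :
    (P.dart (i, j) 1).1 ∈ P.star V ↔ (i, j) ∈ V ∨ (i, j + 1) ∈ V := by
  constructor
  · rintro ⟨p, hp, k, hk⟩
    rcases (P.fst_eq_iff_of_mem h (hV hp) h' (P.rev_north h h')).1 hk with ⟨rfl, -⟩ | ⟨rfl, -⟩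
    · exact Or.inl hp
    · exact Or.inr hp
  · rintro (hp | hp)
    · exact ⟨_, hp, 1, rfl⟩
    · exact ⟨_, hp, 3, by rw [← P.rev_north h h', fst_rev]⟩

/-- The rotation at a grid point has period four, which also turns negative powers into nonnegative
ones. -/
theorem sameVertex_dart {p : ℤ × ℤ} (hp : p ∈ sq 0 R) (k : Fin 4) {d : Dart E} :
    L.SameVertex (P.dart p k) d ↔ ∃ l, d = P.dart p l := by
  have fwd : ∀ n : ℕ, ∀ k, ∃ l, (L.next ^ n) (P.dart p k) = P.dart p l := by
    intro n
    induction n with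
    | zero => exact fun k => ⟨k, rfl⟩
    | succ n ih =>
      intro k
      rw [pow_succ, Equiv.Perm.mul_apply, P.next_dart' hp]
      exact ih _
  have all : ∀ m : Fin 4, (L.next ^ (m : ℕ)) (P.dart p k) = P.dart p (k + m) := by
    have h1 := P.next_dart' hp k
    have h2 := P.next_dart' hp (k + 1)
    have h3 := P.next_dart' hp (k + 1 + 1)
    intro m
    fin_cases m
    · simp
    · simpa using h1
    · show (L.next ^ 2) _ = _
      rw [pow_succ, pow_one, Equiv.Perm.mul_apply, h1, h2, add_assoc]; rfl
    · show (L.next ^ 3) _ = _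
      rw [pow_succ, pow_succ, pow_one, Equiv.Perm.mul_apply, Equiv.Perm.mul_apply, h1, h2, h3,
        add_assoc, add_assoc]; rfl
  constructor
  · rintro ⟨i, rfl⟩
    have h4 : (L.next ^ 4) (P.dart p k) = P.dart p k := by
      have := P.next_dart' hp (k + 3)
      rw [pow_succ', Equiv.Perm.mul_apply, show (L.next ^ 3) (P.dart p k) = _ from all 3, this,
        add_assoc]
      simp
    have hfix : ∀ n : ℕ, (L.next ^ (4 * n)) (P.dart p k) = P.dart p k := by
      intro n
      induction n with
      | zero => simp
      | succ n ih => rw [mul_add, pow_add, Equiv.Perm.mul_apply, mul_one, h4, ih]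
    obtain ⟨n, rfl | rfl⟩ := i.eq_nat_or_neg
    · exact (fwd n k).imp fun l hl => by rw [zpow_natCast, hl]
    · obtain ⟨l, hl⟩ := fwd (3 * n) k
      refine ⟨l, ?_⟩
      rw [← hl, zpow_neg, zpow_natCast, Equiv.Perm.inv_eq_iff_eq, ← Equiv.Perm.mul_apply,
        ← pow_add, show n + 3 * n = 4 * n by omega, hfix]
  · rintro ⟨l, rfl⟩
    refine ⟨((l - k : Fin 4) : ℕ), ?_⟩
    rw [zpow_natCast, all, add_sub_cancel]

/-- Supports in the patch grow by one step per unit of distance. -/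
theorem nbhd_star_subset {V W : Set (ℤ × ℤ)} {r : ℕ} (h : ∀ p ∈ V, sq p r ⊆ W)
    (hW : W ⊆ sq 0 ((R : ℤ) - 1)) : L.nbhd r (P.star V) ⊆ P.star W := by
  have step : ∀ p ∈ sq 0 ((R : ℤ) - 1), ∀ k e', L.edgeGraph.Adj (P.dart p k).1 e' →
      ∃ q ∈ sq p 1, ∃ l, (P.dart q l).1 = e' := by
    rintro ⟨i, j⟩ hp k e' ⟨-, b, b', hb⟩
    simp only [mem_sq, Prod.fst_zero, Prod.snd_zero] at hp
    have h0 : (i, j) ∈ sq 0 (R : ℤ) := by simp only [mem_sq, Prod.fst_zero, Prod.snd_zero]; omega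
    have hq : ∃ m : ℤ × ℤ, unitStep k = m ∧ -1 ≤ m.1 ∧ m.1 ≤ 1 ∧ -1 ≤ m.2 ∧ m.2 ≤ 1 := by
      refine ⟨_, rfl, ?_⟩
      fin_cases k <;> simp [unitStep]
    obtain ⟨⟨m1, m2⟩, hm, hm'⟩ := hq
    simp only at hm'
    have h1 : (i, j) + unitStep k ∈ sq 0 (R : ℤ) := by
      rw [hm]; simp only [mem_sq, Prod.fst_zero, Prod.snd_zero, Prod.mk_add_mk]; omega
    have hrev := P.rev_dart' h0 k h1
    have hd : ((P.dart (i, j) k).1, b) = P.dart (i, j) k ∨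
        ((P.dart (i, j) k).1, b) = P.dart ((i, j) + unitStep k) (k + 2) := by
      rw [← hrev]
      exact fst_eq_iff.1 rfl
    rcases hd with hd | hd
    · rw [hd, P.sameVertex_dart h0] at hb
      obtain ⟨l, hl⟩ := hb
      exact ⟨(i, j), by simp [mem_sq], l, by rw [← hl]⟩
    · rw [hd, P.sameVertex_dart h1] at hb
      obtain ⟨l, hl⟩ := hb
      refine ⟨_, ?_, l, by rw [← hl]⟩
      rw [hm]
      simp only [mem_sq, Prod.mk_add_mk]
      omega
  -- The square of radius `w.length` lies one step inside the patch, so the walk cannot reach an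
  -- edge outside the coordinates.
  have walk : ∀ (e e' : E) (w : L.edgeGraph.Walk e e') (p : ℤ × ℤ),
      sq p w.length ⊆ sq 0 ((R : ℤ) - 1) → (∃ k, (P.dart p k).1 = e) →
      ∃ q ∈ sq p w.length, ∃ l, (P.dart q l).1 = e' := by
    intro e e' w
    induction w with
    | nil => exact fun p _ hk => ⟨p, by simp [mem_sq], hk⟩
    | cons hadj w ih =>
      rintro p hp ⟨k, rfl⟩
      simp only [SimpleGraph.Walk.length_cons, Nat.cast_add, Nat.cast_one] at hp ⊢
      obtain ⟨q, hq, hl⟩ := step p (hp (by simp only [mem_sq]; omega)) k _ hadj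
      have hsub : sq q w.length ⊆ sq p ((w.length : ℤ) + 1) := by
        intro q' hq'
        simp only [mem_sq] at *
        omega
      obtain ⟨q', hq', hl'⟩ := ih q (hsub.trans hp) hl
      exact ⟨q', hsub hq', hl'⟩
  rintro e ⟨s', ⟨p, hp, k, rfl⟩, hdist⟩
  have hne : L.edgeGraph.edist (P.dart p k).1 e ≠ ⊤ := by
    intro h
    rw [h] at hdist
    exact absurd hdist (by simp)
  obtain ⟨w, hw⟩ := SimpleGraph.exists_walk_of_edist_ne_top hne
  have hlen : w.length ≤ r := by
    rw [← hw] at hdist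
    exact_mod_cast hdist
  have hsub : sq p w.length ⊆ sq p r := by
    intro q hq
    simp only [mem_sq] at *
    omega
  obtain ⟨q, hq, l, hl⟩ := walk _ _ w p (hsub.trans ((h p hp).trans hW)) ⟨k, rfl⟩
  exact ⟨q, h p hp (hsub hq), l, hl⟩

end Coordinates

end Lattice.SquarePatch

/-! ### Ground states -/

section GroundStates

variable {E G : Type*} [Fintype E] [DecidableEq E] [Group G] [Fintype G] [DecidableEq G]

theorem moveOp_mulVec {f f' : (E → G) → (E → G)} (h1 : ∀ x, f (f' x) = x)
    (h2 : ∀ x, f' (f x) = x) (φ : Vec E G) (y : E → G) : (moveOp f *ᵥ φ) y = φ (f' y) := by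
  have : (moveOp f *ᵥ φ) y = ∑ x, (if y = f x then 1 else 0) * φ x := rfl
  rw [this, Finset.sum_eq_single (f' y)]
  · rw [if_pos (h1 y).symm, one_mul]
  · intro x _ hx
    rw [if_neg, zero_mul]
    rintro rfl
    exact hx (h2 x).symm
  · simp

theorem testOp_mulVec (f : (E → G) → G) (g : G) (φ : Vec E G) (y : E → G) :
    (testOp f g *ᵥ φ) y = if f y = g then φ y else 0 := by
  rw [testOp, Matrix.mulVec_diagonal]
  split_ifs <;> simp

theorem vertexAct_eq_act (L : Lattice E) (s : L.Site) (k : G) :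
    open Classical in L.vertexAct s k = act fun d => if L.SameVertex s d then k else 1 := by
  classical
  ext x e
  simp only [Lattice.vertexAct, act]
  congr 1
  split_ifs <;> simp

theorem vertexAct_mul (L : Lattice E) (s : L.Site) (k k' : G) (x : E → G) :
    L.vertexAct s (k * k') x = L.vertexAct s k (L.vertexAct s k' x) := by
  classical
  rw [vertexAct_eq_act, vertexAct_eq_act, vertexAct_eq_act, ← act_mul]
  congr 1
  ext d
  simp only [Pi.mul_apply]
  split_ifs <;> simp

theorem vertexAct_one (L : Lattice E) (s : L.Site) (x : E → G) : L.vertexAct s 1 x = x := by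
  classical
  rw [vertexAct_eq_act]
  ext e
  simp [act]

theorem siteA_mulVec (L : Lattice E) (s : L.Site) (k : G) (φ : Vec E G) (y : E → G) :
    (L.siteA s k *ᵥ φ) y = φ (L.vertexAct s k⁻¹ y) :=
  moveOp_mulVec (fun x => by rw [← vertexAct_mul, mul_inv_cancel, vertexAct_one])
    (fun x => by rw [← vertexAct_mul, inv_mul_cancel, vertexAct_one]) φ y

/-- An average over the group absorbs a shift, so being fixed by the average means being fixed by
each element. -/
theorem Lattice.IsGroundState.vertexAct {L : Lattice E} {ψ : Vec E G} (h : L.IsGroundState ψ)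
    (s : L.Site) (k : G) (x : E → G) : ψ (L.vertexAct s k x) = ψ x := by
  have hx : ∀ x, ψ x = (Fintype.card G : ℂ)⁻¹ * ∑ g, ψ (L.vertexAct s g⁻¹ x) := by
    intro x
    have := congrFun (h.2 s).1 x
    rw [Lattice.vertexOp, Matrix.smul_mulVec, Matrix.sum_mulVec] at this
    simp only [Pi.smul_apply, Finset.sum_apply, siteA_mulVec, smul_eq_mul] at this
    exact this.symm
  rw [hx, hx x]
  congr 1
  refine Fintype.sum_equiv (Equiv.mulLeft k⁻¹) _ _ fun g => ?_
  rw [← vertexAct_mul, Equiv.coe_mulLeft, mul_inv_rev, inv_inv]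

theorem Lattice.IsGroundState.holonomy_eq_one {L : Lattice E} {ψ : Vec E G}
    (h : L.IsGroundState ψ) (s : L.Site) {x : E → G} (hx : ψ x ≠ 0) : L.holonomy s x = 1 := by
  have := congrFun (h.2 s).2 x
  rw [Lattice.plaquetteOp, Lattice.siteB, testOp_mulVec] at this
  by_contra hne
  rw [if_neg hne] at this
  exact hx this.symm

namespace Lattice.SquarePatch

variable {L : Lattice E} {s : L.Site} {R : ℕ} (P : L.SquarePatch s R)

/-- Invariance of a state under the gauge transformations on `V`. -/
def GaugeInv (V : Set (ℤ × ℤ)) (χ : Vec E G) : Prop :=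
  ∀ c : ℤ × ℤ → G, (∀ p ∉ V, c p = 1) → ∀ x, χ (P.gact c x) = χ x

theorem gact_mulSingle {p : ℤ × ℤ} (hp : p ∈ sq 0 R) (k : G) :
    P.gact (Pi.mulSingle p k) = L.vertexAct (P.dart p 0) k := by
  classical
  ext x e
  rw [vertexAct_eq_act, gact]
  congr 1
  ext d
  by_cases h : ∃ l, d = P.dart p l
  · rw [if_pos ((P.sameVertex_dart hp 0).2 h)]
    obtain ⟨l, rfl⟩ := h
    rw [P.gauge_dart _ hp, Pi.mulSingle_eq_same]
  · rw [if_neg (mt (P.sameVertex_dart hp 0).1 h)]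
    by_cases h' : ∃ q ∈ sq 0 (R : ℤ), ∃ k, P.dart q k = d
    · obtain ⟨q, hq, k, rfl⟩ := h'
      rw [P.gauge_dart _ hq, Pi.mulSingle_eq_of_ne]
      rintro rfl
      exact h ⟨k, rfl⟩
    · push Not at h'
      exact P.gauge_of_not_mem _ h'

theorem GaugeInv.of_single {V : Set (ℤ × ℤ)} (hV : V.Finite) {χ : Vec E G}
    (h : ∀ p ∈ V, ∀ k x, χ (P.gact (Pi.mulSingle p k) x) = χ x) : P.GaugeInv V χ := by
  classical
  have key : ∀ T : Finset (ℤ × ℤ), (T : Set (ℤ × ℤ)) ⊆ V → ∀ c : ℤ × ℤ → G,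
      (∀ p ∉ T, c p = 1) → ∀ x, χ (P.gact c x) = χ x := by
    intro T
    induction T using Finset.induction_on with
    | empty =>
      intro _ c hc x
      rw [show c = 1 from funext fun p => hc p (by simp), gact_one]
    | insert p T hp ih =>
      intro hT c hc x
      have e1 : c = Pi.mulSingle p (c p) * Function.update c p 1 := by
        ext q
        by_cases hq : q = p
        · subst hq; simp
        · simp [hq]
      rw [e1, gact_mul, h p (hT (by simp)), ih (fun q hq => hT (by simp [Finset.mem_coe.1 hq]))]
      intro q hq
      by_cases hqp : q = p
      · subst hqp; simp
      · rw [Function.update_of_ne hqp]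
        exact hc q (by simp [hqp, hq])
  intro c hc x
  refine key hV.toFinset (by simp) c (fun p hp => hc p (by simpa using hp)) x

theorem sq_finite (b : ℤ × ℤ) (r : ℤ) : (sq b r).Finite :=
  ((Set.finite_Icc (b.1 - r) (b.1 + r)).prod (Set.finite_Icc (b.2 - r) (b.2 + r))).subset
    fun _ hp => ⟨⟨hp.1, hp.2.1⟩, ⟨hp.2.2.1, hp.2.2.2⟩⟩

theorem gaugeInv_of_isGroundState {ψ : Vec E G} (h : L.IsGroundState ψ) {V : Set (ℤ × ℤ)}
    (hV : V ⊆ sq 0 R) : P.GaugeInv V ψ :=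
  GaugeInv.of_single P ((sq_finite 0 R).subset hV) fun p hp k x => by
    rw [P.gact_mulSingle (hV hp), h.vertexAct]

/-- The darts around the plaquette with lower left corner `p`, counterclockwise. -/
def plaq (p : ℤ × ℤ) : Fin 4 → Dart E :=
  ![P.dart p 0, P.dart (p.1 + 1, p.2) 1, P.dart (p.1 + 1, p.2 + 1) 2, P.dart (p.1, p.2 + 1) 3]

theorem mem_of_corners {i j : ℤ} (h : (i, j) ∈ sq 0 (R : ℤ)) (h' : (i + 1, j + 1) ∈ sq 0 (R : ℤ)) :
    (i + 1, j) ∈ sq 0 (R : ℤ) ∧ (i, j + 1) ∈ sq 0 (R : ℤ) := by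
  simp only [mem_sq] at *
  omega

theorem next_plaq {i j : ℤ} (h : (i, j) ∈ sq 0 (R : ℤ)) (h' : (i + 1, j + 1) ∈ sq 0 (R : ℤ))
    (k : Fin 4) : L.next (P.plaq (i, j) k) = (P.plaq (i, j) (k - 1)).rev := by
  obtain ⟨h1, h2⟩ := mem_of_corners h h'
  fin_cases k
  · show L.next (P.dart (i, j) 0) = (P.dart (i, j + 1) 3).rev
    rw [P.next_dart' h, ← P.rev_north h h2, rev_rev]; rfl
  · show L.next (P.dart (i + 1, j) 1) = (P.dart (i, j) 0).rev
    rw [P.next_dart' h1, P.rev_east h h1]; rfl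
  · show L.next (P.dart (i + 1, j + 1) 2) = (P.dart (i + 1, j) 1).rev
    rw [P.next_dart' h', P.rev_north h1 h']; rfl
  · show L.next (P.dart (i, j + 1) 3) = (P.dart (i + 1, j + 1) 2).rev
    rw [P.next_dart' h2, ← P.rev_east h2 h', rev_rev]; rfl

theorem exists_plaq_eq (p : ℤ × ℤ) (k : Fin 4) : ∃ q : ℤ × ℤ, P.plaq p k = P.dart q k ∧
    (q.1 = p.1 ∨ q.1 = p.1 + 1) ∧ (q.2 = p.2 ∨ q.2 = p.2 + 1) := by
  fin_cases k
  · exact ⟨p, rfl, by simp, by simp⟩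
  · exact ⟨(p.1 + 1, p.2), rfl, by simp, by simp⟩
  · exact ⟨(p.1 + 1, p.2 + 1), rfl, by simp, by simp⟩
  · exact ⟨(p.1, p.2 + 1), rfl, by simp, by simp⟩

theorem exists_plaq_eq' {i j : ℤ} (h : (i, j) ∈ sq 0 (R : ℤ)) (h' : (i + 1, j + 1) ∈ sq 0 (R : ℤ))
    (k : Fin 4) : ∃ q ∈ sq 0 (R : ℤ), P.plaq (i, j) k = P.dart q k := by
  obtain ⟨q, hq, h1, h2⟩ := P.exists_plaq_eq (i, j) k
  refine ⟨q, ?_, hq⟩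
  simp only [mem_sq] at *
  omega

theorem plaq_injective {i j : ℤ} (h : (i, j) ∈ sq 0 (R : ℤ)) (h' : (i + 1, j + 1) ∈ sq 0 (R : ℤ)) :
    Function.Injective (P.plaq (i, j)) := by
  intro k l hkl
  obtain ⟨q, hq, e1⟩ := P.exists_plaq_eq' h h' k
  obtain ⟨q', hq', e2⟩ := P.exists_plaq_eq' h h' l
  rw [e1, e2] at hkl
  exact ((P.dart_inj hq hq').1 hkl).2

/-- No edge borders the plaquette from both sides, so multiplying one edge changes at most one
factor of its holonomy. An equality would identify two consecutive corners, which are distinct grid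
points. -/
theorem plaq_ne_rev {i j : ℤ} (h : (i, j) ∈ sq 0 (R : ℤ)) (h' : (i + 1, j + 1) ∈ sq 0 (R : ℤ))
    (k l : Fin 4) : P.plaq (i, j) k ≠ (P.plaq (i, j) l).rev := by
  obtain ⟨h1, h2⟩ := mem_of_corners h h'
  have e := P.next_plaq h h' (l + 1)
  rw [add_sub_cancel_right] at e
  rw [← e]
  have a0 : P.plaq (i, j) 0 = P.dart (i, j) 0 := rfl
  have a1 : P.plaq (i, j) 1 = P.dart (i + 1, j) 1 := rfl
  have a2 : P.plaq (i, j) 2 = P.dart (i + 1, j + 1) 2 := rfl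
  have a3 : P.plaq (i, j) 3 = P.dart (i, j + 1) 3 := rfl
  intro hk
  obtain ⟨q, hq, e1⟩ := P.exists_plaq_eq' h h' k
  obtain ⟨q', hq', e2⟩ := P.exists_plaq_eq' h h' (l + 1)
  rw [e1, e2, P.next_dart' hq', P.dart_inj hq hq'] at hk
  obtain ⟨rfl, rfl⟩ := hk
  clear e
  generalize l + 1 = m at *
  fin_cases m
  all_goals
    first
      | (have e1' : P.dart (i + 1, j) 1 = P.dart q 1 := e1
         have e2' : P.dart (i, j) 0 = P.dart q 0 := e2
         rw [P.dart_inj h1 hq] at e1'; rw [P.dart_inj h hq] at e2'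
         have := e1'.1.trans e2'.1.symm; simp at this)
      | (have e1' : P.dart (i + 1, j + 1) 2 = P.dart q 2 := e1
         have e2' : P.dart (i + 1, j) 1 = P.dart q 1 := e2
         rw [P.dart_inj h' hq] at e1'; rw [P.dart_inj h1 hq] at e2'
         have := e1'.1.trans e2'.1.symm; simp at this)
      | (have e1' : P.dart (i, j + 1) 3 = P.dart q 3 := e1
         have e2' : P.dart (i + 1, j + 1) 2 = P.dart q 2 := e2
         rw [P.dart_inj h2 hq] at e1'; rw [P.dart_inj h' hq] at e2'
         have := e1'.1.trans e2'.1.symm; simp at this)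
      | (have e1' : P.dart (i, j) 0 = P.dart q 0 := e1
         have e2' : P.dart (i, j + 1) 3 = P.dart q 3 := e2
         rw [P.dart_inj h hq] at e1'; rw [P.dart_inj h2 hq] at e2'
         have := e1'.1.trans e2'.1.symm; simp at this)

end Lattice.SquarePatch

/-- The product of the group elements along four darts, starting with the `k`-th one. -/
def cyc (d : Fin 4 → Dart E) (x : E → G) (k : Fin 4) : G :=
  val x (d k) * val x (d (k + 1)) * val x (d (k + 2)) * val x (d (k + 3))

theorem cyc_sub_one (d : Fin 4 → Dart E) (x : E → G) (k : Fin 4) :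
    cyc d x (k - 1) = val x (d (k - 1)) * cyc d x k * (val x (d (k - 1)))⁻¹ := by
  have h3 : k + 3 = k - 1 := by revert k; decide
  have h2 : k - 1 + 3 = k + 2 := by revert k; decide
  have h1 : k - 1 + 2 = k + 1 := by revert k; decide
  simp only [cyc, sub_add_cancel, h1, h2, h3]
  group

theorem cyc_eq_one_iff (d : Fin 4 → Dart E) (x : E → G) (k l : Fin 4) :
    cyc d x k = 1 ↔ cyc d x l = 1 := by
  have step : ∀ k, cyc d x (k - 1) = 1 ↔ cyc d x k = 1 := by
    intro k
    rw [cyc_sub_one, conj_eq_one_iff]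
  have all : ∀ k, cyc d x k = 1 ↔ cyc d x 0 = 1 := by
    have a1 := step 1
    have a2 := step 2
    have a3 := step 3
    intro k
    fin_cases k
    · rfl
    · exact a1.symm
    · exact a2.symm.trans a1.symm
    · exact a3.symm.trans (a2.symm.trans a1.symm)
  rw [all k, all l]

namespace Lattice.SquarePatch

variable {L : Lattice E} {s : L.Site} {R : ℕ} (P : L.SquarePatch s R)

theorem holonomy_eq {i j : ℤ} (h : (i, j) ∈ sq 0 (R : ℤ)) (h' : (i + 1, j + 1) ∈ sq 0 (R : ℤ))
    (x : E → G) : L.holonomy (P.dart (i, j) 0) x = cyc (P.plaq (i, j)) x 0 := by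
  have step : ∀ k, L.faceNext (P.plaq (i, j) k) = P.plaq (i, j) (k + 1) := by
    intro k
    have := P.next_plaq h h' (k + 1)
    rw [add_sub_cancel_right] at this
    rw [Lattice.faceNext, ← this, Equiv.symm_apply_apply]
  have h0 : P.plaq (i, j) 0 = P.dart (i, j) 0 := rfl
  have i2 : L.faceNext^[2] (P.plaq (i, j) 0) = P.plaq (i, j) 2 := by
    rw [Function.iterate_succ, Function.comp, Function.iterate_one, step, step]; rfl
  have i3 : L.faceNext^[3] (P.plaq (i, j) 0) = P.plaq (i, j) 3 := by
    rw [Function.iterate_succ_apply', i2, step]; rfl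
  have i4 : L.faceNext^[4] (P.plaq (i, j) 0) = P.plaq (i, j) 0 := by
    rw [Function.iterate_succ_apply', i3, step]; rfl
  -- The period divides four, and it does not divide two because the four darts are distinct.
  have per : Function.minimalPeriod L.faceNext (P.plaq (i, j) 0) = 4 := by
    have d4 : Function.minimalPeriod L.faceNext (P.plaq (i, j) 0) ∣ 2 ^ 2 :=
      Function.IsPeriodicPt.minimalPeriod_dvd i4
    have d2 : ¬ Function.minimalPeriod L.faceNext (P.plaq (i, j) 0) ∣ 2 := by
      intro hd
      have := (Function.isPeriodicPt_minimalPeriod L.faceNext (P.plaq (i, j) 0)).trans_dvd hd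
      rw [Function.IsPeriodicPt, Function.IsFixedPt, i2] at this
      exact absurd (P.plaq_injective h h' this) (by decide)
    obtain ⟨k, hk, hk'⟩ := (Nat.dvd_prime_pow Nat.prime_two).1 d4
    rw [hk'] at d2 ⊢
    interval_cases k
    · simp at d2
    · simp at d2
    · rfl
  rw [Lattice.holonomy, ← h0, per]
  simp only [List.range_succ, List.range_zero, List.nil_append, List.map_cons,
    List.map_nil, List.cons_append, List.prod_cons, List.prod_nil, Function.iterate_zero, id,
    Function.iterate_one, i2, i3, step, mul_one, cyc, mul_assoc]
  rfl

theorem cyc_plaq {i j : ℤ} (h : (i, j) ∈ sq 0 (R : ℤ)) (h' : (i + 1, j + 1) ∈ sq 0 (R : ℤ))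
    (x : E → G) : cyc (P.plaq (i, j)) x 0 =
      P.east x (i, j) * P.north x (i + 1, j) * (P.north x (i, j) * P.east x (i, j + 1))⁻¹ := by
  obtain ⟨h1, h2⟩ := mem_of_corners h h'
  show val x (P.dart (i, j) 0) * val x (P.dart (i + 1, j) 1) * val x (P.dart (i + 1, j + 1) 2) *
    val x (P.dart (i, j + 1) 3) = _
  rw [← P.rev_east h2 h', ← P.rev_north h h2, val_rev, val_rev, mul_inv_rev, ← mul_assoc]
  rfl

end Lattice.SquarePatch

end GroundStates

/-! ### Ribbon operators -/

section Ribbons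

variable {E G : Type*} [Fintype E] [DecidableEq E] [Group G] [Fintype G] [DecidableEq G]

theorem multDart_of_ne (d : Dart E) (h : G) (x : E → G) {e : E} (he : e ≠ d.1) :
    multDart d h x e = x e := Function.update_of_ne he _ _

theorem val_multDart (d : Dart E) (h : G) (x : E → G) :
    val (multDart d h x) d = h * val x d := by
  obtain ⟨e, b⟩ := d
  cases b <;> simp [val, multDart]

theorem val_multDart_of_ne {d d' : Dart E} (h : G) (x : E → G) (hd : d'.1 ≠ d.1) :
    val (multDart d h x) d' = val x d' := val_eq_iff.2 (multDart_of_ne d h x hd)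

theorem multDart_mul (d : Dart E) (h k : G) (x : E → G) :
    multDart d (h * k) x = multDart d h (multDart d k x) := by
  obtain ⟨e, b⟩ := d
  ext e'
  by_cases he : e' = e
  · subst he
    cases b <;> simp [multDart, mul_assoc]
  · simp [multDart, he]

theorem multDart_one (d : Dart E) (x : E → G) : multDart d 1 x = x := by
  simp [multDart]

theorem multDart_rev_comm (d : Dart E) (h k : G) (x : E → G) :
    multDart d h (multDart d.rev k x) = multDart d.rev k (multDart d h x) := by
  obtain ⟨e, b⟩ := d
  ext e'
  by_cases he : e' = e
  · subst he
    cases b <;> simp [multDart, Dart.rev, mul_assoc]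
  · simp [multDart, Dart.rev, he]

theorem multDart_comm_of_ne {d d' : Dart E} (hd : d ≠ d') (h k : G) (x : E → G) :
    multDart d h (multDart d' k x) = multDart d' k (multDart d h x) := by
  by_cases he : d.1 = d'.1
  · rcases fst_eq_iff.1 he with rfl | rfl
    · exact absurd rfl hd
    · rw [multDart_rev_comm]
  · ext e
    by_cases h1 : e = d.1
    · subst h1
      rw [multDart_of_ne d' k _ he]
      simp [multDart, he]
    · rw [multDart_of_ne d h _ h1]
      by_cases h2 : e = d'.1
      · subst h2
        simp [multDart, h1]
      · rw [multDart_of_ne d' k _ h2, multDart_of_ne d' k _ h2, multDart_of_ne d h _ h1]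

theorem ribbonOp_cons_primary {τ : Triangle E} (hτ : τ.isDual = false) (ξ : List (Triangle E))
    (h g : G) (ψ : Vec E G) (y : E → G) : (ribbonOp (τ :: ξ) h g *ᵥ ψ) y =
      (ribbonOp ξ ((val y τ.dart)⁻¹ * h * val y τ.dart) ((val y τ.dart)⁻¹ * g) *ᵥ ψ) y := by
  simp only [ribbonOp, Matrix.sum_mulVec, Finset.sum_apply, ← Matrix.mulVec_mulVec, triangleOp, hτ,
    Bool.false_eq_true, if_false, testOp_mulVec, Finset.sum_ite_eq, Finset.mem_univ, if_true]

theorem ribbonOp_cons_dual {τ : Triangle E} (hτ : τ.isDual = true) (ξ : List (Triangle E))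
    (h g : G) (ψ : Vec E G) (y : E → G) : (ribbonOp (τ :: ξ) h g *ᵥ ψ) y =
      (ribbonOp ξ h g *ᵥ ψ) (multDart τ.dart h⁻¹ y) := by
  have e1 : ∀ k : G, triangleOp τ h k * ribbonOp ξ (k⁻¹ * h * k) (k⁻¹ * g) =
      if k = 1 then moveOp (multDart τ.dart h) * ribbonOp ξ h g else 0 := by
    intro k
    by_cases hk : k = 1
    · subst hk; simp [triangleOp, hτ]
    · simp [triangleOp, hτ, hk]
  rw [ribbonOp, Finset.sum_congr rfl fun k _ => e1 k, Finset.sum_ite_eq' Finset.univ (1 : G),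
    if_pos (Finset.mem_univ _), ← Matrix.mulVec_mulVec]
  exact moveOp_mulVec (fun x => by rw [← multDart_mul, mul_inv_cancel, multDart_one])
    (fun x => by rw [← multDart_mul, inv_mul_cancel, multDart_one]) _ _

theorem multDart_act (γ : Dart E → G) (d : Dart E) (h : G) (x : E → G) :
    multDart d h (act γ x) = act γ (multDart d ((γ d)⁻¹ * h * γ d) x) := by
  obtain ⟨e, b⟩ := d
  ext e'
  by_cases he : e' = e
  · subst he
    cases b <;> simp [multDart, act, mul_assoc]
  · simp [multDart, act, he]

/-- Ribbon operators are gauge covariant. -/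
theorem ribbonOp_act {L : Lattice E} {γ : Dart E → G} (hγ : ∀ d, γ (L.next d) = γ d)
    (s₁ : L.Site) (ψ : Vec E G) : ∀ (ξ : List (Triangle E)) (a : L.Site) (h g : G) (x : E → G),
    L.IsStrip a s₁ ξ → (ribbonOp ξ h g *ᵥ ψ) (act γ x) =
      (ribbonOp ξ ((γ a)⁻¹ * h * γ a) ((γ a)⁻¹ * g * γ s₁) *ᵥ fun y => ψ (act γ y)) x := by
  intro ξ
  induction ξ with
  | nil =>
    intro a h g x ha
    have ha : a = s₁ := ha
    subst ha
    have : (γ a)⁻¹ * g * γ a = 1 ↔ g = 1 := by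
      constructor
      · intro h'
        have := congrArg (fun z => γ a * z * (γ a)⁻¹) h'
        simpa [mul_assoc] using this
      · rintro rfl; simp
    simp only [ribbonOp, this]
    split_ifs <;> simp
  | cons τ ξ ih =>
    intro a h g x ha
    obtain ⟨ha, hs⟩ := ha
    have hd : γ τ.dart = γ a := by
      rw [← ha, Lattice.triangleStart, ← hγ (L.next.symm τ.dart), Equiv.apply_symm_apply]
    cases hτ : τ.isDual with
    | false =>
      have he : L.triangleEnd τ = τ.dart.rev := by simp [Lattice.triangleEnd, hτ]
      rw [he] at hs
      rw [ribbonOp_cons_primary hτ, ribbonOp_cons_primary hτ, ih _ _ _ _ hs, val_act, hd]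
      have p1 : ∀ (u v w h : G), w⁻¹ * ((u * v * w⁻¹)⁻¹ * h * (u * v * w⁻¹)) * w =
          v⁻¹ * (u⁻¹ * h * u) * v := by intro u v w h; group
      have p2 : ∀ (u v w h z : G), w⁻¹ * ((u * v * w⁻¹)⁻¹ * h) * z =
          v⁻¹ * (u⁻¹ * h * z) := by intro u v w h z; group
      rw [p1, p2]
    | true =>
      have he : L.triangleEnd τ = τ.dart := by simp [Lattice.triangleEnd, hτ]
      rw [he] at hs
      rw [ribbonOp_cons_dual hτ, ribbonOp_cons_dual hτ, multDart_act, ih _ _ _ _ hs, hd]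
      have p1 : ∀ (u h : G), u⁻¹ * h⁻¹ * u = (u⁻¹ * h * u)⁻¹ := by intro u h; group
      rw [p1]

/-- The configuration produced by a ribbon operator with flux label `h` from the basis state `x`. -/
def ribbonMove : List (Triangle E) → G → (E → G) → (E → G)
  | [], _, x => x
  | τ :: ξ, h, x => if τ.isDual then ribbonMove ξ h (multDart τ.dart h x)
      else ribbonMove ξ ((val x τ.dart)⁻¹ * h * val x τ.dart) x

/-- The product of the group elements along the primary triangles. -/
def ribbonHol : List (Triangle E) → (E → G) → G
  | [], _ => 1
  | τ :: ξ, x => if τ.isDual then ribbonHol ξ x else val x τ.dart * ribbonHol ξ x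

theorem ribbonMove_apply_of_ne : ∀ (ξ : List (Triangle E)) (h : G) (x : E → G) {e : E},
    (∀ τ ∈ ξ, τ.isDual = true → e ≠ τ.dart.1) → ribbonMove ξ h x e = x e := by
  intro ξ
  induction ξ with
  | nil => intros; rfl
  | cons τ ξ ih =>
    intro h x e he
    rw [ribbonMove]
    cases hτ : τ.isDual with
    | true =>
      rw [if_pos rfl, ih _ _ fun τ' hτ' => he τ' (List.mem_cons_of_mem _ hτ'),
        multDart_of_ne _ _ _ (he τ List.mem_cons_self hτ)]
    | false =>
      rw [if_neg (by simp), ih _ _ fun τ' hτ' => he τ' (List.mem_cons_of_mem _ hτ')]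

theorem ribbonMove_multDart {τ : Triangle E} (hτ : τ.isDual = true) (k : G) :
    ∀ (ξ : List (Triangle E)) (h : G) (x : E → G),
    (∀ τ' ∈ ξ, τ ≠ τ' ∧ (τ.dart.1 = τ'.dart.1 → τ.isDual = τ'.isDual)) →
    ribbonMove ξ h (multDart τ.dart k x) = multDart τ.dart k (ribbonMove ξ h x) := by
  intro ξ
  induction ξ with
  | nil => intros; rfl
  | cons τ' ξ ih =>
    intro h x hξ
    have hne := hξ τ' List.mem_cons_self
    have ih := fun h x => ih h x fun τ'' h' => hξ τ'' (List.mem_cons_of_mem _ h')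
    rw [ribbonMove, ribbonMove]
    cases hτ' : τ'.isDual with
    | true =>
      have hd : τ'.dart ≠ τ.dart := by
        intro hd
        apply hne.1
        cases τ; cases τ'
        simp_all
      rw [if_pos rfl, if_pos rfl, multDart_comm_of_ne hd, ih]
    | false =>
      have hd : τ'.dart.1 ≠ τ.dart.1 := by
        intro hd
        have := hne.2 hd.symm
        rw [hτ, hτ'] at this
        exact absurd this (by simp)
      rw [if_neg (by simp), if_neg (by simp), val_multDart_of_ne k x hd, ih]

theorem ribbonHol_multDart {τ : Triangle E} (hτ : τ.isDual = true) (k : G) (x : E → G) :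
    ∀ (ξ : List (Triangle E)),
    (∀ τ' ∈ ξ, τ ≠ τ' ∧ (τ.dart.1 = τ'.dart.1 → τ.isDual = τ'.isDual)) →
    ribbonHol ξ (multDart τ.dart k x) = ribbonHol ξ x := by
  intro ξ
  induction ξ with
  | nil => intros; rfl
  | cons τ' ξ ih =>
    intro hξ
    have hne := hξ τ' List.mem_cons_self
    have ih := ih fun τ'' h' => hξ τ'' (List.mem_cons_of_mem _ h')
    rw [ribbonHol, ribbonHol, ih]
    cases hτ' : τ'.isDual with
    | true => rfl
    | false =>
      have hd : τ'.dart.1 ≠ τ.dart.1 := by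
        intro hd
        have := hne.2 hd.symm
        rw [hτ, hτ'] at this
        exact absurd this (by simp)
      rw [val_multDart_of_ne k x hd]

/-- Each basis state is either annihilated or sent to one basis state. Non-overlap is what makes the
order of the triangles harmless: the edges read by primary triangles are never moved by dual ones.
-/
theorem exists_of_ribbonOp_mulVec_ne_zero (ψ : Vec E G) : ∀ (ξ : List (Triangle E)) (h g : G)
    (y : E → G), (ξ.Pairwise fun τ τ' => τ ≠ τ' ∧ (τ.dart.1 = τ'.dart.1 → τ.isDual = τ'.isDual)) →
    (ribbonOp ξ h g *ᵥ ψ) y ≠ 0 → ∃ x, ψ x ≠ 0 ∧ y = ribbonMove ξ h x ∧ ribbonHol ξ x = g := by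
  intro ξ
  induction ξ with
  | nil =>
    intro h g y _ hy
    rw [ribbonOp] at hy
    by_cases hg : g = 1
    · rw [if_pos hg, Matrix.one_mulVec] at hy
      exact ⟨y, hy, rfl, hg.symm⟩
    · simp [hg] at hy
  | cons τ ξ ih =>
    intro h g y hp hy
    rw [List.pairwise_cons] at hp
    cases hτ : τ.isDual with
    | false =>
      rw [ribbonOp_cons_primary hτ] at hy
      obtain ⟨x, hx, hyx, hg⟩ := ih _ _ _ hp.2 hy
      have hv : val y τ.dart = val x τ.dart := by
        rw [val_eq_iff, hyx]
        refine ribbonMove_apply_of_ne _ _ _ fun τ' hτ' hd he => ?_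
        have := (hp.1 τ' hτ').2 he
        rw [hτ, hd] at this
        exact absurd this (by simp)
      refine ⟨x, hx, ?_, ?_⟩
      · rw [ribbonMove, hτ, if_neg (by simp), ← hv]
        exact hyx
      · rw [ribbonHol, hτ, if_neg (by simp), hg, hv, mul_inv_cancel_left]
    | true =>
      rw [ribbonOp_cons_dual hτ] at hy
      obtain ⟨x, hx, hyx, hg⟩ := ih _ _ _ hp.2 hy
      refine ⟨x, hx, ?_, ?_⟩
      · rw [ribbonMove, hτ, if_pos rfl, ribbonMove_multDart hτ _ _ _ _ hp.1, ← hyx, ← multDart_mul,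
          mul_inv_cancel, multDart_one]
      · rw [ribbonHol, hτ, if_pos rfl, hg]

/-- While a ribbon operator is applied, the flux through a plaquette is trivial unless the current
site lies in this plaquette, where it is the flux label. -/
theorem cyc_ribbonMove {L : Lattice E} {d : Fin 4 → Dart E} (hd : Function.Injective d)
    (hrev : ∀ k l, d k ≠ (d l).rev) (hnext : ∀ k, L.next (d k) = (d (k - 1)).rev) (s₁ : L.Site) :
    ∀ (ξ : List (Triangle E)) (a : L.Site) (h : G) (x : E → G), L.IsStrip a s₁ ξ →
    (ξ.Pairwise fun τ τ' => τ ≠ τ' ∧ (τ.dart.1 = τ'.dart.1 → τ.isDual = τ'.isDual)) →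
    (∀ k, a = d k → cyc d x k = h) → ((∀ k, a ≠ d k) → cyc d x 0 = 1) →
    (∀ k, s₁ = d k → cyc d (ribbonMove ξ h x) k = (ribbonHol ξ x)⁻¹ * h * ribbonHol ξ x) ∧
      ((∀ k, s₁ ≠ d k) → cyc d (ribbonMove ξ h x) 0 = 1) := by
  have hfst : ∀ k l, (d k).1 = (d l).1 → k = l := by
    intro k l hkl
    rcases fst_eq_iff.1 hkl with h | h
    · exact hd h
    · exact absurd h (hrev k l)
  have s1 : ∀ k : Fin 4, k + 1 ≠ k ∧ k + 2 ≠ k ∧ k + 3 ≠ k := by decide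
  have s2 : ∀ k : Fin 4, k + 3 = k - 1 ∧ k ≠ k - 1 ∧ k + 1 ≠ k - 1 ∧ k + 2 ≠ k - 1 := by decide
  intro ξ
  induction ξ with
  | nil =>
    intro a h x ha _ h1 h2
    have ha : a = s₁ := ha
    subst ha
    exact ⟨fun k hk => by simpa [ribbonMove, ribbonHol] using h1 k hk, h2⟩
  | cons τ ξ ih =>
    intro a h x ha hp h1 h2
    obtain ⟨ha, hs⟩ := ha
    rw [List.pairwise_cons] at hp
    have ha' : τ.dart = L.next a := by
      rw [← ha, Lattice.triangleStart, Equiv.apply_symm_apply]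
    have hback : ∀ k, τ.dart = (d k).rev → a = d (k + 1) := by
      intro k hk
      apply L.next.injective
      rw [← ha', hk, hnext, add_sub_cancel_right]
    rw [ribbonMove, ribbonHol]
    cases hτ : τ.isDual with
    | false =>
      have he : L.triangleEnd τ = τ.dart.rev := by simp [Lattice.triangleEnd, hτ]
      rw [he] at hs
      rw [if_neg (by simp), if_neg (by simp)]
      have := ih τ.dart.rev ((val x τ.dart)⁻¹ * h * val x τ.dart) x hs hp.2 ?_ ?_
      · refine ⟨fun k hk => (this.1 k hk).trans ?_, this.2⟩
        group
      · intro k hk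
        -- The site slides along the boundary of the plaquette; moving the base point of the
        -- holonomy conjugates it exactly as the flux label is conjugated.
        have hk' : τ.dart = (d k).rev := by rw [← hk, rev_rev]
        have := cyc_sub_one d x (k + 1)
        rw [add_sub_cancel_right, h1 _ (hback k hk')] at this
        rw [this, hk', val_rev, inv_inv]
      · intro hk
        by_cases hka : ∃ k, a = d k
        · obtain ⟨k, rfl⟩ := hka
          refine absurd ?_ (hk (k - 1))
          rw [ha', hnext, rev_rev]
        · push Not at hka
          exact h2 hka
    | true =>
      have he : L.triangleEnd τ = τ.dart := by simp [Lattice.triangleEnd, hτ]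
      rw [he] at hs
      rw [if_pos rfl, if_pos rfl]
      have := ih τ.dart h (multDart τ.dart h x) hs hp.2 ?_ ?_
      · rw [ribbonHol_multDart hτ h x ξ hp.1] at this
        exact this
      · intro k hk
        -- The ribbon enters the plaquette: the crossed edge acquires the factor `h` at its start,
        -- which turns the trivial holonomy into `h`.
        have hout : ∀ l, a ≠ d l := by
          rintro l rfl
          rw [ha', hnext] at hk
          exact hrev _ _ hk.symm
        have h3 := (cyc_eq_one_iff d x 0 k).1 (h2 hout)
        have h4 : ∀ l, l ≠ k → val (multDart τ.dart h x) (d l) = val x (d l) := by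
          intro l hl
          rw [hk]
          exact val_multDart_of_ne _ _ fun h' => hl (hfst _ _ h')
        have h5 : val (multDart τ.dart h x) (d k) = h * val x (d k) := by
          rw [← hk]; exact val_multDart _ _ _
        rw [cyc, h4 _ (s1 k).1, h4 _ (s1 k).2.1, h4 _ (s1 k).2.2, h5]
        rw [cyc] at h3
        calc _ = h * (val x (d k) * val x (d (k + 1)) * val x (d (k + 2)) * val x (d (k + 3))) := by
              simp only [mul_assoc]
          _ = h := by rw [h3, mul_one]
      · intro hk
        by_cases hka : ∃ k, a = d k
        · obtain ⟨k, rfl⟩ := hka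
          -- The ribbon leaves the plaquette: the crossed edge is the last factor seen from the
          -- site, and its new factor `h⁻¹` cancels the flux.
          have hdart : τ.dart = (d (k - 1)).rev := by rw [ha', hnext]
          have h3 := h1 k rfl
          have hk3 := (s2 k).1
          have h4 : ∀ l, l ≠ k - 1 → val (multDart τ.dart h x) (d l) = val x (d l) := by
            intro l hl
            rw [hdart]
            exact val_multDart_of_ne _ _ fun h' => hl (hfst _ _ h')
          have h5 : val (multDart τ.dart h x) (d (k - 1)) = val x (d (k - 1)) * h⁻¹ := by
            have := val_multDart τ.dart h x
            rw [hdart, val_rev, val_rev] at this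
            rw [hdart, ← inv_inv (val _ (d (k - 1))), this]
            group
          rw [cyc_eq_one_iff d _ 0 k, cyc, hk3, h5, h4, h4, h4]
          · rw [cyc, hk3] at h3
            rw [← mul_assoc, h3, mul_inv_cancel]
          · exact (s2 k).2.2.2
          · exact (s2 k).2.2.1
          · exact (s2 k).2.1
        · push Not at hka
          have h4 : ∀ l, val (multDart τ.dart h x) (d l) = val x (d l) := by
            intro l
            refine val_multDart_of_ne _ _ fun h' => ?_
            rcases fst_eq_iff.1 h' with h' | h'
            · exact hk l h'.symm
            · exact hka _ (hback l (by rw [h', rev_rev]))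
          simp only [cyc, h4]
          exact h2 hka

end Ribbons

/-! ### Irreducible matrix representations -/

section Irreducible

variable {H : Type*} [Group H] {n : ℕ} {Γ : H →* Matrix.unitaryGroup (Fin n) ℂ}

theorem matrixRep_apply (g : H) (v : Fin n → ℂ) :
    matrixRep Γ g v = (Γ g : Matrix (Fin n) (Fin n) ℂ) *ᵥ v := by
  simp [matrixRep]

theorem eq_bot_or_eq_top_of_invariant (hΓ : (matrixRep Γ).IsIrreducible)
    (S : Submodule ℂ (Fin n → ℂ))
    (hS : ∀ g, ∀ v ∈ S, (Γ g : Matrix (Fin n) (Fin n) ℂ) *ᵥ v ∈ S) : S = ⊥ ∨ S = ⊤ := by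
  let S' : Subrepresentation (matrixRep Γ) := ⟨S, fun g v hv => by
    rw [matrixRep_apply]; exact hS g v hv⟩
  rcases IsSimpleOrder.eq_bot_or_eq_top S' with h | h
  · left
    exact congrArg Subrepresentation.toSubmodule h
  · right
    exact congrArg Subrepresentation.toSubmodule h

theorem coe_map_mul (g h : H) : (Γ (g * h) : Matrix (Fin n) (Fin n) ℂ) = Γ g * Γ h := by
  rw [map_mul]; rfl

/-- If the operators `Γ k` act on some nonzero vector as if they commuted with each other, then
they are scalars of modulus one. -/
theorem norm_entry_eq_one_of_conj (hΓ : (matrixRep Γ).IsIrreducible) {u : Fin n → ℂ} (hu : u ≠ 0)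
    (h : ∀ e k : H, (Γ (e * k * e⁻¹) : Matrix (Fin n) (Fin n) ℂ) *ᵥ u = Γ k *ᵥ u) (r : H)
    (i : Fin n) : ‖(Γ r : Matrix (Fin n) (Fin n) ℂ) i i‖ = 1 := by
  -- The vectors with the property of `u` form an invariant subspace, since conjugating by `g`
  -- merely renames `e` and `k`. It is nonzero, hence everything, and the representation is abelian.
  let S : Submodule ℂ (Fin n → ℂ) :=
    { carrier := {v | ∀ e k : H, (Γ (e * k * e⁻¹) : Matrix (Fin n) (Fin n) ℂ) *ᵥ v = Γ k *ᵥ v}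
      add_mem' := fun {v w} hv hw e k => by rw [Matrix.mulVec_add, Matrix.mulVec_add, hv, hw]
      zero_mem' := fun e k => by simp
      smul_mem' := fun c v hv e k => by rw [Matrix.mulVec_smul, Matrix.mulVec_smul, hv] }
  have hS : S = ⊤ := by
    refine (eq_bot_or_eq_top_of_invariant hΓ S ?_).resolve_left fun hbot => hu ?_
    · intro g v hv e k
      rw [Matrix.mulVec_mulVec, Matrix.mulVec_mulVec, ← coe_map_mul, ← coe_map_mul,
        show e * k * e⁻¹ * g = g * ((g⁻¹ * e) * k * (g⁻¹ * e)⁻¹) by group,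
        show k * g = g * (g⁻¹ * k * g⁻¹⁻¹) by group, coe_map_mul g, coe_map_mul g,
        ← Matrix.mulVec_mulVec, ← Matrix.mulVec_mulVec, hv, hv]
    · have : u ∈ S := h
      rw [hbot] at this
      exact this
  have hcomm : ∀ (e k : H) (v : Fin n → ℂ), (Γ k : Matrix (Fin n) (Fin n) ℂ) *ᵥ (Γ e *ᵥ v) =
      Γ e *ᵥ ((Γ k : Matrix (Fin n) (Fin n) ℂ) *ᵥ v) := by
    intro e k v
    have hv : Γ e *ᵥ v ∈ S := by rw [hS]; trivial
    rw [← hv e k, Matrix.mulVec_mulVec, Matrix.mulVec_mulVec, ← coe_map_mul, ← coe_map_mul]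
    congr 3
    group
  have : Nonempty (Fin n) := ⟨i⟩
  obtain ⟨μ, hμ⟩ := Module.End.exists_eigenvalue
    (Matrix.toLin' (Γ r : Matrix (Fin n) (Fin n) ℂ))
  -- Schur's lemma: an eigenspace of an operator that commutes with the representation is invariant.
  have htop : Module.End.eigenspace (Matrix.toLin' (Γ r : Matrix (Fin n) (Fin n) ℂ)) μ = ⊤ := by
    refine (eq_bot_or_eq_top_of_invariant hΓ _ ?_).resolve_left hμ
    intro g v hv
    rw [Module.End.mem_eigenspace_iff, Matrix.toLin'_apply] at hv ⊢
    rw [hcomm, hv, Matrix.mulVec_smul]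
  have hr : ∀ v, (Γ r : Matrix (Fin n) (Fin n) ℂ) *ᵥ v = μ • v := by
    intro v
    have : v ∈ Module.End.eigenspace (Matrix.toLin' (Γ r : Matrix (Fin n) (Fin n) ℂ)) μ := by
      rw [htop]; trivial
    rwa [Module.End.mem_eigenspace_iff, Matrix.toLin'_apply] at this
  have hmat : (Γ r : Matrix (Fin n) (Fin n) ℂ) = μ • 1 := by
    ext a b
    have := congrFun (hr (Pi.single b 1)) a
    rw [Matrix.mulVec_single_one] at this
    simpa [Matrix.one_apply, Pi.single_apply] using this
  have hunit : (Γ r : Matrix (Fin n) (Fin n) ℂ) * star (Γ r : Matrix (Fin n) (Fin n) ℂ) = 1 :=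
    Matrix.mem_unitaryGroup_iff.1 (Γ r).2
  rw [hmat] at hunit ⊢
  have h1 := congrFun (congrFun hunit i) i
  rw [star_smul, star_one, smul_mul_smul_comm, mul_one, Matrix.smul_apply, Matrix.one_apply_eq,
    smul_eq_mul, mul_one] at h1
  have h2 : ‖μ‖ * ‖μ‖ = 1 := by
    have := congrArg norm h1
    simpa using this
  rw [Matrix.smul_apply, Matrix.one_apply_eq, smul_eq_mul, mul_one]
  nlinarith [norm_nonneg μ]

end Irreducible

/-! ### States with anyons at the ends of a ribbon -/

section AnyonStates

variable {E G : Type*} [Fintype E] [DecidableEq E] [Group G] [Fintype G] [DecidableEq G]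
  {L : Lattice E} {s₀ s₁ : L.Site} {R : ℕ} (P : L.SquarePatch s₁ R) {ψ : Vec E G}
  {ξ : List (Triangle E)} {ρ : AnyonLabel G}

open Classical in
/-- The state with the vector `u` of the representation `Γ` as local state of the anyon at the end
of the ribbon. -/
noncomputable def ribbonState (ρ : AnyonLabel G) (ξ : List (Triangle E)) (ψ : Vec E G)
    (u : Fin ρ.dim → ℂ) : Vec E G :=
  ∑ k : Subgroup.centralizer ({ρ.r} : Set G),
    (star u ⬝ᵥ ((ρ.Γ k⁻¹ : Matrix (Fin ρ.dim) (Fin ρ.dim) ℂ) *ᵥ Pi.single 0 1)) •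
      (ribbonOp ξ ρ.r⁻¹ (k : G) *ᵥ ψ)

theorem anyonRibbonOp_mulVec (ρ : AnyonLabel G) (ξ : List (Triangle E)) (ψ : Vec E G) :
    anyonRibbonOp ρ ξ *ᵥ ψ =
      ((ρ.dim : ℂ) / (Nat.card (Subgroup.centralizer ({ρ.r} : Set G)) : ℂ)) •
        ribbonState ρ ξ ψ (Pi.single 0 1) := by
  classical
  rw [anyonRibbonOp, ribbonState, Matrix.smul_mulVec, Matrix.sum_mulVec]
  congr 1
  refine Finset.sum_congr rfl fun k _ => ?_
  rw [Matrix.smul_mulVec]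
  congr 1
  rw [AnyonLabel.entry, ← Pi.single_star, star_one, single_one_dotProduct,
    Matrix.mulVec_single_one]
  rfl

theorem ribbonState_add (u v : Fin ρ.dim → ℂ) :
    ribbonState ρ ξ ψ (u + v) = ribbonState ρ ξ ψ u + ribbonState ρ ξ ψ v := by
  simp only [ribbonState, star_add, add_dotProduct, add_smul, Finset.sum_add_distrib]

theorem ribbonState_smul (c : ℂ) (u : Fin ρ.dim → ℂ) :
    ribbonState ρ ξ ψ (c • u) = star c • ribbonState ρ ξ ψ u := by
  simp only [ribbonState, star_smul, smul_dotProduct, Finset.smul_sum, smul_smul, smul_eq_mul]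

theorem ribbonState_sub (u v : Fin ρ.dim → ℂ) :
    ribbonState ρ ξ ψ (u - v) = ribbonState ρ ξ ψ u - ribbonState ρ ξ ψ v := by
  have := ribbonState_add (ξ := ξ) (ψ := ψ) (u - v) v
  rw [sub_add_cancel] at this
  rw [this, add_sub_cancel_right]

/-- The ground state absorbs the gauge transformation, which is trivial at the start of the ribbon.
At the end it multiplies the label `k` by `m` from the right; reindexing the sum moves `m` into the
representation. -/
theorem ribbonState_gact (hψ : L.IsGroundState ψ) (hξ : L.IsStrip s₀ s₁ ξ)
    (hs₀ : ∀ p ∈ sq 0 (R : ℤ), ∀ k, P.dart p k ≠ s₀) (u : Fin ρ.dim → ℂ) {c : ℤ × ℤ → G}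
    (m : Subgroup.centralizer ({ρ.r} : Set G)) (hc : c 0 = m) (x : E → G) :
    ribbonState ρ ξ ψ u (P.gact c x) =
      ribbonState ρ ξ ψ ((ρ.Γ m⁻¹ : Matrix (Fin ρ.dim) (Fin ρ.dim) ℂ) *ᵥ u) x := by
  classical
  have h0 : (0 : ℤ × ℤ) ∈ sq 0 (R : ℤ) := by simp [mem_sq]
  have h1 : P.gauge c s₁ = m := 
    (congrArg (P.gauge c) P.center).symm.trans ((P.gauge_dart c h0 0).trans hc)
  have h2 : P.gauge c s₀ = 1 := P.gauge_of_not_mem c hs₀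
  have h3 : (fun y => ψ (act (P.gauge c) y)) = ψ := by
    funext y
    have := P.gaugeInv_of_isGroundState hψ (V := sq 0 R) subset_rfl
      (fun p => if p ∈ sq 0 (R : ℤ) then c p else 1) (fun p hp => if_neg hp) y
    rw [← this]
    congr 1
    rw [Lattice.SquarePatch.gact]
    congr 1
    funext d
    by_cases h : ∃ p ∈ sq 0 (R : ℤ), ∃ k, P.dart p k = d
    · obtain ⟨p, hp, k, rfl⟩ := h
      rw [P.gauge_dart _ hp, P.gauge_dart _ hp, if_pos hp]
    · push Not at h
      rw [P.gauge_of_not_mem _ h, P.gauge_of_not_mem _ h]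
  simp only [ribbonState, Finset.sum_apply, Pi.smul_apply]
  refine Fintype.sum_equiv (Equiv.mulRight m) _ _ fun k => ?_
  rw [Lattice.SquarePatch.gact, ribbonOp_act (P.gauge_next c) s₁ ψ ξ s₀ _ _ x hξ, h1, h2, h3]
  simp only [inv_one, one_mul, mul_one, Equiv.coe_mulRight, Subgroup.coe_mul]
  congr 1
  rw [Matrix.star_mulVec, ← Matrix.dotProduct_mulVec, Matrix.mulVec_mulVec]
  have hstar : (ρ.Γ m⁻¹ : Matrix (Fin ρ.dim) (Fin ρ.dim) ℂ)ᴴ = ρ.Γ m := by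
    rw [map_inv]
    exact star_star (ρ.Γ m : Matrix (Fin ρ.dim) (Fin ρ.dim) ℂ)
  rw [hstar, ← coe_map_mul, mul_inv_rev, mul_inv_cancel_left]

/-- The local state of the anyon is determined by the state. -/
theorem ribbonState_injective (hψ : L.IsGroundState ψ) (hξ : L.IsStrip s₀ s₁ ξ)
    (hs₀ : ∀ p ∈ sq 0 (R : ℤ), ∀ k, P.dart p k ≠ s₀) {u₀ : Fin ρ.dim → ℂ}
    (hu₀ : ribbonState ρ ξ ψ u₀ ≠ 0) : Function.Injective (ribbonState ρ ξ ψ) := by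
  -- The kernel is invariant under `Γ`, because `Γ` is implemented by gauge transformations at the
  -- centre; so it vanishes unless every state is zero.
  let S : Submodule ℂ (Fin ρ.dim → ℂ) :=
    { carrier := {v | ribbonState ρ ξ ψ v = 0}
      add_mem' := fun {v w} (hv : _ = _) (hw : _ = _) => by
        show _ = _
        rw [ribbonState_add, hv, hw, add_zero]
      zero_mem' := by
        show _ = _
        have := ribbonState_sub (ρ := ρ) (ξ := ξ) (ψ := ψ) 0 0
        rwa [sub_self, sub_self] at this
      smul_mem' := fun c v (hv : _ = _) => by
        show _ = _
        rw [ribbonState_smul, hv, smul_zero] }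
  have hS : S = ⊥ := by
    refine (eq_bot_or_eq_top_of_invariant ρ.irreducible S ?_).resolve_right fun htop => hu₀ ?_
    · intro g v hv
      show _ = _
      funext x
      have := ribbonState_gact P hψ hξ hs₀ v (c := Pi.mulSingle 0 ((g⁻¹ : _) : G)) g⁻¹
        (Pi.mulSingle_eq_same _ _) x
      rw [inv_inv] at this
      rw [← this, show ribbonState ρ ξ ψ v = 0 from hv]
      rfl
    · have : u₀ ∈ S := by rw [htop]; trivial
      exact this
  intro u v huv
  have : u - v ∈ S := by
    show _ = _
    rw [ribbonState_sub, huv, sub_self]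
  rw [hS] at this
  exact sub_eq_zero.1 this

/-- Ground state configurations are flat, and the ribbon creates flux only at its ends, of which one
lies outside the patch. Labels `k` in the centralizer leave the flux at the other end equal to
`r_C⁻¹`. -/
theorem exists_isFluxPotential_of_ribbonState_ne_zero (hψ : L.IsGroundState ψ)
    (hξ : L.IsRibbon s₀ s₁ ξ) (hs₀ : ∀ p ∈ sq 0 (R : ℤ), ∀ k, P.dart p k ≠ s₀) (hR : 1 ≤ R)
    (u : Fin ρ.dim → ℂ) {x : E → G} (hx : ribbonState ρ ξ ψ u x ≠ 0) :
    ∃ κ, IsFluxPotential R ρ.r⁻¹ (P.east x) (P.north x) κ := by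
  classical
  simp only [ribbonState, Finset.sum_apply, Pi.smul_apply] at hx
  obtain ⟨k, -, hk⟩ := Finset.exists_ne_zero_of_sum_ne_zero hx
  rw [smul_eq_mul] at hk
  obtain ⟨z, hz, hxz, hg⟩ :=
    exists_of_ribbonOp_mulVec_ne_zero ψ ξ _ _ _ hξ.2 (right_ne_zero_of_mul hk)
  have hz1 : ∀ i j, (i, j) ∈ sq 0 (R : ℤ) → (i + 1, j + 1) ∈ sq 0 (R : ℤ) →
      cyc (P.plaq (i, j)) z 0 = 1 := by
    intro i j h h'
    rw [← P.holonomy_eq h h']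
    exact hψ.holonomy_eq_one _ hz
  have hk' : (k : G)⁻¹ * ρ.r⁻¹ * k = ρ.r⁻¹ := by
    have := Subgroup.mem_centralizer_singleton_iff.1 k.2
    rw [mul_assoc, inv_mul_eq_iff_eq_mul, inv_mul_eq_iff_eq_mul, ← mul_assoc, ← this, mul_assoc,
      mul_inv_cancel, mul_one]
  have hout : ∀ i j, (i, j) ∈ sq 0 (R : ℤ) → (i + 1, j + 1) ∈ sq 0 (R : ℤ) →
      (∀ l, s₁ = P.plaq (i, j) l → cyc (P.plaq (i, j)) x l = ρ.r⁻¹) ∧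
      ((∀ l, s₁ ≠ P.plaq (i, j) l) → cyc (P.plaq (i, j)) x 0 = 1) := by
    intro i j h h'
    have := cyc_ribbonMove (P.plaq_injective h h') (P.plaq_ne_rev h h') (P.next_plaq h h') s₁ ξ s₀
      ρ.r⁻¹ z hξ.1 hξ.2 ?_ fun _ => hz1 i j h h'
    · rw [hg, hk', ← hxz] at this
      exact this
    · intro l hl
      obtain ⟨q, hq, hq'⟩ := P.exists_plaq_eq' h h' l
      exact absurd (hq'.symm.trans hl.symm) (hs₀ q hq l)
  have hR' : (1 : ℤ) ≤ R := by exact_mod_cast hR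
  have h00 : ((0 : ℤ), (0 : ℤ)) ∈ sq 0 (R : ℤ) := by simp [mem_sq]
  have h11 : ((0 : ℤ) + 1, (0 : ℤ) + 1) ∈ sq 0 (R : ℤ) := by
    simp only [mem_sq, Prod.fst_zero, Prod.snd_zero]; omega
  refine exists_isFluxPotential hR' (fun i j h1 h2 h3 h4 hij => ?_) ?_
  · have h : (i, j) ∈ sq 0 (R : ℤ) := by simp only [mem_sq, Prod.fst_zero, Prod.snd_zero]; omega
    have h' : (i + 1, j + 1) ∈ sq 0 (R : ℤ) := by
      simp only [mem_sq, Prod.fst_zero, Prod.snd_zero]; omega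
    have := (hout i j h h').2 fun l hl => ?_
    · rw [P.cyc_plaq h h', mul_inv_eq_one] at this
      exact this
    -- As a corner, `s₁` belongs only to the plaquette to the north-east of the origin.
    · have hl := P.center.trans hl
      obtain ⟨q, hq, hq'⟩ := P.exists_plaq_eq' h h' l
      rw [hq'] at hl
      obtain ⟨rfl, rfl⟩ := (P.dart_inj h00 hq).1 hl
      have h0 : P.plaq (i, j) 0 = P.dart (i, j) 0 := rfl
      rw [h0] at hq'
      exact hij ((P.dart_inj h hq).1 hq').1
  · have := (hout 0 0 h00 h11).1 0 P.center.symm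
    rw [P.cyc_plaq h00 h11, mul_inv_eq_iff_eq_mul] at this
    simpa using this

end AnyonStates

/-! ### Moving charge between the centre of the patch and a distant point -/

section Transfer

variable {E G : Type*} [Fintype E] [DecidableEq E] [Group G] [Fintype G] [DecidableEq G]

/-- A projection that fixes `Φ` fixes `Φ ∘ g` as well, when `g` only moves qudits off the support
of the projection, in a way that only depends on these qudits. -/
theorem mulVec_comp_equiv {M : Op E G} (hM : IsProj M) {Q : Set E} (hQ : LocalOn Q M)
    {Φ : Vec E G} (hΦ : M *ᵥ Φ = Φ) (g : (E → G) ≃ (E → G)) {S : Set (E → G)}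
    (hS : ∀ x, Φ x ≠ 0 → x ∈ S) (hg : ∀ x, g x ∈ S ↔ x ∈ S) (h1 : ∀ x ∈ S, ∀ e ∈ Q, g x e = x e)
    (h2 : ∀ x ∈ S, ∀ y ∈ S, (∀ e ∉ Q, x e = y e) → ∀ e ∉ Q, g x e = g y e)
    (h3 : ∀ x ∈ S, ∀ y ∈ S, (∀ e ∉ Q, g x e = g y e) → ∀ e ∉ Q, x e = y e) :
    (M *ᵥ fun x => Φ (g x)) = fun x => Φ (g x) := by
  refine hM.mulVec_eq_self fun x hx => ?_
  have hxS : x ∈ S := (hg x).1 (hS _ hx)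
  show ∑ y, M x y * Φ (g y) = Φ (g x)
  have h4 : Φ (g x) = ∑ y, M (g x) y * Φ y := (congrFun hΦ (g x)).symm
  rw [h4]
  refine Fintype.sum_equiv g _ _ fun y => ?_
  by_cases hy : Φ (g y) = 0
  · rw [hy, mul_zero, mul_zero]
  have hyS : y ∈ S := (hg y).1 (hS _ hy)
  congr 1
  by_cases hxy : ∀ e ∉ Q, x e = y e
  · exact hQ.2 _ _ _ _ (fun e he => (h1 x hxS e he).symm) (fun e he => (h1 y hyS e he).symm) hxy
      (h2 x hxS y hyS hxy)
  · have a1 : M x y = 0 := by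
      by_contra h; exact hxy (hQ.1 _ _ h)
    have a2 : M (g x) (g y) = 0 := by
      by_contra h; exact hxy (h3 x hxS y hyS (hQ.1 _ _ h))
    rw [a1, a2]

/-- The element `k` transported with `t`, where this makes sense in the presence of the flux `h`. -/
def twist (h t k : G) : G := if t * h = h * t then t * k * t⁻¹ else 1

theorem twist_comm {h t k : G} (hk : k * h = h * k) : twist h t k * h = h * twist h t k := by
  unfold twist
  split_ifs with ht
  · have h1 : Commute t h := ht
    have h2 : Commute k h := hk
    exact (h1.mul_left h2).mul_left h1.inv_left
  · simp

/-- A twist changes the transporter from `t` to `(twist h t k)⁻¹ * t`; with this transporter `k⁻¹`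
undoes it. The default value `1` in `twist` keeps the move invertible when `t` does not commute with
`h`. -/
theorem twist_inv {h t k : G} (hk : k * h = h * k) :
    twist h ((twist h t k)⁻¹ * t) k⁻¹ = (twist h t k)⁻¹ := by
  by_cases ht : t * h = h * t
  · have h1 : Commute t h := ht
    have h2 : Commute k h := hk
    have e : twist h t k = t * k * t⁻¹ := if_pos ht
    have e2 : (t * k * t⁻¹)⁻¹ * t = t * k⁻¹ := by group
    rw [e, e2, twist, if_pos (show t * k⁻¹ * h = h * (t * k⁻¹) from h1.mul_left h2.inv_left)]
    group
  · have e : twist h t k = 1 := if_neg ht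
    rw [e, inv_one, one_mul, twist, if_neg ht]

/-- The transported element is covariant under changes of the potential by constants that commute
with the flux. -/
theorem twist_mul {h t c k : G} (hc : c * h = h * c) :
    twist h (c * t) k = c * twist h t k * c⁻¹ := by
  have h1 : Commute c h := hc
  have hiff : c * t * h = h * (c * t) ↔ t * h = h * t := by
    rw [← mul_assoc h, ← hc, mul_assoc, mul_assoc, mul_right_inj]
  unfold twist
  simp only [hiff]
  split_ifs
  · group
  · simp

namespace Lattice.SquarePatch

variable {L : Lattice E} {s : L.Site} {R : ℕ} (P : L.SquarePatch s R)

/-- Configurations that are flat on the patch apart from the flux `h` at the central site. -/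
def Good (h : G) (x : E → G) : Prop := ∃ κ, IsFluxPotential R h (P.east x) (P.north x) κ

open Classical in
/-- A flux potential of a configuration. -/
noncomputable def pot (h : G) (x : E → G) : ℤ × ℤ → G :=
  if H : P.Good h x then H.choose else 1

variable {P} {h : G} {x y : E → G}

theorem Good.pot (H : P.Good h x) : IsFluxPotential R h (P.east x) (P.north x) (P.pot h x) := by
  unfold Lattice.SquarePatch.pot
  rw [dif_pos H]
  exact H.choose_spec

/-- The right factor `m` restores the normalization at the centre; it passes through the cut because
it commutes with `h`. -/
theorem flux_gact {κ c : ℤ × ℤ → G} (hκ : IsFluxPotential R h (P.east x) (P.north x) κ) {m : G}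
    (hm : m * h = h * m) (hc : c 0 * m = 1) :
    IsFluxPotential R h (P.east (P.gact c x)) (P.north (P.gact c x)) fun p => c p * κ p * m := by
  have hm' : ∀ u v : G, u * m * (h * (m⁻¹ * v)) = u * (h * v) := by
    intro u v
    rw [mul_assoc u, ← mul_assoc m h, hm, mul_assoc h m, mul_inv_cancel_left]
  refine ⟨?_, fun i j h1 h2 => ?_, fun i j h1 h2 => ?_⟩
  · show c (0, 0) * κ (0, 0) * m = 1
    rw [hκ.1, mul_one]; exact hc
  · rw [P.east_gact c x h1 h2, hκ.2.1 i j h1 h2]; group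
  · rw [P.north_gact c x h1 h2, hκ.2.2 i j h1 h2]
    split_ifs
    · simp only [mul_inv_rev]
      have := hm' (c (i, j) * κ (i, j)) ((κ (i, j + 1))⁻¹ * (c (i, j + 1))⁻¹)
      simp only [mul_assoc] at this ⊢
      exact this.symm
    · group

theorem Good.gact (H : P.Good h x) {c : ℤ × ℤ → G} (hc : c 0 * h = h * c 0) :
    P.Good h (P.gact c x) := by
  obtain ⟨κ, hκ⟩ := H
  have h1 : Commute (c 0) h := hc
  exact ⟨_, flux_gact hκ (m := (c 0)⁻¹) h1.inv_left (mul_inv_cancel _)⟩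

/-- The comparison of the potentials of two configurations is constant along the edges where they
agree. -/
theorem compare_east {κ κ' : ℤ × ℤ → G} (hκ : IsFluxPotential R h (P.east x) (P.north x) κ)
    (hκ' : IsFluxPotential R h (P.east y) (P.north y) κ') {i j : ℤ} (h1 : (i, j) ∈ sq 0 (R : ℤ))
    (h2 : (i + 1, j) ∈ sq 0 (R : ℤ)) (he : x (P.dart (i, j) 0).1 = y (P.dart (i, j) 0).1) :
    (κ' (i, j))⁻¹ * κ (i, j) = (κ' (i + 1, j))⁻¹ * κ (i + 1, j) := by
  have e : P.east x (i, j) = P.east y (i, j) := val_eq_iff.2 he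
  rw [hκ.2.1 i j h1 h2, hκ'.2.1 i j h1 h2, mul_inv_eq_iff_eq_mul] at e
  rw [e]; group

theorem compare_north {κ κ' : ℤ × ℤ → G} (hκ : IsFluxPotential R h (P.east x) (P.north x) κ)
    (hκ' : IsFluxPotential R h (P.east y) (P.north y) κ') {i j : ℤ} (h1 : (i, j) ∈ sq 0 (R : ℤ))
    (h2 : (i, j + 1) ∈ sq 0 (R : ℤ)) (hij : ¬ (j = 0 ∧ 0 < i))
    (he : x (P.dart (i, j) 1).1 = y (P.dart (i, j) 1).1) :
    (κ' (i, j))⁻¹ * κ (i, j) = (κ' (i, j + 1))⁻¹ * κ (i, j + 1) := by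
  have e : P.north x (i, j) = P.north y (i, j) := val_eq_iff.2 he
  rw [hκ.2.2 i j h1 h2, hκ'.2.2 i j h1 h2, if_neg (by omega), mul_one, mul_one,
    mul_inv_eq_iff_eq_mul] at e
  rw [e]; group

theorem compare_cut {κ κ' : ℤ × ℤ → G} (hκ : IsFluxPotential R h (P.east x) (P.north x) κ)
    (hκ' : IsFluxPotential R h (P.east y) (P.north y) κ') {i : ℤ} (h1 : (i, 0) ∈ sq 0 (R : ℤ))
    (h2 : (i, 0 + 1) ∈ sq 0 (R : ℤ)) (hi : 0 < i)
    (he : x (P.dart (i, 0) 1).1 = y (P.dart (i, 0) 1).1) :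
    (κ' (i, 0))⁻¹ * κ (i, 0) * h = h * ((κ' (i, 0 + 1))⁻¹ * κ (i, 0 + 1)) := by
  have e : P.north x (i, 0) = P.north y (i, 0) := val_eq_iff.2 he
  rw [hκ.2.2 i 0 h1 h2, hκ'.2.2 i 0 h1 h2, if_pos ⟨rfl, by omega⟩, mul_inv_eq_iff_eq_mul] at e
  rw [mul_assoc, e]; group

/-- The central column followed by a row reaches every point from the centre without crossing the
cut. -/
theorem pot_unique {κ : ℤ × ℤ → G} (hκ : IsFluxPotential R h (P.east x) (P.north x) κ)
    {p : ℤ × ℤ} (hp : p ∈ sq 0 (R : ℤ)) : P.pot h x p = κ p := by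
  have hκ' := Good.pot ⟨κ, hκ⟩
  obtain ⟨i, j⟩ := p
  simp only [mem_sq, Prod.fst_zero, Prod.snd_zero] at hp
  have col : (P.pot h x (0, j))⁻¹ * κ (0, j) = (P.pot h x (0, 0))⁻¹ * κ (0, 0) :=
    eq_of_forall_step (f := fun j => (P.pot h x (0, j))⁻¹ * κ (0, j)) (lo := -R) (hi := R)
      (fun j' _ _ => compare_north hκ hκ' (by simp only [mem_sq, Prod.fst_zero, Prod.snd_zero]; omega)
        (by simp only [mem_sq, Prod.fst_zero, Prod.snd_zero]; omega) (by omega) rfl)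
      (by omega) (by omega) (by omega) (by omega)
  have row : (P.pot h x (i, j))⁻¹ * κ (i, j) = (P.pot h x (0, j))⁻¹ * κ (0, j) :=
    eq_of_forall_step (f := fun i => (P.pot h x (i, j))⁻¹ * κ (i, j)) (lo := -R) (hi := R)
      (fun j' _ _ => compare_east hκ hκ' (by simp only [mem_sq, Prod.fst_zero, Prod.snd_zero]; omega)
        (by simp only [mem_sq, Prod.fst_zero, Prod.snd_zero]; omega) rfl)
      (by omega) (by omega) (by omega) (by omega)
  rw [col, hκ.1, hκ'.1, inv_one, one_mul, inv_mul_eq_one] at row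
  exact row

variable (P)

open Classical in
/-- The covariantly constant gauge transformation on `W` which at the centre of the patch is
`k`, transported from the point `b`. -/
noncomputable def twistField (h : G) (b : ℤ × ℤ) (W : Set (ℤ × ℤ)) (k : G) (x : E → G)
    (p : ℤ × ℤ) : G :=
  if p ∈ W then P.pot h x p * twist h (P.pot h x b)⁻¹ k * (P.pot h x p)⁻¹ else 1

open Classical in
/-- The inverse of the gauge transformation `twistField`, on good configurations. -/
noncomputable def twistMove (h : G) (b : ℤ × ℤ) (W : Set (ℤ × ℤ)) (k : G) (x : E → G) : E → G :=
  if P.Good h x then P.gact (P.twistField h b W k x)⁻¹ x else x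

/-- The state obtained from `Φ` by acting at the centre of the patch with `k`, transported from
the point `b`. -/
noncomputable def twistState (h : G) (b : ℤ × ℤ) (k : G) (Φ : Vec E G) : Vec E G := fun x =>
  Φ (P.gact (Pi.mulSingle 0 (twist h (P.pot h x b)⁻¹ k)⁻¹) x)

variable {P} {b : ℤ × ℤ} {W : Set (ℤ × ℤ)} {k : G}

theorem Good.twistField_zero (H : P.Good h x) (h0 : (0 : ℤ × ℤ) ∈ W) :
    P.twistField h b W k x 0 = twist h (P.pot h x b)⁻¹ k := by
  have : P.pot h x 0 = 1 := H.pot.1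
  rw [twistField, if_pos h0, this]
  simp

theorem Good.flux_twistMove (H : P.Good h x) (hk : k * h = h * k) (h0 : (0 : ℤ × ℤ) ∈ W) :
    IsFluxPotential R h (P.east (P.twistMove h b W k x)) (P.north (P.twistMove h b W k x))
      fun p => (P.twistField h b W k x p)⁻¹ * P.pot h x p * twist h (P.pot h x b)⁻¹ k := by
  rw [twistMove, if_pos H]
  refine flux_gact H.pot (twist_comm hk) ?_
  rw [Pi.inv_apply, H.twistField_zero h0, inv_mul_cancel]

theorem good_twistMove_iff (hk : k * h = h * k) (h0 : (0 : ℤ × ℤ) ∈ W) :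
    P.Good h (P.twistMove h b W k x) ↔ P.Good h x := by
  constructor
  · intro H
    by_contra H'
    rw [twistMove, if_neg H'] at H
    exact H' H
  · exact fun H => ⟨_, H.flux_twistMove hk h0⟩

theorem twistMove_twistMove (hk : k * h = h * k) (h0 : (0 : ℤ × ℤ) ∈ W) (hb : b ∉ W)
    (hbR : b ∈ sq 0 (R : ℤ)) (hW : W ⊆ sq 0 (R : ℤ)) (x : E → G) :
    P.twistMove h b W k⁻¹ (P.twistMove h b W k x) = x := by
  by_cases H : P.Good h x
  · have hpot := fun p (hp : p ∈ sq 0 (R : ℤ)) =>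
      pot_unique (H.flux_twistMove (b := b) (W := W) hk h0) hp
    have hbpot := hpot b hbR
    -- Since `b` is outside `W`, the potential there changes only by the renormalizing factor, which
    -- is the situation of `twist_inv`.
    rw [twistField, if_neg hb, inv_one, one_mul] at hbpot
    have key : P.twistField h b W k⁻¹ (P.twistMove h b W k x) = (P.twistField h b W k x)⁻¹ := by
      funext p
      by_cases hp : p ∈ W
      · rw [twistField, if_pos hp, hbpot, mul_inv_rev, twist_inv hk, hpot p (hW hp), Pi.inv_apply,
          twistField, if_pos hp]
        group
      · rw [Pi.inv_apply, twistField, twistField, if_neg hp, if_neg hp, inv_one]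
    conv_lhs => rw [twistMove, if_pos ((good_twistMove_iff hk h0).2 H), key]
    rw [twistMove, if_pos H, inv_inv, gact_gact_inv]
  · have : P.twistMove h b W k x = x := if_neg H
    rw [this, twistMove, if_neg H]

/-- The two gauge transformations agree at the centre, and `Φ` does not see the rest; hence `W` can
be chosen at will. -/
theorem twistState_eq (hk : k * h = h * k) (h0 : (0 : ℤ × ℤ) ∈ W) {Φ : Vec E G}
    (hA : ∀ c : ℤ × ℤ → G, c 0 = 1 → ∀ x, Φ (P.gact c x) = Φ x)
    (hB : ∀ x, Φ x ≠ 0 → P.Good h x) (x : E → G) :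
    P.twistState h b k Φ x = Φ (P.twistMove h b W k x) := by
  by_cases H : P.Good h x
  · rw [twistState, twistMove, if_pos H]
    have e : (P.twistField h b W k x)⁻¹ =
        ((P.twistField h b W k x)⁻¹ * Pi.mulSingle 0 (twist h (P.pot h x b)⁻¹ k)) *
          Pi.mulSingle 0 (twist h (P.pot h x b)⁻¹ k)⁻¹ := by
      rw [mul_assoc, ← Pi.mulSingle_mul, mul_inv_cancel, Pi.mulSingle_one, mul_one]
    rw [e, gact_mul]
    exact (hA _ (by rw [Pi.mul_apply, Pi.inv_apply, H.twistField_zero h0, Pi.mulSingle_eq_same,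
      inv_mul_cancel]) _).symm
  · rw [twistMove, if_neg H]
    have h1 : Φ x = 0 := by
      by_contra h1; exact H (hB x h1)
    rw [h1, twistState]
    by_contra h2
    have h3 := hB _ h2
    have hcomm : Commute (twist h (P.pot h x b)⁻¹ k) h := twist_comm hk
    have := h3.gact (c := (Pi.mulSingle 0 (twist h (P.pot h x b)⁻¹ k)⁻¹)⁻¹) (by
      rw [Pi.inv_apply, Pi.mulSingle_eq_same, inv_inv]; exact hcomm)
    rw [gact_inv_gact] at this
    exact H this

theorem mem_star_cases {V : Set (ℤ × ℤ)} (hV : V ⊆ sq 0 ((R : ℤ) - 1)) {e : E}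
    (he : e ∈ P.star V) :
    (∃ i j, e = (P.dart (i, j) 0).1 ∧ ((i, j) ∈ V ∨ (i + 1, j) ∈ V)) ∨
    ∃ i j, e = (P.dart (i, j) 1).1 ∧ ((i, j) ∈ V ∨ (i, j + 1) ∈ V) := by
  obtain ⟨⟨i, j⟩, hp, k, rfl⟩ := he
  rcases P.dart_fst_cases (hV hp) k with h | h | h | h
  · exact Or.inl ⟨i, j, h, Or.inl hp⟩
  · exact Or.inr ⟨i, j, h, Or.inl hp⟩
  · exact Or.inl ⟨i - 1, j, h, Or.inr (by simpa using hp)⟩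
  · exact Or.inr ⟨i, j - 1, h, Or.inr (by simpa using hp)⟩

theorem Good.twistMove_east (H : P.Good h x) {i j : ℤ} (h1 : (i, j) ∈ sq 0 (R : ℤ))
    (h2 : (i + 1, j) ∈ sq 0 (R : ℤ)) (hW : (i, j) ∈ W ↔ (i + 1, j) ∈ W) :
    P.twistMove h b W k x (P.dart (i, j) 0).1 = x (P.dart (i, j) 0).1 := by
  rw [← val_eq_iff]
  show P.east _ (i, j) = P.east x (i, j)
  rw [twistMove, if_pos H, P.east_gact _ _ h1 h2, Pi.inv_apply, Pi.inv_apply, twistField,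
    twistField, H.pot.2.1 i j h1 h2]
  by_cases hp : (i, j) ∈ W
  · rw [if_pos hp, if_pos (hW.1 hp)]; group
  · rw [if_neg hp, if_neg fun h => hp (hW.2 h)]; group

/-- A covariantly constant gauge transformation changes only edges across the boundary of `W`.
Across the cut, constancy holds because the twist commutes with `h`. -/
theorem Good.twistMove_north (H : P.Good h x) (hk : k * h = h * k) {i j : ℤ}
    (h1 : (i, j) ∈ sq 0 (R : ℤ)) (h2 : (i, j + 1) ∈ sq 0 (R : ℤ))
    (hW : (i, j) ∈ W ↔ (i, j + 1) ∈ W) :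
    P.twistMove h b W k x (P.dart (i, j) 1).1 = x (P.dart (i, j) 1).1 := by
  rw [← val_eq_iff]
  show P.north _ (i, j) = P.north x (i, j)
  rw [twistMove, if_pos H, P.north_gact _ _ h1 h2, Pi.inv_apply, Pi.inv_apply, twistField,
    twistField, H.pot.2.2 i j h1 h2]
  have ht := twist_comm (h := h) (t := (P.pot h x b)⁻¹) hk
  by_cases hp : (i, j) ∈ W
  · rw [if_pos hp, if_pos (hW.1 hp)]
    split_ifs
    · generalize twist h (P.pot h x b)⁻¹ k = m at ht
      have e : m⁻¹ * h * m = h := by rw [mul_assoc, ← ht, inv_mul_cancel_left]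
      calc _ = P.pot h x (i, j) * (m⁻¹ * h * m) * (P.pot h x (i, j + 1))⁻¹ := by group
        _ = _ := by rw [e]
    · group
  · rw [if_neg hp, if_neg fun h => hp (hW.2 h)]; group

/-- Projections away from `b` do not see the difference between `Φ` and `twistState`. -/
theorem mulVec_twistState {M : Op E G} (hM : IsProj M) {Q : Set E} (hQ : LocalOn Q M)
    {Φ : Vec E G} (hΦ : M *ᵥ Φ = Φ) (hk : k * h = h * k)
    (hA : ∀ c : ℤ × ℤ → G, c 0 = 1 → ∀ x, Φ (P.gact c x) = Φ x)
    (hB : ∀ x, Φ x ≠ 0 → P.Good h x) (h0 : (0 : ℤ × ℤ) ∈ W) (hb : b ∉ W)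
    (hbR : b ∈ sq 0 (R : ℤ)) (hW : W ⊆ sq 0 ((R : ℤ) - 1))
    (hQe : ∀ i j, (P.dart (i, j) 0).1 ∈ Q → ((i, j) ∈ W ↔ (i + 1, j) ∈ W))
    (hQn : ∀ i j, (P.dart (i, j) 1).1 ∈ Q → ((i, j) ∈ W ↔ (i, j + 1) ∈ W))
    (hbdry : ∀ x y, P.Good h x → P.Good h y → (∀ e ∉ Q, x e = y e) →
      ∀ i j i' j' : ℤ, (i, j) ∈ W → (i', j') ∉ W → (i', j') ∈ sq (i, j) 1 → ∀ k : G,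
        P.twistField h b W k x (i, j) = P.twistField h b W k y (i, j)) :
    M *ᵥ P.twistState h b k Φ = P.twistState h b k Φ := by
  have hW' : W ⊆ sq 0 (R : ℤ) := hW.trans fun p hp => by
    simp only [mem_sq] at *; omega
  have hkinv : k⁻¹ * h = h * k⁻¹ := (show Commute k h from hk).inv_left
  have hinv := twistMove_twistMove (P := P) hkinv h0 hb hbR hW'
  rw [inv_inv] at hinv
  -- The twist becomes a permutation of configurations, to which `mulVec_comp_equiv` applies.
  let g : (E → G) ≃ (E → G) := ⟨P.twistMove h b W k, P.twistMove h b W k⁻¹,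
    twistMove_twistMove hk h0 hb hbR hW', hinv⟩
  have hnear : ∀ i j, ((i, j) ∈ W ∨ (i + 1, j) ∈ W) →
      (i, j) ∈ sq 0 (R : ℤ) ∧ (i + 1, j) ∈ sq 0 (R : ℤ) := by
    rintro i j (hp | hp) <;> have := hW hp <;>
      simp only [mem_sq, Prod.fst_zero, Prod.snd_zero] at * <;> omega
  have hnear' : ∀ i j, ((i, j) ∈ W ∨ (i, j + 1) ∈ W) →
      (i, j) ∈ sq 0 (R : ℤ) ∧ (i, j + 1) ∈ sq 0 (R : ℤ) := by
    rintro i j (hp | hp) <;> have := hW hp <;>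
      simp only [mem_sq, Prod.fst_zero, Prod.snd_zero] at * <;> omega
  have hoff : ∀ k x e, e ∉ P.star W → P.twistMove h b W k x e = x e := by
    intro k x e he
    rw [twistMove]
    split_ifs
    · refine P.gact_apply_of_not_mem_star (V := W) (fun p hp => ?_) x he
      rw [Pi.inv_apply, twistField, if_neg hp, inv_one]
    · rfl
  -- The move changes edges across the boundary of `W` only, using the field at boundary points;
  -- `hbdry` says that this field can be read off outside `Q`. Applied to `k⁻¹`, the same fact gives
  -- the converse needed below.
  have h2 : ∀ k : G, k * h = h * k → ∀ x, P.Good h x → ∀ y, P.Good h y →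
      (∀ e ∉ Q, x e = y e) → ∀ e ∉ Q, P.twistMove h b W k x e = P.twistMove h b W k y e := by
    intro k hk x hx y hy hxy e he
    by_cases heW : e ∈ P.star W
    · rcases mem_star_cases hW heW with ⟨i, j, rfl, hij⟩ | ⟨i, j, rfl, hij⟩
      · obtain ⟨a1, a2⟩ := hnear i j hij
        by_cases hiff : (i, j) ∈ W ↔ (i + 1, j) ∈ W
        · rw [hx.twistMove_east a1 a2 hiff, hy.twistMove_east a1 a2 hiff, hxy _ he]
        · rw [← val_eq_iff]
          show P.east _ (i, j) = P.east _ (i, j)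
          have exy : P.east x (i, j) = P.east y (i, j) := val_eq_iff.2 (hxy _ he)
          rw [twistMove, twistMove, if_pos hx, if_pos hy, P.east_gact _ _ a1 a2,
            P.east_gact _ _ a1 a2, exy]
          simp only [Pi.inv_apply]
          have b1 : P.twistField h b W k x (i, j) = P.twistField h b W k y (i, j) := by
            by_cases hp : (i, j) ∈ W
            · exact hbdry x y hx hy hxy i j (i + 1) j hp (by tauto)
                (by simp only [mem_sq]; omega) k
            · rw [twistField, twistField, if_neg hp, if_neg hp]
          have b2 : P.twistField h b W k x (i + 1, j) = P.twistField h b W k y (i + 1, j) := by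
            by_cases hp : (i + 1, j) ∈ W
            · exact hbdry x y hx hy hxy (i + 1) j i j hp (by tauto)
                (by simp only [mem_sq]; omega) k
            · rw [twistField, twistField, if_neg hp, if_neg hp]
          rw [b1, b2]
      · obtain ⟨a1, a2⟩ := hnear' i j hij
        by_cases hiff : (i, j) ∈ W ↔ (i, j + 1) ∈ W
        · rw [hx.twistMove_north hk a1 a2 hiff, hy.twistMove_north hk a1 a2 hiff, hxy _ he]
        · rw [← val_eq_iff]
          show P.north _ (i, j) = P.north _ (i, j)
          have exy : P.north x (i, j) = P.north y (i, j) := val_eq_iff.2 (hxy _ he)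
          rw [twistMove, twistMove, if_pos hx, if_pos hy, P.north_gact _ _ a1 a2,
            P.north_gact _ _ a1 a2, exy]
          simp only [Pi.inv_apply]
          have b1 : P.twistField h b W k x (i, j) = P.twistField h b W k y (i, j) := by
            by_cases hp : (i, j) ∈ W
            · exact hbdry x y hx hy hxy i j i (j + 1) hp (by tauto)
                (by simp only [mem_sq]; omega) k
            · rw [twistField, twistField, if_neg hp, if_neg hp]
          have b2 : P.twistField h b W k x (i, j + 1) = P.twistField h b W k y (i, j + 1) := by
            by_cases hp : (i, j + 1) ∈ W
            · exact hbdry x y hx hy hxy i (j + 1) i j hp (by tauto)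
                (by simp only [mem_sq]; omega) k
            · rw [twistField, twistField, if_neg hp, if_neg hp]
          rw [b1, b2]
    · rw [hoff k x e heW, hoff k y e heW, hxy e he]
  have hfun : P.twistState h b k Φ = fun x => Φ (g x) :=
    funext fun x => twistState_eq hk h0 hA hB x
  rw [hfun]
  refine mulVec_comp_equiv hM hQ hΦ g (S := {x | P.Good h x}) hB
    (fun x => good_twistMove_iff hk h0) ?_ (h2 k hk) ?_
  · intro x hx e he
    by_cases heW : e ∈ P.star W
    · rcases mem_star_cases hW heW with ⟨i, j, rfl, hij⟩ | ⟨i, j, rfl, hij⟩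
      · obtain ⟨a1, a2⟩ := hnear i j hij
        exact Good.twistMove_east hx a1 a2 (hQe i j he)
      · obtain ⟨a1, a2⟩ := hnear' i j hij
        exact Good.twistMove_north hx hk a1 a2 (hQn i j he)
    · exact hoff k x e heW
  · intro x hx y hy hxy
    have := h2 k⁻¹ hkinv (g x) ((good_twistMove_iff hk h0).2 hx) (g y)
      ((good_twistMove_iff hk h0).2 hy) hxy
    intro e he
    have h4 := this e he
    rwa [show P.twistMove h b W k⁻¹ (g x) = x from g.left_inv x,
      show P.twistMove h b W k⁻¹ (g y) = y from g.left_inv y] at h4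

end Lattice.SquarePatch

end Transfer

/-! ### Two choices of region that hide the charge transfer from a projection -/

section TransferCases

variable {E G : Type*} [Fintype E] [DecidableEq E] [Group G] [Fintype G] [DecidableEq G]

namespace Lattice.SquarePatch

variable {L : Lattice E} {s : L.Site} {R : ℕ} {P : L.SquarePatch s R} {h k : G} {x y : E → G}
  {V : Set (ℤ × ℤ)}

theorem eq_of_agree_off_star_east (hV : V ⊆ sq 0 (R : ℤ)) (hxy : ∀ e ∉ P.star V, x e = y e)
    {i j : ℤ} (h1 : (i, j) ∈ sq 0 (R : ℤ)) (h2 : (i + 1, j) ∈ sq 0 (R : ℤ)) (h3 : (i, j) ∉ V)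
    (h4 : (i + 1, j) ∉ V) : x (P.dart (i, j) 0).1 = y (P.dart (i, j) 0).1 :=
  hxy _ fun h => by
    rw [P.east_mem_star hV h1 h2] at h; tauto

theorem eq_of_agree_off_star_north (hV : V ⊆ sq 0 (R : ℤ)) (hxy : ∀ e ∉ P.star V, x e = y e)
    {i j : ℤ} (h1 : (i, j) ∈ sq 0 (R : ℤ)) (h2 : (i, j + 1) ∈ sq 0 (R : ℤ)) (h3 : (i, j) ∉ V)
    (h4 : (i, j + 1) ∉ V) : x (P.dart (i, j) 1).1 = y (P.dart (i, j) 1).1 :=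
  hxy _ fun h => by
    rw [P.north_mem_star hV h1 h2] at h; tauto

theorem compare_row {κ κ' : ℤ × ℤ → G} (hκ : IsFluxPotential R h (P.east x) (P.north x) κ)
    (hκ' : IsFluxPotential R h (P.east y) (P.north y) κ') (hV : V ⊆ sq 0 (R : ℤ))
    (hxy : ∀ e ∉ P.star V, x e = y e) {j lo hi : ℤ} (hj : -R ≤ j) (hj' : j ≤ R) (hlo : -R ≤ lo)
    (hhi : hi ≤ R) (hle : lo ≤ hi) (hav : ∀ i, lo ≤ i → i ≤ hi → (i, j) ∉ V) :
    (κ' (lo, j))⁻¹ * κ (lo, j) = (κ' (hi, j))⁻¹ * κ (hi, j) :=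
  eq_of_forall_step (f := fun i => (κ' (i, j))⁻¹ * κ (i, j)) (lo := lo) (hi := hi)
    (fun i _ _ => by
      have h1 : (i, j) ∈ sq 0 (R : ℤ) := by
        simp only [mem_sq, Prod.fst_zero, Prod.snd_zero]; omega
      have h2 : (i + 1, j) ∈ sq 0 (R : ℤ) := by
        simp only [mem_sq, Prod.fst_zero, Prod.snd_zero]; omega
      exact compare_east hκ hκ' h1 h2 (eq_of_agree_off_star_east hV hxy h1 h2
        (hav _ (by omega) (by omega)) (hav _ (by omega) (by omega))))
    le_rfl hle hle le_rfl

theorem compare_col {κ κ' : ℤ × ℤ → G} (hκ : IsFluxPotential R h (P.east x) (P.north x) κ)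
    (hκ' : IsFluxPotential R h (P.east y) (P.north y) κ') (hV : V ⊆ sq 0 (R : ℤ))
    (hxy : ∀ e ∉ P.star V, x e = y e) {i lo hi : ℤ} (hi0 : i ≤ 0) (hi' : -R ≤ i) (hlo : -R ≤ lo)
    (hhi : hi ≤ R) (hle : lo ≤ hi) (hav : ∀ j, lo ≤ j → j ≤ hi → (i, j) ∉ V) :
    (κ' (i, lo))⁻¹ * κ (i, lo) = (κ' (i, hi))⁻¹ * κ (i, hi) :=
  eq_of_forall_step (f := fun j => (κ' (i, j))⁻¹ * κ (i, j)) (lo := lo) (hi := hi)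
    (fun j _ _ => by
      have h1 : (i, j) ∈ sq 0 (R : ℤ) := by
        simp only [mem_sq, Prod.fst_zero, Prod.snd_zero]; omega
      have h2 : (i, j + 1) ∈ sq 0 (R : ℤ) := by
        simp only [mem_sq, Prod.fst_zero, Prod.snd_zero]; omega
      exact compare_north hκ hκ' h1 h2 (by omega) (eq_of_agree_off_star_north hV hxy h1 h2
        (hav _ (by omega) (by omega)) (hav _ (by omega) (by omega))))
    le_rfl hle hle le_rfl

variable {B : ℤ} {M : Op E G} {Φ : Vec E G}

/-- The support of the projection avoids the centre of the patch and a path from there to `b`. -/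
theorem mulVec_twistState_of_path (hM : IsProj M) (hQ : LocalOn (P.star V) M)
    (hΦ : M *ᵥ Φ = Φ) (hk : k * h = h * k)
    (hA : ∀ c : ℤ × ℤ → G, c 0 = 1 → ∀ x, Φ (P.gact c x) = Φ x)
    (hB : ∀ x, Φ x ≠ 0 → P.Good h x) (hV : V ⊆ sq 0 (R : ℤ)) (hV0 : ∀ p ∈ V, p ∉ sq 0 1)
    (hB0 : 0 < B) (hBR : B < R)
    (hpath : (∀ i, -B ≤ i → i ≤ 0 → (i, 0) ∉ V ∧ (-B, i) ∉ V) ∨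
      ∀ i, -B ≤ i → i ≤ 0 → (0, i) ∉ V ∧ (i, -B) ∉ V) :
    M *ᵥ P.twistState h (-B, -B) k Φ = P.twistState h (-B, -B) k Φ := by
  refine mulVec_twistState (W := {0}) hM hQ hΦ hk hA hB rfl ?_ ?_ ?_ ?_ ?_ ?_
  · simp only [Set.mem_singleton_iff, Prod.mk_eq_zero]; omega
  · simp only [mem_sq, Prod.fst_zero, Prod.snd_zero]; omega
  · simp only [Set.singleton_subset_iff, mem_sq, Prod.fst_zero, Prod.snd_zero]; omega
  · intro i j hQ
    by_cases hij : (i, j) ∈ sq 0 1 ∧ (i + 1, j) ∈ sq 0 1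
    · rw [P.east_mem_star hV (by simp only [mem_sq, Prod.fst_zero, Prod.snd_zero] at *; omega)
        (by simp only [mem_sq, Prod.fst_zero, Prod.snd_zero] at *; omega)] at hQ
      exact absurd hQ (by rintro (hQ | hQ) <;> have := hV0 _ hQ <;> tauto)
    · simp only [Set.mem_singleton_iff, Prod.mk_eq_zero]
      simp only [mem_sq, Prod.fst_zero, Prod.snd_zero] at hij
      omega
  · intro i j hQ
    by_cases hij : (i, j) ∈ sq 0 1 ∧ (i, j + 1) ∈ sq 0 1
    · rw [P.north_mem_star hV (by simp only [mem_sq, Prod.fst_zero, Prod.snd_zero] at *; omega)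
        (by simp only [mem_sq, Prod.fst_zero, Prod.snd_zero] at *; omega)] at hQ
      exact absurd hQ (by rintro (hQ | hQ) <;> have := hV0 _ hQ <;> tauto)
    · simp only [Set.mem_singleton_iff, Prod.mk_eq_zero]
      simp only [mem_sq, Prod.fst_zero, Prod.snd_zero] at hij
      omega
  · intro x y hx hy hxy i j _ _ h0 _ _ k
    obtain ⟨rfl, rfl⟩ : i = 0 ∧ j = 0 := by
      simpa only [Set.mem_singleton_iff, Prod.mk_eq_zero] using h0
    have e1 : P.pot h x (0, 0) = 1 := hx.pot.1
    have e2 : P.pot h y (0, 0) = 1 := hy.pot.1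
    -- The comparison of the potentials is constant along a path outside the support. Both
    -- potentials are `1` at the centre, so they agree at `b`.
    have key : (P.pot h y (-B, -B))⁻¹ * P.pot h x (-B, -B) =
        (P.pot h y (0, 0))⁻¹ * P.pot h x (0, 0) := by
      rcases hpath with hp | hp
      · exact (compare_col hx.pot hy.pot hV hxy (by omega) (by omega) (by omega) (by omega)
          (by omega) fun j h1 h2 => (hp j h1 h2).2).trans
          (compare_row hx.pot hy.pot hV hxy (by omega) (by omega) (by omega) (by omega)
          (by omega) fun j h1 h2 => (hp j h1 h2).1)
      · exact (compare_row hx.pot hy.pot hV hxy (by omega) (by omega) (by omega) (by omega)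
          (by omega) fun j h1 h2 => (hp j h1 h2).2).trans
          (compare_col hx.pot hy.pot hV hxy (by omega) (by omega) (by omega) (by omega)
          (by omega) fun j h1 h2 => (hp j h1 h2).1)
    rw [e1, e2, inv_one, one_mul, inv_mul_eq_one] at key
    simp only [twistField, Set.mem_singleton_iff, Prod.mk_eq_zero, and_self, if_true, e1, e2, key]

/-- The support of the projection is close to the centre of the patch. -/
theorem mulVec_twistState_of_subset (hM : IsProj M) (hQ : LocalOn (P.star V) M)
    (hΦ : M *ᵥ Φ = Φ) (hk : k * h = h * k)
    (hA : ∀ c : ℤ × ℤ → G, c 0 = 1 → ∀ x, Φ (P.gact c x) = Φ x)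
    (hB : ∀ x, Φ x ≠ 0 → P.Good h x) {q : ℤ} (hV : V ⊆ sq 0 (q - 1)) (hq : 0 < q) (hqB : q < B)
    (hBR : B < R) :
    M *ᵥ P.twistState h (-B, -B) k Φ = P.twistState h (-B, -B) k Φ := by
  have hVR : V ⊆ sq 0 (R : ℤ) := hV.trans fun p hp => by
    simp only [mem_sq, Prod.fst_zero, Prod.snd_zero] at *; omega
  refine mulVec_twistState (W := sq 0 q) hM hQ hΦ hk hA hB ?_ ?_ ?_ ?_ ?_ ?_ ?_
  · simp only [mem_sq, Prod.fst_zero, Prod.snd_zero]; omega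
  · simp only [mem_sq, Prod.fst_zero, Prod.snd_zero]; omega
  · simp only [mem_sq, Prod.fst_zero, Prod.snd_zero]; omega
  · intro p
    simp only [mem_sq, Prod.fst_zero, Prod.snd_zero]; omega
  · intro i j hQ
    by_cases hij : (i, j) ∈ sq 0 (R : ℤ) ∧ (i + 1, j) ∈ sq 0 (R : ℤ)
    · rw [P.east_mem_star hVR hij.1 hij.2] at hQ
      rcases hQ with hQ | hQ <;> have := hV hQ <;>
        simp only [mem_sq, Prod.fst_zero, Prod.snd_zero] at * <;> omega
    · simp only [mem_sq, Prod.fst_zero, Prod.snd_zero] at *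
      omega
  · intro i j hQ
    by_cases hij : (i, j) ∈ sq 0 (R : ℤ) ∧ (i, j + 1) ∈ sq 0 (R : ℤ)
    · rw [P.north_mem_star hVR hij.1 hij.2] at hQ
      rcases hQ with hQ | hQ <;> have := hV hQ <;>
        simp only [mem_sq, Prod.fst_zero, Prod.snd_zero] at * <;> omega
    · simp only [mem_sq, Prod.fst_zero, Prod.snd_zero] at *
      omega
  · intro x y hx hy hxy i j i' j' hp hp' hpp k
    have hnV : ∀ p, p ∉ sq 0 (q - 1) → p ∉ V := fun p hp h => hp (hV h)
    have hR : ∀ p, p ∈ sq 0 q → p ∈ sq 0 (R : ℤ) := fun p hp => by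
      simp only [mem_sq, Prod.fst_zero, Prod.snd_zero] at *; omega
    -- The two configurations agree along the boundary of `W`, which encircles the support. Cut open
    -- at the flux line it is still connected, so the potentials there differ by one constant.
    have hring : ∀ p : ℤ × ℤ, p ∈ sq 0 q → p ∉ sq 0 (q - 1) →
        (P.pot h y p)⁻¹ * P.pot h x p = (P.pot h y (-q, -q))⁻¹ * P.pot h x (-q, -q) := by
      intro p hp hp'
      have := ring_const (f := fun p => (P.pot h y p)⁻¹ * P.pot h x p) (b := 0) (q := q)
        (fun i j h1 h2 h3 h4 => compare_east hx.pot hy.pot (hR _ h1) (hR _ h2)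
          (eq_of_agree_off_star_east hVR hxy (hR _ h1) (hR _ h2) (hnV _ h3) (hnV _ h4)))
        (fun i j h1 h2 h3 h4 h5 => compare_north hx.pot hy.pot (hR _ h1) (hR _ h2) h5
          (eq_of_agree_off_star_north hVR hxy (hR _ h1) (hR _ h2) (hnV _ h3) (hnV _ h4))) hp hp'
      simpa using this
    have hb : (P.pot h y (-B, -B))⁻¹ * P.pot h x (-B, -B) =
        (P.pot h y (-q, -q))⁻¹ * P.pot h x (-q, -q) :=
      (compare_col hx.pot hy.pot hVR hxy (by omega) (by omega) (by omega) (by omega)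
          (by omega) fun j h1 h2 => hnV _ (by
            simp only [mem_sq, Prod.fst_zero, Prod.snd_zero]; omega)).trans
        (compare_row hx.pot hy.pot hVR hxy (by omega) (by omega) (by omega) (by omega)
          (by omega) fun j h1 h2 => hnV _ (by
            simp only [mem_sq, Prod.fst_zero, Prod.snd_zero]; omega))
    have c1 : (q, (0 : ℤ)) ∈ sq 0 q := by
      simp only [mem_sq, Prod.fst_zero, Prod.snd_zero]; omega
    have c2 : (q, (0 : ℤ)) ∉ sq 0 (q - 1) := by
      simp only [mem_sq, Prod.fst_zero, Prod.snd_zero]; omega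
    have c3 : (q, (0 : ℤ) + 1) ∈ sq 0 q := by
      simp only [mem_sq, Prod.fst_zero, Prod.snd_zero]; omega
    have c4 : (q, (0 : ℤ) + 1) ∉ sq 0 (q - 1) := by
      simp only [mem_sq, Prod.fst_zero, Prod.snd_zero]; omega
    -- Closing the loop across the flux line shows that this constant commutes with `h`; by
    -- `twist_mul` it then cancels from the twist field.
    have hcut := compare_cut hx.pot hy.pot (hR _ c1) (hR _ c3) hq
      (eq_of_agree_off_star_north hVR hxy (hR _ c1) (hR _ c3) (hnV _ c2) (hnV _ c4))
    rw [hring _ c1 c2, hring _ c3 c4] at hcut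
    have hp1 : (i, j) ∉ sq 0 (q - 1) := by
      simp only [mem_sq, Prod.fst_zero, Prod.snd_zero] at *; omega
    have hpc := hring _ hp hp1
    generalize (P.pot h y (-q, -q))⁻¹ * P.pot h x (-q, -q) = c at hb hcut hpc
    have e1 : P.pot h x (-B, -B) = P.pot h y (-B, -B) * c := by rw [← hb, mul_inv_cancel_left]
    have e2 : P.pot h x (i, j) = P.pot h y (i, j) * c := by rw [← hpc, mul_inv_cancel_left]
    have hcinv : c⁻¹ * h = h * c⁻¹ := (show Commute c h from hcut).inv_left
    rw [twistField, twistField, if_pos hp, if_pos hp, e1, e2, mul_inv_rev _ c, twist_mul hcinv]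
    group

end Lattice.SquarePatch

end TransferCases

/-! ### Annulus projections -/

section Potentials

variable {G : Type*} [Group G] {V W : Set (ℤ × ℤ)} {a n κ a' n' κ' : ℤ × ℤ → G}

theorem IsPotential.mono (h : IsPotential V a n κ) (hW : W ⊆ V) : IsPotential W a n κ :=
  ⟨fun i j h1 h2 => h.1 i j (hW h1) (hW h2), fun i j h1 h2 => h.2 i j (hW h1) (hW h2)⟩

theorem IsPotential.mul_const (h : IsPotential V a n κ) (c : G) :
    IsPotential V a n fun p => κ p * c :=
  ⟨fun i j h1 h2 => by rw [h.1 i j h1 h2]; group, fun i j h1 h2 => by rw [h.2 i j h1 h2]; group⟩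

theorem IsPotential.congr (h : IsPotential V a n κ)
    (ha : ∀ i j, (i, j) ∈ V → (i + 1, j) ∈ V → a (i, j) = a' (i, j))
    (hn : ∀ i j, (i, j) ∈ V → (i, j + 1) ∈ V → n (i, j) = n' (i, j)) : IsPotential V a' n' κ :=
  ⟨fun i j h1 h2 => by rw [← ha i j h1 h2, h.1 i j h1 h2],
    fun i j h1 h2 => by rw [← hn i j h1 h2, h.2 i j h1 h2]⟩

/-- Two potentials of the same connection on the boundary of a square agree up to a constant. -/
theorem IsPotential.exists_eq_mul_const {b : ℤ × ℤ} {q : ℤ} (h : IsPotential V a n κ)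
    (h' : IsPotential W a' n' κ') (hV : sq b q \ sq b (q - 1) ⊆ V)
    (hW : sq b q \ sq b (q - 1) ⊆ W)
    (ha : ∀ i j, (i, j) ∈ sq b q \ sq b (q - 1) → (i + 1, j) ∈ sq b q \ sq b (q - 1) →
      a (i, j) = a' (i, j))
    (hn : ∀ i j, (i, j) ∈ sq b q \ sq b (q - 1) → (i, j + 1) ∈ sq b q \ sq b (q - 1) →
      n (i, j) = n' (i, j)) : ∃ c, ∀ p ∈ sq b q \ sq b (q - 1), κ p = κ' p * c := by
  refine ⟨(κ' (b.1 - q, b.2 - q))⁻¹ * κ (b.1 - q, b.2 - q), fun p hp => ?_⟩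
  rw [← inv_mul_eq_iff_eq_mul]
  refine ring_const (f := fun p => (κ' p)⁻¹ * κ p) ?_ ?_ hp.1 hp.2
  · intro i j h1 h2 h3 h4
    have e := ha i j ⟨h1, h3⟩ ⟨h2, h4⟩
    rw [h.1 i j (hV ⟨h1, h3⟩) (hV ⟨h2, h4⟩), h'.1 i j (hW ⟨h1, h3⟩) (hW ⟨h2, h4⟩),
      mul_inv_eq_iff_eq_mul] at e
    simp only [e]; group
  · intro i j h1 h2 h3 h4 _
    have e := hn i j ⟨h1, h3⟩ ⟨h2, h4⟩
    rw [h.2 i j (hV ⟨h1, h3⟩) (hV ⟨h2, h4⟩), h'.2 i j (hW ⟨h1, h3⟩) (hW ⟨h2, h4⟩),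
      mul_inv_eq_iff_eq_mul] at e
    simp only [e]; group

end Potentials

/-! ### Projections onto trivial flux and charge through an annulus -/

section Annulus

variable {E G : Type*} [Fintype E] [DecidableEq E] [Group G] [Fintype G] [DecidableEq G]

namespace Lattice.SquarePatch

variable {L : Lattice E} {s : L.Site} {R : ℕ} (P : L.SquarePatch s R)

/-- The configuration `x` is pure gauge on `V`. -/
def Pure (V : Set (ℤ × ℤ)) (x : E → G) : Prop := ∃ κ, IsPotential V (P.east x) (P.north x) κ

variable {P} {x y z w : E → G} {V W : Set (ℤ × ℤ)} {κ : ℤ × ℤ → G}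

theorem Pure.mono (h : P.Pure V x) (hW : W ⊆ V) : P.Pure W x :=
  h.imp fun _ h => h.mono hW

theorem isPotential_gact (h : IsPotential V (P.east x) (P.north x) κ) (hV : V ⊆ sq 0 (R : ℤ))
    (c : ℤ × ℤ → G) :
    IsPotential V (P.east (P.gact c x)) (P.north (P.gact c x)) fun p => c p * κ p :=
  ⟨fun i j h1 h2 => by rw [P.east_gact _ _ (hV h1) (hV h2), h.1 i j h1 h2]; group,
    fun i j h1 h2 => by rw [P.north_gact _ _ (hV h1) (hV h2), h.2 i j h1 h2]; group⟩

theorem east_eq_of_apply (h : ∀ e ∉ P.star W, x e = y e) (hW : W ⊆ sq 0 (R : ℤ)) {i j : ℤ}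
    (h1 : (i, j) ∈ sq 0 (R : ℤ)) (h2 : (i + 1, j) ∈ sq 0 (R : ℤ)) (h3 : (i, j) ∉ W)
    (h4 : (i + 1, j) ∉ W) : P.east x (i, j) = P.east y (i, j) :=
  val_eq_iff.2 (eq_of_agree_off_star_east hW h h1 h2 h3 h4)

theorem north_eq_of_apply (h : ∀ e ∉ P.star W, x e = y e) (hW : W ⊆ sq 0 (R : ℤ)) {i j : ℤ}
    (h1 : (i, j) ∈ sq 0 (R : ℤ)) (h2 : (i, j + 1) ∈ sq 0 (R : ℤ)) (h3 : (i, j) ∉ W)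
    (h4 : (i, j + 1) ∉ W) : P.north x (i, j) = P.north y (i, j) :=
  val_eq_iff.2 (eq_of_agree_off_star_north hW h h1 h2 h3 h4)

variable (P) in
/-- Both configurations are pure gauge on three consecutive rings around `b`, and they only differ
on edges at the middle one. -/
def ringRel (b : ℤ × ℤ) (n : ℤ) (x y : E → G) : Prop :=
  P.Pure (sq b (n + 1) \ sq b (n - 2)) x ∧ P.Pure (sq b (n + 1) \ sq b (n - 2)) y ∧
    ∀ e ∉ P.star (sq b n \ sq b (n - 1)), x e = y e

theorem ringRel.symm {b : ℤ × ℤ} {n : ℤ} (h : P.ringRel b n x y) : P.ringRel b n y x :=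
  ⟨h.2.1, h.1, fun e he => (h.2.2 e he).symm⟩

theorem ringRel.trans {b : ℤ × ℤ} {n : ℤ} (h : P.ringRel b n x y) (h' : P.ringRel b n y z) :
    P.ringRel b n x z :=
  ⟨h.1, h'.2.1, fun e he => (h.2.2 e he).trans (h'.2.2 e he)⟩

theorem isPotential_congr_star (hκ : IsPotential V (P.east x) (P.north x) κ)
    (h : ∀ e ∈ P.star V, x e = y e) : IsPotential V (P.east y) (P.north y) κ :=
  hκ.congr (fun _ _ h1 _ => val_eq_iff.2 (h _ ⟨_, h1, 0, rfl⟩))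
    fun _ _ h1 _ => val_eq_iff.2 (h _ ⟨_, h1, 1, rfl⟩)

theorem ringRel_localOn (P : L.SquarePatch s R) (b : ℤ × ℤ) (n : ℤ) :
    LocalOn (P.star (sq b (n + 1) \ sq b (n - 2))) (relProj (P.ringRel (G := G) b n)) := by
  have hsub : P.star (sq b n \ sq b (n - 1)) ⊆ P.star (sq b (n + 1) \ sq b (n - 2)) :=
    P.star_mono fun p => by
      simp only [Set.mem_sdiff, mem_sq]; omega
  refine relProj_localOn (fun x y h e he => h.2.2 e fun h => he (hsub h)) ?_
  rintro x y x' y' ⟨⟨κ, hκ⟩, ⟨κ', hκ'⟩, h⟩ hx hy hxy hxy'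
  refine ⟨⟨κ, isPotential_congr_star hκ hx⟩, ⟨κ', isPotential_congr_star hκ' hy⟩, fun e he => ?_⟩
  by_cases he' : e ∈ P.star (sq b (n + 1) \ sq b (n - 2))
  · rw [← hx e he', ← hy e he', h e he]
  · exact hxy' e he'

theorem ringRel_isProj (P : L.SquarePatch s R) (b : ℤ × ℤ) (n : ℤ) :
    IsProj (relProj (P.ringRel (G := G) b n)) :=
  relProj_isProj (fun _ _ h => h.symm) fun _ _ _ h h' => h.trans h'

/-- The equality of two configurations along the edges at `V`, from their potentials. -/
theorem eq_of_isPotential {κ κ' : ℤ × ℤ → G} (hκ : IsPotential W (P.east x) (P.north x) κ)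
    (hκ' : IsPotential W (P.east y) (P.north y) κ') (heq : ∀ p ∈ W, κ p = κ' p) :
    (∀ i j, (i, j) ∈ W → (i + 1, j) ∈ W → P.east x (i, j) = P.east y (i, j)) ∧
    ∀ i j, (i, j) ∈ W → (i, j + 1) ∈ W → P.north x (i, j) = P.north y (i, j) :=
  ⟨fun i j h1 h2 => by rw [hκ.1 i j h1 h2, hκ'.1 i j h1 h2, heq _ h1, heq _ h2],
    fun i j h1 h2 => by rw [hκ.2 i j h1 h2, hκ'.2 i j h1 h2, heq _ h1, heq _ h2]⟩

open Classical in
/-- On a disc without excitations the annulus projection acts trivially. -/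
theorem ringProj_mulVec_of_pure {b : ℤ × ℤ} {n : ℤ} (hn : sq b (n + 1) ⊆ sq 0 ((R : ℤ) - 1))
    {χ : Vec E G} (hχ : P.GaugeInv (sq b n) χ) (hsupp : ∀ x, χ x ≠ 0 → P.Pure (sq b (n + 1)) x) :
    relProj (P.ringRel b n) *ᵥ χ = χ := by
  have hnR : sq b (n + 1) ⊆ sq 0 (R : ℤ) := hn.trans fun p hp => by
    simp only [mem_sq] at *; omega
  have key : ∀ x y, P.ringRel b n x y → χ x ≠ 0 → χ x = χ y := by
    rintro x y ⟨-, ⟨κ', hκ'⟩, hxy⟩ hx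
    obtain ⟨κ, hκ⟩ := hsupp x hx
    have hmid : sq b n \ sq b (n - 1) ⊆ sq 0 (R : ℤ) := fun p hp => hnR (by
      simp only [Set.mem_sdiff, mem_sq] at *; omega)
    have sub : ∀ {p : ℤ × ℤ}, p ∈ sq b (n + 1) → p ∈ sq 0 (R : ℤ) := fun hp => hnR hp
    -- The configurations agree along the outer and the inner ring, so their potentials match there
    -- up to constants; after normalization outside, the inner constant `d` is the only invariant.
    obtain ⟨c, hc⟩ : ∃ c, ∀ p ∈ sq b (n + 1) \ sq b (n + 1 - 1), κ p = κ' p * c := by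
      refine hκ.exists_eq_mul_const hκ' (fun p hp => hp.1) (fun p hp => ?_) ?_ ?_
      · simp only [Set.mem_sdiff, mem_sq] at *; omega
      · intro i j h1 h2
        exact east_eq_of_apply hxy hmid (sub h1.1) (sub h2.1)
          (by simp only [Set.mem_sdiff, mem_sq] at *; omega)
          (by simp only [Set.mem_sdiff, mem_sq] at *; omega)
      · intro i j h1 h2
        exact north_eq_of_apply hxy hmid (sub h1.1) (sub h2.1)
          (by simp only [Set.mem_sdiff, mem_sq] at *; omega)
          (by simp only [Set.mem_sdiff, mem_sq] at *; omega)
    obtain ⟨d, hd⟩ : ∃ d, ∀ p ∈ sq b (n - 1) \ sq b (n - 1 - 1), κ' p * c = κ p * d := by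
      refine (hκ'.mul_const c).exists_eq_mul_const hκ (fun p hp => ?_) (fun p hp => ?_) ?_ ?_
      · simp only [Set.mem_sdiff, mem_sq] at *; omega
      · simp only [Set.mem_sdiff, mem_sq] at *; omega
      · intro i j h1 h2
        exact (east_eq_of_apply hxy hmid
          (sub (by simp only [Set.mem_sdiff, mem_sq] at *; omega))
          (sub (by simp only [Set.mem_sdiff, mem_sq] at *; omega))
          (by simp only [Set.mem_sdiff, mem_sq] at *; omega)
          (by simp only [Set.mem_sdiff, mem_sq] at *; omega)).symm
      · intro i j h1 h2
        exact (north_eq_of_apply hxy hmid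
          (sub (by simp only [Set.mem_sdiff, mem_sq] at *; omega))
          (sub (by simp only [Set.mem_sdiff, mem_sq] at *; omega))
          (by simp only [Set.mem_sdiff, mem_sq] at *; omega)
          (by simp only [Set.mem_sdiff, mem_sq] at *; omega)).symm
    -- Covariantly constant inside, hence invisible on inner edges; on the middle ring it takes `x`
    -- to `y`. The configurations are thus gauge equivalent.
    let lam : ℤ × ℤ → G := fun p => if p ∈ sq b (n - 1) then κ p * d * (κ p)⁻¹ else
      if p ∈ sq b n then κ' p * c * (κ p)⁻¹ else 1
    have hlam : ∀ p ∉ sq b n, lam p = 1 := fun p hp => by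
      have : p ∉ sq b (n - 1) := fun h => hp (by simp only [mem_sq] at *; omega)
      simp only [lam, if_neg this, if_neg hp]
    have hpot := isPotential_gact (hκ.mono (W := sq b (n + 1) \ sq b (n - 2))
      fun p hp => hp.1) (fun p hp => hnR hp.1) lam
    have hpot' := eq_of_isPotential hpot (hκ'.mul_const c) fun p hp => by
      by_cases h1 : p ∈ sq b (n - 1)
      · simp only [lam, if_pos h1, hd p ⟨h1, by
          simp only [Set.mem_sdiff, mem_sq] at *; omega⟩]
        group
      by_cases h2 : p ∈ sq b n
      · simp only [lam, if_neg h1, if_pos h2]; group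
      · simp only [lam, if_neg h1, if_neg h2, one_mul]
        exact hc p ⟨hp.1, by simpa using h2⟩
    have hin : ∀ p ∈ sq b (n - 1), lam p = κ p * d * (κ p)⁻¹ := fun p hp => if_pos hp
    have hy : P.gact lam x = y := by
      funext e
      by_cases he : e ∈ P.star (sq b n)
      · refine P.eq_on_star (V := sq b n) (fun p hp => hn ?_) ?_ ?_ e he
        · simp only [mem_sq] at *; omega
        · intro i j hij
          have h1 : (i, j) ∈ sq b (n + 1) := by simp only [mem_sq] at *; omega
          have h2 : (i + 1, j) ∈ sq b (n + 1) := by simp only [mem_sq] at *; omega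
          by_cases h3 : (i, j) ∈ sq b (n - 2) ∨ (i + 1, j) ∈ sq b (n - 2)
          · rw [P.east_gact _ _ (sub h1) (sub h2), hin _ (by simp only [mem_sq] at *; omega),
              hin _ (by simp only [mem_sq] at *; omega), ← east_eq_of_apply hxy hmid (sub h1)
                (sub h2) (by simp only [Set.mem_sdiff, mem_sq] at *; omega)
                (by simp only [Set.mem_sdiff, mem_sq] at *; omega), hκ.1 i j h1 h2]
            group
          · exact hpot'.1 i j ⟨h1, by tauto⟩ ⟨h2, by tauto⟩
        · intro i j hij
          have h1 : (i, j) ∈ sq b (n + 1) := by simp only [mem_sq] at *; omega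
          have h2 : (i, j + 1) ∈ sq b (n + 1) := by simp only [mem_sq] at *; omega
          by_cases h3 : (i, j) ∈ sq b (n - 2) ∨ (i, j + 1) ∈ sq b (n - 2)
          · rw [P.north_gact _ _ (sub h1) (sub h2), hin _ (by simp only [mem_sq] at *; omega),
              hin _ (by simp only [mem_sq] at *; omega), ← north_eq_of_apply hxy hmid (sub h1)
                (sub h2) (by simp only [Set.mem_sdiff, mem_sq] at *; omega)
                (by simp only [Set.mem_sdiff, mem_sq] at *; omega), hκ.2 i j h1 h2]
            group
          · exact hpot'.2 i j ⟨h1, by tauto⟩ ⟨h2, by tauto⟩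
      · rw [P.gact_apply_of_not_mem_star hlam x he]
        exact hxy e fun h => he (P.star_mono Set.sdiff_subset h)
    rw [← hy, hχ lam hlam]
  refine (relProj_mulVec_eq_iff (fun _ _ h => h.symm) fun _ _ _ h h' => h.trans h').2
    ⟨fun x hx => ?_, fun x y hxy => ?_⟩
  · have := (hsupp x hx).mono (W := sq b (n + 1) \ sq b (n - 2)) Set.sdiff_subset
    exact ⟨this, this, fun _ _ => rfl⟩
  · by_cases hx : χ x = 0
    · by_contra hne
      exact hne (key y x hxy.symm fun hy => hne (hx.trans hy.symm)).symm
    · exact key x y hxy hx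

end Lattice.SquarePatch

end Annulus

/-! ### States without excitations outside of a hole are locally indistinguishable -/

section Locality

variable {E G : Type*} [Fintype E] [DecidableEq E] [Group G] [Fintype G] [DecidableEq G]

namespace Lattice.SquarePatch

variable {L : Lattice E} {s : L.Site} {R : ℕ} (P : L.SquarePatch s R)

/-- States without excitations on `sq b (n + 1) \ sq b r`, and without flux or charge inside the
square `sq b n`. -/
structure Vacuum (b : ℤ × ℤ) (r n : ℤ) (χ : Vec E G) : Prop where
  gaugeInv : P.GaugeInv (sq b n \ sq b r) χ
  pure : ∀ x, χ x ≠ 0 → P.Pure (sq b (n + 1) \ sq b r) x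
  ring : ∀ x y, P.ringRel b n x y → χ x = χ y

variable {P} {x y z w : E → G} {V W A : Set (ℤ × ℤ)} {b : ℤ × ℤ} {r n : ℤ} {χ Ψ : Vec E G}

open Classical in
-- Two pure configurations that differ inside the annulus are related by a gauge transformation
-- fixed to be trivial next to the hole. The mismatch this leaves is a constant on the outside, seen
-- only at the ring `n`, where `ring` removes it.
theorem Vacuum.apply_eq (hχ : P.Vacuum b r n χ) (hn : sq b (n + 1) ⊆ sq 0 ((R : ℤ) - 1))
    (hr : r + 2 ≤ n) {n₁ n₂ : ℤ} (h1 : r + 1 ≤ n₁) (h2 : n₂ + 1 ≤ n)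
    (hx : P.Pure (sq b (n + 1) \ sq b r) x) (hy : P.Pure (sq b (n + 1) \ sq b r) y)
    (hxy : ∀ e ∉ P.star (sq b n₂ \ sq b n₁), x e = y e) : χ x = χ y := by
  have hnR : sq b (n + 1) ⊆ sq 0 (R : ℤ) := hn.trans fun p hp => by
    simp only [mem_sq] at *; omega
  have sub : ∀ {p : ℤ × ℤ}, p ∈ sq b (n + 1) → p ∈ sq 0 (R : ℤ) := fun hp => hnR hp
  have hA : sq b n₂ \ sq b n₁ ⊆ sq 0 (R : ℤ) := fun p hp => hnR (by
      simp only [Set.mem_sdiff, mem_sq] at *; omega)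
  obtain ⟨κ, hκ⟩ := hx
  obtain ⟨κ', hκ'⟩ := hy
  have hr1 : ∀ {p : ℤ × ℤ}, p ∈ sq b (r + 1) → p ∉ sq b n₂ \ sq b n₁ := fun hp h => by
    simp only [Set.mem_sdiff, mem_sq] at *; omega
  obtain ⟨c, hc⟩ : ∃ c, ∀ p ∈ sq b (r + 1) \ sq b (r + 1 - 1), κ p = κ' p * c := by
    have hsub : sq b (r + 1) \ sq b (r + 1 - 1) ⊆ sq b (n + 1) \ sq b r := fun p hp => by
      simp only [Set.mem_sdiff, mem_sq] at *; omega
    refine hκ.exists_eq_mul_const hκ' hsub hsub ?_ ?_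
    · intro i j h1 h2
      exact east_eq_of_apply hxy hA (sub (hsub h1).1) (sub (hsub h2).1) (hr1 h1.1) (hr1 h2.1)
    · intro i j h1 h2
      exact north_eq_of_apply hxy hA (sub (hsub h1).1) (sub (hsub h2).1) (hr1 h1.1) (hr1 h2.1)
  -- The constant `c` was read off at the ring `r + 1`, so `lam` is `1` there and extends trivially
  -- into the hole.
  let lam : ℤ × ℤ → G := fun p => if p ∈ sq b n \ sq b r then κ' p * c * (κ p)⁻¹ else 1
  have hlam : ∀ p ∉ sq b n \ sq b r, lam p = 1 := fun p hp => if_neg hp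
  have hlam' : ∀ p ∈ sq b n \ sq b r, lam p * κ p = κ' p * c := fun p hp => by
    simp only [lam, if_pos hp]; group
  have hlam1 : ∀ p ∈ sq b (r + 1), lam p = 1 := fun p hp => by
    by_cases h : p ∈ sq b n \ sq b r
    · rw [eq_mul_inv_of_mul_eq (hlam' p h), ← hc p ⟨hp, by simpa using h.2⟩, mul_inv_cancel]
    · exact hlam p h
  rw [← hχ.gaugeInv lam hlam x]
  have hz := isPotential_gact hκ (fun p hp => hnR hp.1) lam
  have hcl : sq b (n + 1) \ sq b (n - 2) ⊆ sq b (n + 1) \ sq b r := fun p hp => by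
    simp only [Set.mem_sdiff, mem_sq] at *; omega
  refine hχ.ring _ _ ⟨⟨_, hz.mono hcl⟩, ⟨κ', hκ'.mono hcl⟩, fun e he => ?_⟩
  by_cases heV : e ∈ P.star (sq b n \ sq b r)
  · have hpot := eq_of_isPotential (hz.mono (W := sq b n \ sq b r) fun p hp => by
      simp only [Set.mem_sdiff, mem_sq] at *; omega) ((hκ'.mul_const c).mono fun p hp => by
      simp only [Set.mem_sdiff, mem_sq] at *; omega) hlam'
    have hVn : sq b n \ sq b r ⊆ sq 0 ((R : ℤ) - 1) := fun p hp => hn (by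
      simp only [Set.mem_sdiff, mem_sq] at *; omega)
    have hmid : sq b n \ sq b (n - 1) ⊆ sq 0 (R : ℤ) := fun p hp => hnR (by
      simp only [Set.mem_sdiff, mem_sq] at *; omega)
    rcases mem_star_cases hVn heV with ⟨i, j, rfl, hij⟩ | ⟨i, j, rfl, hij⟩
    · have h1 : (i, j) ∈ sq b (n + 1) := by simp only [Set.mem_sdiff, mem_sq] at *; omega
      have h2 : (i + 1, j) ∈ sq b (n + 1) := by simp only [Set.mem_sdiff, mem_sq] at *; omega
      rw [P.east_mem_star hmid (sub h1) (sub h2)] at he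
      rw [← val_eq_iff]
      show P.east _ (i, j) = P.east y (i, j)
      by_cases hr1' : (i, j) ∈ sq b (r + 1) ∧ (i + 1, j) ∈ sq b (r + 1)
      · rw [P.east_gact _ _ (sub h1) (sub h2), hlam1 _ hr1'.1, hlam1 _ hr1'.2,
          east_eq_of_apply hxy hA (sub h1) (sub h2) (hr1 hr1'.1) (hr1 hr1'.2)]
        group
      · refine hpot.1 i j ?_ ?_ <;> simp only [Set.mem_sdiff, mem_sq] at * <;> omega
    · have h1 : (i, j) ∈ sq b (n + 1) := by simp only [Set.mem_sdiff, mem_sq] at *; omega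
      have h2 : (i, j + 1) ∈ sq b (n + 1) := by simp only [Set.mem_sdiff, mem_sq] at *; omega
      rw [P.north_mem_star hmid (sub h1) (sub h2)] at he
      rw [← val_eq_iff]
      show P.north _ (i, j) = P.north y (i, j)
      by_cases hr1' : (i, j) ∈ sq b (r + 1) ∧ (i, j + 1) ∈ sq b (r + 1)
      · rw [P.north_gact _ _ (sub h1) (sub h2), hlam1 _ hr1'.1, hlam1 _ hr1'.2,
          north_eq_of_apply hxy hA (sub h1) (sub h2) (hr1 hr1'.1) (hr1 hr1'.2)]
        group
      · refine hpot.2 i j ?_ ?_ <;> simp only [Set.mem_sdiff, mem_sq] at * <;> omega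
  · rw [P.gact_apply_of_not_mem_star hlam x heV]
    exact hxy e fun h => heV (P.star_mono (fun p hp => by
      simp only [Set.mem_sdiff, mem_sq] at *; omega) h)

/-- Purity of `y` only depends on the edges at `A` when the exterior is pure. -/
theorem Pure.splice {κx κz : ℤ × ℤ → G} (hx : IsPotential V (P.east x) (P.north x) κx)
    (hz : IsPotential V (P.east z) (P.north z) κz) (hV : V ⊆ sq 0 (R : ℤ))
    (hA : A ⊆ sq 0 (R : ℤ))
    (heq : ∀ p q, p ∈ A → q ∈ V → q ∈ sq p 1 → κx q = κz q)
    (hxy : ∀ e ∉ P.star A, x e = y e) (hzw : ∀ e ∉ P.star A, z e = w e)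
    (hyw : ∀ e ∈ P.star A, y e = w e) (hy : P.Pure V y) : P.Pure V w := by
  obtain ⟨κy, hκy⟩ := hy
  -- At edges of `A` the first two factors cancel and leave `y`. Elsewhere `(κx)⁻¹ κy` is constant
  -- along the edge, which leaves `z`.
  refine ⟨fun p => κz p * (κx p)⁻¹ * κy p, fun i j h1 h2 => ?_, fun i j h1 h2 => ?_⟩
  · by_cases he : (P.dart (i, j) 0).1 ∈ P.star A
    · have e1 : P.east w (i, j) = P.east y (i, j) := val_eq_iff.2 (hyw _ he).symm
      have hq : κx (i, j) = κz (i, j) ∧ κx (i + 1, j) = κz (i + 1, j) := by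
        rcases (P.east_mem_star hA (hV h1) (hV h2)).1 he with h | h <;>
          exact ⟨heq _ _ h h1 (by simp only [mem_sq]; omega),
            heq _ _ h h2 (by simp only [mem_sq]; omega)⟩
      rw [e1, hκy.1 i j h1 h2]; simp only [hq.1, hq.2]; group
    · have e1 : P.east w (i, j) = P.east z (i, j) := val_eq_iff.2 (hzw _ he).symm
      have e2 : P.east x (i, j) = P.east y (i, j) := val_eq_iff.2 (hxy _ he)
      rw [hx.1 i j h1 h2, hκy.1 i j h1 h2, mul_inv_eq_iff_eq_mul] at e2
      rw [e1, hz.1 i j h1 h2]; simp only [e2]; group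
  · by_cases he : (P.dart (i, j) 1).1 ∈ P.star A
    · have e1 : P.north w (i, j) = P.north y (i, j) := val_eq_iff.2 (hyw _ he).symm
      have hq : κx (i, j) = κz (i, j) ∧ κx (i, j + 1) = κz (i, j + 1) := by
        rcases (P.north_mem_star hA (hV h1) (hV h2)).1 he with h | h <;>
          exact ⟨heq _ _ h h1 (by simp only [mem_sq]; omega),
            heq _ _ h h2 (by simp only [mem_sq]; omega)⟩
      rw [e1, hκy.2 i j h1 h2]; simp only [hq.1, hq.2]; group
    · have e1 : P.north w (i, j) = P.north z (i, j) := val_eq_iff.2 (hzw _ he).symm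
      have e2 : P.north x (i, j) = P.north y (i, j) := val_eq_iff.2 (hxy _ he)
      rw [hx.2 i j h1 h2, hκy.2 i j h1 h2, mul_inv_eq_iff_eq_mul] at e2
      rw [e1, hz.2 i j h1 h2]; simp only [e2]; group

open Classical in
/-- A projection supported on an annulus around the hole which fixes one vacuum state fixes every
vacuum state. -/
theorem Vacuum.mulVec_eq (hχ : P.Vacuum b r n χ) (hΨ : P.Vacuum b r n Ψ) (hΨ0 : Ψ ≠ 0)
    (hn : sq b (n + 1) ⊆ sq 0 ((R : ℤ) - 1)) (hr : r + 2 ≤ n) {n₁ n₂ : ℤ} (h1 : r + 1 ≤ n₁)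
    (h2 : n₂ + 1 ≤ n) {M : Op E G} (hM : IsProj M)
    (hQ : LocalOn (P.star (sq b n₂ \ sq b n₁)) M) (hMΨ : M *ᵥ Ψ = Ψ) : M *ᵥ χ = χ := by
  set A := sq b n₂ \ sq b n₁ with hAdef
  set S := sq b (n + 1) \ sq b r with hS
  have hSR : S ⊆ sq 0 (R : ℤ) := fun p hp => by
    have := hn hp.1
    simp only [mem_sq] at *; omega
  have hAn : A ⊆ sq 0 ((R : ℤ) - 1) := fun p hp => hn (by
    simp only [hAdef, Set.mem_sdiff, mem_sq] at *; omega)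
  have hAR : A ⊆ sq 0 (R : ℤ) := fun p hp => by
    have := hAn hp
    simp only [mem_sq] at *; omega
  refine hM.mulVec_eq_self fun x hx => ?_
  obtain ⟨κ, hκ⟩ := hχ.pure x hx
  obtain ⟨z₀, hz₀⟩ := Function.ne_iff.1 hΨ0
  obtain ⟨κ₀, hκ₀⟩ := hΨ.pure z₀ hz₀
  -- A gauge transformation brings a configuration of the support of `Ψ` into agreement with `x` at
  -- all edges of `A`, without changing its amplitude.
  let lam : ℤ × ℤ → G := fun p => if p ∈ sq b n \ sq b r then κ p * (κ₀ p)⁻¹ else 1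
  obtain ⟨z, rfl⟩ : ∃ z, z = P.gact lam z₀ := ⟨_, rfl⟩
  have hz : Ψ (P.gact lam z₀) ≠ 0 := by
    rw [hΨ.gaugeInv lam (fun p hp => if_neg hp)]; exact hz₀
  have hκz := isPotential_gact hκ₀ hSR lam
  have hκeq : ∀ p ∈ sq b n \ sq b r, κ p = lam p * κ₀ p := fun p hp => by
    simp only [lam, if_pos hp]; group
  have hnear : ∀ p q, p ∈ A → q ∈ S → q ∈ sq p 1 → κ q = lam q * κ₀ q := fun p q h1 h2 h3 =>
    hκeq q (by simp only [hAdef, hS, Set.mem_sdiff, mem_sq] at *; omega)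
  have hpot := eq_of_isPotential (hκ.mono (W := sq b n \ sq b r) fun p hp => by
      simp only [hS, Set.mem_sdiff, mem_sq] at *; omega) (hκz.mono fun p hp => by
      simp only [hS, Set.mem_sdiff, mem_sq] at *; omega) hκeq
  have hxz : ∀ e ∈ P.star A, x e = P.gact lam z₀ e := by
    refine P.eq_on_star hAn (fun i j hij => hpot.1 i j ?_ ?_) fun i j hij => hpot.2 i j ?_ ?_ <;>
      simp only [hAdef, Set.mem_sdiff, mem_sq] at * <;> omega
  generalize P.gact lam z₀ = z at hz hκz hpot hxz
  -- Multiplication by `u` replaces the exterior of `x` by that of `z` and keeps the edges at `A`.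
  let u : E → G := fun e => if e ∈ P.star A then 1 else z e * (x e)⁻¹
  have hu1 : ∀ y : E → G, ∀ e ∈ P.star A, (u * y) e = y e := fun y e he => by
    simp only [Pi.mul_apply, u, if_pos he, one_mul]
  have hu2 : ∀ y : E → G, ∀ e ∉ P.star A, (x e = y e ↔ z e = (u * y) e) := fun y e he => by
    simp only [Pi.mul_apply, u, if_neg he]
    rw [mul_assoc, left_eq_mul, inv_mul_eq_one]
  have hxp : P.Pure S x := ⟨κ, hκ⟩
  have hzp : P.Pure S z := ⟨_, hκz⟩
  -- The amplitude is constant along the nonzero entries of this row of `M`, so it factors out. What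
  -- remains depends on `M` and `x`, not on the vacuum state, and equals `1` for `Ψ`.
  have expand : ∀ (φ : Vec E G), P.Vacuum b r n φ → ∀ x, P.Pure S x →
      (M *ᵥ φ) x = φ x * ∑ y, if P.Pure S y then M x y else 0 := by
    intro φ hφ x hxp
    show ∑ y, M x y * φ y = _
    rw [Finset.mul_sum]
    refine Finset.sum_congr rfl fun y _ => ?_
    by_cases hy : P.Pure S y
    · rw [if_pos hy, mul_comm]
      by_cases hxy : ∀ e ∉ P.star A, x e = y e
      · rw [hφ.apply_eq hn hr h1 h2 hxp hy hxy]
      · rw [show M x y = 0 by by_contra h; exact hxy (hQ.1 _ _ h), mul_zero, mul_zero]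
    · rw [if_neg hy, mul_zero, show φ y = 0 by by_contra h; exact hy (hφ.pure y h), mul_zero]
  have hsum : (∑ y, if P.Pure S y then M x y else 0) = ∑ y, if P.Pure S y then M z y else 0 := by
    refine Fintype.sum_equiv (Equiv.mulLeft u) _ _ fun y => ?_
    show _ = if P.Pure S (u * y) then M z (u * y) else 0
    by_cases hxy : ∀ e ∉ P.star A, x e = y e
    · have hzw : ∀ e ∉ P.star A, z e = (u * y) e := fun e he => (hu2 y e he).1 (hxy e he)
      have hiff : P.Pure S y ↔ P.Pure S (u * y) :=
        ⟨Pure.splice hκ hκz hSR hAR hnear hxy hzw fun e he => (hu1 y e he).symm,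
          Pure.splice hκz hκ hSR hAR (fun p q h1 h2 h3 => (hnear p q h1 h2 h3).symm) hzw hxy
            (hu1 y)⟩
      simp only [hiff]
      split_ifs
      · exact hQ.2 _ _ _ _ hxz (fun e he => (hu1 y e he).symm) hxy hzw
      · rfl
    · rw [show M x y = 0 by by_contra h; exact hxy (hQ.1 _ _ h),
        show M z (u * y) = 0 by
          by_contra h; exact hxy fun e he => (hu2 y e he).2 (hQ.1 _ _ h e he)]
      simp
  have h3 := expand Ψ hΨ z hzp
  rw [hMΨ] at h3
  have h4 : (∑ y, if P.Pure S y then M z y else 0) = 1 :=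
    mul_left_cancel₀ hz (by rw [← h3, mul_one])
  rw [expand χ hχ x hxp, hsum, h4, mul_one]

end Lattice.SquarePatch

end Locality

/-! ### Carrying stabilizers through a unitary -/

section Conjugation

variable {X : Type*} [Fintype X] [DecidableEq X] {U M : Matrix X X ℂ} {Ψ Φ : X → ℂ}

theorem conj_mulVec_eq_self (hU : U ∈ Matrix.unitaryGroup X ℂ) {z : ℂ} (hz : z ≠ 0)
    (h : U *ᵥ Ψ = z • Φ) (hM : M *ᵥ Ψ = Ψ) : (U * M * Uᴴ) *ᵥ Φ = Φ := by
  have h1 : Uᴴ * U = 1 := Matrix.mem_unitaryGroup_iff'.1 hU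
  have h2 : Φ = z⁻¹ • (U *ᵥ Ψ) := by rw [h, smul_smul, inv_mul_cancel₀ hz, one_smul]
  rw [h2, Matrix.mulVec_smul, Matrix.mulVec_mulVec, mul_assoc, h1, mul_one,
    ← Matrix.mulVec_mulVec, hM]

theorem mulVec_conjTranspose_eq_self (hU : U ∈ Matrix.unitaryGroup X ℂ)
    (h : (U * M * Uᴴ) *ᵥ Φ = Φ) : M *ᵥ (Uᴴ *ᵥ Φ) = Uᴴ *ᵥ Φ := by
  have h1 : Uᴴ * U = 1 := Matrix.mem_unitaryGroup_iff'.1 hU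
  conv_rhs => rw [← h]
  rw [Matrix.mulVec_mulVec, Matrix.mulVec_mulVec, ← mul_assoc, ← mul_assoc, h1, one_mul]

end Conjugation

/-! ### The local stabilizers of a ground state -/

section Stabilizers

variable {E G : Type*} [Fintype E] [DecidableEq E] [Group G] [Fintype G] [DecidableEq G]

namespace Lattice.SquarePatch

variable {L : Lattice E} {s : L.Site} {R : ℕ} (P : L.SquarePatch s R)

theorem gact_apply_congr (c : ℤ × ℤ → G) {x y : E → G} {e : E} (h : x e = y e) :
    P.gact c x e = P.gact c y e := by
  simp only [gact, act, h]

/-- The configurations differ by a gauge transformation at `p`. -/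
def gaugeRel (p : ℤ × ℤ) (x y : E → G) : Prop := ∃ g, y = P.gact (Pi.mulSingle p g) x

/-- The configurations are the same, and flat at the plaquette to the north-east of `p`. -/
def flatRel (p : ℤ × ℤ) (x y : E → G) : Prop :=
  x = y ∧ P.east x p * P.north x (p.1 + 1, p.2) = P.north x p * P.east x (p.1, p.2 + 1)

variable {P} {p : ℤ × ℤ} {x y z : E → G}

theorem gaugeRel.symm (h : P.gaugeRel p x y) : P.gaugeRel p y x := by
  obtain ⟨g, rfl⟩ := h
  exact ⟨g⁻¹, by rw [Pi.mulSingle_inv, gact_inv_gact]⟩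

theorem gaugeRel.trans (h : P.gaugeRel p x y) (h' : P.gaugeRel p y z) : P.gaugeRel p x z := by
  obtain ⟨g, rfl⟩ := h
  obtain ⟨g', rfl⟩ := h'
  exact ⟨g' * g, by rw [Pi.mulSingle_mul, gact_mul]⟩

theorem flatRel.symm (h : P.flatRel p x y) : P.flatRel p y x := ⟨h.1.symm, h.1 ▸ h.2⟩

theorem flatRel.trans (h : P.flatRel p x y) (h' : P.flatRel p y z) : P.flatRel p x z :=
  ⟨h.1.trans h'.1, h.2⟩

theorem gaugeRel_localOn (P : L.SquarePatch s R) (p : ℤ × ℤ) :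
    LocalOn (P.star (sq p 1)) (relProj (P.gaugeRel (G := G) p)) := by
  have hoff : ∀ (g : G) (x : E → G), ∀ e ∉ P.star (sq p 1), P.gact (Pi.mulSingle p g) x e = x e :=
    fun g x e he => P.gact_apply_of_not_mem_star (fun q hq => Pi.mulSingle_eq_of_ne (by
      rintro rfl; exact hq (by simp only [mem_sq]; omega)) _) x he
  refine relProj_localOn ?_ ?_
  · rintro x _ ⟨g, rfl⟩ e he
    exact (hoff g x e he).symm
  · rintro x _ x' y' ⟨g, rfl⟩ hx hy _ hxy'
    refine ⟨g, funext fun e => ?_⟩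
    by_cases he : e ∈ P.star (sq p 1)
    · rw [← hy e he, P.gact_apply_congr _ (hx e he)]
    · rw [hoff g x' e he, hxy' e he]

theorem flatRel_localOn (P : L.SquarePatch s R) (p : ℤ × ℤ) :
    LocalOn (P.star (sq p 1)) (relProj (P.flatRel (G := G) p)) := by
  refine relProj_localOn (fun x y h e _ => congrFun h.1 e) ?_
  rintro x y x' y' ⟨rfl, hf⟩ hx hy _ hxy'
  have hxy : x' = y' := funext fun e => by
    by_cases he : e ∈ P.star (sq p 1)
    · rw [← hx e he, hy e he]
    · exact hxy' e he
  have heast : ∀ q ∈ sq p 1, P.east x q = P.east x' q := fun q hq =>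
    val_eq_iff.2 (hx _ ⟨q, hq, 0, rfl⟩)
  have hnorth : ∀ q ∈ sq p 1, P.north x q = P.north x' q := fun q hq =>
    val_eq_iff.2 (hx _ ⟨q, hq, 1, rfl⟩)
  refine ⟨hxy, ?_⟩
  rwa [← heast p, ← heast (p.1, p.2 + 1), ← hnorth p, ← hnorth (p.1 + 1, p.2)] <;>
    (simp only [mem_sq]; omega)

theorem gaugeRel_isProj (P : L.SquarePatch s R) (p : ℤ × ℤ) :
    IsProj (relProj (P.gaugeRel (G := G) p)) :=
  relProj_isProj (fun _ _ h => h.symm) fun _ _ _ h h' => h.trans h'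

theorem flatRel_isProj (P : L.SquarePatch s R) (p : ℤ × ℤ) :
    IsProj (relProj (P.flatRel (G := G) p)) :=
  relProj_isProj (fun _ _ h => h.symm) fun _ _ _ h h' => h.trans h'

theorem gaugeRel_mulVec {χ : Vec E G} : relProj (P.gaugeRel p) *ᵥ χ = χ ↔
    ∀ g x, χ (P.gact (Pi.mulSingle p g) x) = χ x := by
  refine (relProj_mulVec_eq_iff (fun _ _ h => h.symm) fun _ _ _ h h' => h.trans h').trans
    ⟨fun h g x => (h.2 _ _ ⟨g, rfl⟩).symm, fun h => ⟨fun x _ => ⟨1, ?_⟩, ?_⟩⟩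
  · rw [Pi.mulSingle_one, gact_one]
  · rintro x _ ⟨g, rfl⟩
    exact (h g x).symm

theorem flatRel_mulVec {χ : Vec E G} : relProj (P.flatRel p) *ᵥ χ = χ ↔
    ∀ x, χ x ≠ 0 →
      P.east x p * P.north x (p.1 + 1, p.2) = P.north x p * P.east x (p.1, p.2 + 1) := by
  refine (relProj_mulVec_eq_iff (fun _ _ h => h.symm) fun _ _ _ h h' => h.trans h').trans
    ⟨fun h x hx => (h.1 x hx).2, fun h => ⟨fun x hx => ⟨rfl, h x hx⟩, ?_⟩⟩
  rintro x _ ⟨rfl, -⟩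
  rfl

theorem ringRel_mulVec {χ : Vec E G} {b : ℤ × ℤ} {n : ℤ} : relProj (P.ringRel b n) *ᵥ χ = χ ↔
    (∀ x, χ x ≠ 0 → P.Pure (sq b (n + 1) \ sq b (n - 2)) x) ∧
      ∀ x y, P.ringRel b n x y → χ x = χ y := by
  refine (relProj_mulVec_eq_iff (fun _ _ h => h.symm) fun _ _ _ h h' => h.trans h').trans
    ⟨fun h => ⟨fun x hx => (h.1 x hx).1, h.2⟩, fun h => ⟨fun x hx => ?_, h.2⟩⟩
  exact ⟨h.1 x hx, h.1 x hx, fun _ _ => rfl⟩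

theorem flat_of_isGroundState {Ψ : Vec E G} (hΨ : L.IsGroundState Ψ) {i j : ℤ}
    (h : (i, j) ∈ sq 0 (R : ℤ)) (h' : (i + 1, j + 1) ∈ sq 0 (R : ℤ)) {x : E → G} (hx : Ψ x ≠ 0) :
    P.east x (i, j) * P.north x (i + 1, j) = P.north x (i, j) * P.east x (i, j + 1) := by
  have := hΨ.holonomy_eq_one (P.dart (i, j) 0) hx
  rwa [P.holonomy_eq h h', P.cyc_plaq h h', mul_inv_eq_one] at this

theorem pure_of_isGroundState {Ψ : Vec E G} (hΨ : L.IsGroundState Ψ) (hR : 1 ≤ R) {x : E → G}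
    (hx : Ψ x ≠ 0) : P.Pure (sq 0 (R : ℤ)) x := by
  have hf : ∀ i j : ℤ, -(R : ℤ) ≤ i → i < R → -(R : ℤ) ≤ j → j < R → _ :=
    fun i j h1 h2 h3 h4 => flat_of_isGroundState (P := P) (i := i) (j := j) hΨ
    (by simp only [mem_sq, Prod.fst_zero, Prod.snd_zero]; omega)
    (by simp only [mem_sq, Prod.fst_zero, Prod.snd_zero]; omega) hx
  obtain ⟨κ, -, h1, h2⟩ := exists_isFluxPotential (R := R) (h := 1) (by omega)
    (fun i j h1 h2 h3 h4 _ => hf i j h1 h2 h3 h4)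
    (by rw [one_mul]; exact hf 0 0 (by omega) (by omega) (by omega) (by omega))
  exact ⟨κ, h1, fun i j h3 h4 => by rw [h2 i j h3 h4]; simp⟩

theorem vacuum_of_isGroundState {Ψ : Vec E G} (hΨ : L.IsGroundState Ψ) {b : ℤ × ℤ} {r n : ℤ}
    (hR : 1 ≤ R) (hn : sq b (n + 1) ⊆ sq 0 ((R : ℤ) - 1)) :
    relProj (P.ringRel b n) *ᵥ Ψ = Ψ ∧ P.Vacuum b r n Ψ := by
  have hnR : sq b (n + 1) ⊆ sq 0 (R : ℤ) := hn.trans fun p hp => by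
    simp only [mem_sq] at *; omega
  have h1 := ringProj_mulVec_of_pure hn
    (P.gaugeInv_of_isGroundState hΨ (V := sq b n) fun p hp => hnR (by
      simp only [mem_sq] at *; omega))
    fun x hx => (pure_of_isGroundState hΨ hR hx).mono hnR
  refine ⟨h1, P.gaugeInv_of_isGroundState hΨ fun p hp => hnR (by
      simp only [Set.mem_sdiff, mem_sq] at *; omega), fun x hx =>
        (pure_of_isGroundState hΨ hR hx).mono fun p hp => hnR hp.1, (ringRel_mulVec.1 h1).2⟩

end Lattice.SquarePatch

end Stabilizers

/-! ### Light-cone geometry: the twisted state after undoing the circuit -/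

section Depth

variable {E G : Type*} [Fintype E] [DecidableEq E] [Group G] [Fintype G] [DecidableEq G]
  {L : Lattice E} {s : L.Site} {R : ℕ}

/-- The states `Φ` with a flux `h` at the central site of the patch, some charge there, and no
other excitation on the patch. -/
structure Lattice.SquarePatch.Excited (P : L.SquarePatch s R) (h : G) (Φ : Vec E G) : Prop where
  gaugeInv : ∀ c : ℤ × ℤ → G, c 0 = 1 → ∀ x, Φ (P.gact c x) = Φ x
  good : ∀ x, Φ x ≠ 0 → P.Good h x

namespace Lattice.SquarePatch

variable {P : L.SquarePatch s R} {h k : G} {Φ Ψ : Vec E G} {M U : Op E G} {ℓ t : ℕ} {x : E → G}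

theorem nbhd_star_sq_subset {p : ℤ × ℤ} {D : ℕ} (hp : sq p (D + 1) ⊆ sq 0 ((R : ℤ) - 1)) :
    L.nbhd D (P.star (sq p 1)) ⊆ P.star (sq p (D + 1)) :=
  P.nbhd_star_subset (fun p hp q hq => by simp only [mem_sq] at *; omega) hp

theorem nbhd_star_annulus_subset {b : ℤ × ℤ} {D : ℕ} {q r : ℤ}
    (hp : sq b (q + D) ⊆ sq 0 ((R : ℤ) - 1)) :
    L.nbhd D (P.star (sq b q \ sq b r)) ⊆ P.star (sq b (q + D) \ sq b (r - D)) :=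
  P.nbhd_star_subset (fun p hp q hq => by simp only [Set.mem_sdiff, mem_sq] at *; omega)
    fun p h => hp h.1

/-- Transporting charge to the point `(-6 r, -6 r)` is invisible to small projections away from
this point. -/
theorem Excited.mulVec_twistState_ball (hΦ : P.Excited h Φ) (hk : k * h = h * k) {D r : ℤ}
    (hD : 0 ≤ D) (hr : r = D + 2) (hrR : 20 * r ≤ R) {p : ℤ × ℤ} (hp : p ∉ sq (-(6 * r), -(6 * r)) r)
    (hpR : sq p (D + 1) ⊆ sq 0 ((R : ℤ) - 1)) (hM : IsProj M)
    (hQ : LocalOn (P.star (sq p (D + 1))) M) (hMΦ : M *ᵥ Φ = Φ) :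
    M *ᵥ P.twistState h (-(6 * r), -(6 * r)) k Φ = P.twistState h (-(6 * r), -(6 * r)) k Φ := by
  have hpR' : sq p (D + 1) ⊆ sq 0 (R : ℤ) := hpR.trans fun p hp => by
    simp only [mem_sq] at *; omega
  -- Near the centre the enlarged square has radius `r - 1`, so it lies in `sq 0 (2 * r - 1)` and
  -- the region `sq 0 (2 * r)` surrounds it.
  by_cases h0 : p ∈ sq 0 r
  · refine mulVec_twistState_of_subset (q := 2 * r) hM hQ hMΦ hk hΦ.gaugeInv hΦ.good
      (fun q hq => ?_) (by omega) (by omega) (by omega)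
    simp only [mem_sq, Prod.fst_zero, Prod.snd_zero] at *; omega
  · refine mulVec_twistState_of_path hM hQ hMΦ hk hΦ.gaugeInv hΦ.good hpR' (fun q hq => ?_)
      (by omega) (by omega) ?_
    · simp only [mem_sq, Prod.fst_zero, Prod.snd_zero] at *; omega
    -- Two L-shaped paths join the centre to `b` and meet only at their ends. A square of radius `r
    -- - 1` that blocks both would have its centre within `r` of an end.
    · by_contra hcon
      push Not at hcon
      obtain ⟨⟨i, a1, a2, a3⟩, ⟨j, b1, b2, b3⟩⟩ := hcon
      by_cases c1 : (i, 0) ∈ sq p (D + 1) <;> by_cases c2 : (0, j) ∈ sq p (D + 1) <;>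
        simp only [c1, c2, not_true_eq_false, not_false_eq_true, forall_const, IsEmpty.forall_iff]
          at a3 b3 <;>
        simp only [mem_sq, Prod.fst_zero, Prod.snd_zero] at * <;> omega

/-- Transporting charge to the point `(-6 r, -6 r)` is invisible to the projections on an annulus
around this point and the centre. -/
theorem Excited.mulVec_twistState_annulus (hΦ : P.Excited h Φ) (hk : k * h = h * k) {r : ℤ}
    (hr : 2 ≤ r) (hrR : 20 * r ≤ R) (hM : IsProj M)
    (hQ : LocalOn (P.star (sq (-(6 * r), -(6 * r)) (9 * r) \ sq (-(6 * r), -(6 * r)) (7 * r))) M)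
    (hMΦ : M *ᵥ Φ = Φ) :
    M *ᵥ P.twistState h (-(6 * r), -(6 * r)) k Φ = P.twistState h (-(6 * r), -(6 * r)) k Φ := by
  -- The path stays within distance `6 * r` of `b`, inside the hole of the annulus.
  refine mulVec_twistState_of_path hM hQ hMΦ hk hΦ.gaugeInv hΦ.good (fun p hp => ?_)
    (fun p hp => ?_) (by omega) (by omega) (Or.inl fun i h1 h2 => ⟨?_, ?_⟩) <;>
  simp only [Set.mem_sdiff, mem_sq, Prod.fst_zero, Prod.snd_zero] at * <;> omega

/-- After undoing the circuit, the transported charge leaves a vacuum state outside of a hole. -/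
theorem vacuum_conjTranspose_mulVec (hΨ : L.IsGroundState Ψ) (hΦ : P.Excited h Φ)
    (hU : L.IsLocalCircuit ℓ t U) {z : ℂ} (hz : z ≠ 0) (hUΨ : U *ᵥ Ψ = z • Φ)
    (hk : k * h = h * k) {r : ℤ} (hr : r = (t * ℓ : ℕ) + 2) (hrR : 20 * r ≤ R) :
    P.Vacuum (-(6 * r), -(6 * r)) r (8 * r + 1)
      (Uᴴ *ᵥ P.twistState h (-(6 * r), -(6 * r)) k Φ) := by
  have hUu := hU.mem_unitary
  have sub : ∀ p ∈ sq (-(6 * r), -(6 * r)) (8 * r + 2),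
      sq p ((t * ℓ : ℕ) + 1) ⊆ sq 0 ((R : ℤ) - 1) := fun p hp q hq => by
    simp only [mem_sq, Prod.fst_zero, Prod.snd_zero] at *; omega
  have ball : ∀ p ∈ sq (-(6 * r), -(6 * r)) (8 * r + 2), p ∉ sq (-(6 * r), -(6 * r)) r →
      ∀ M : Op E G, IsProj M → LocalOn (P.star (sq p 1)) M → M *ᵥ Ψ = Ψ →
      M *ᵥ (Uᴴ *ᵥ P.twistState h (-(6 * r), -(6 * r)) k Φ) =
        Uᴴ *ᵥ P.twistState h (-(6 * r), -(6 * r)) k Φ := fun p hp hp' M hM hQ hMΨ =>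
    mulVec_conjTranspose_eq_self hUu (hΦ.mulVec_twistState_ball hk (by omega) hr hrR hp' (sub p hp)
      (hM.conj hUu) ((hU.conj_local hQ).mono (nbhd_star_sq_subset (sub p hp)))
      (conj_mulVec_eq_self hUu hz hUΨ hMΨ))
  have hn : sq (-(6 * r), -(6 * r)) (8 * r + 1 + 1) ⊆ sq 0 ((R : ℤ) - 1) := fun p hp => by
    simp only [mem_sq, Prod.fst_zero, Prod.snd_zero] at *; omega
  -- The rings `8 * r` to `8 * r + 2` enclose both the centre and `b`; thickened by the light cone
  -- `r - 2`, they stay between the radii `7 * r` and `9 * r`.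
  have hring : relProj (P.ringRel (-(6 * r), -(6 * r)) (8 * r + 1)) *ᵥ
      (Uᴴ *ᵥ P.twistState h (-(6 * r), -(6 * r)) k Φ) =
        Uᴴ *ᵥ P.twistState h (-(6 * r), -(6 * r)) k Φ := by
    refine mulVec_conjTranspose_eq_self hUu (hΦ.mulVec_twistState_annulus hk (by omega) hrR
      ((ringRel_isProj P _ _).conj hUu) ((hU.conj_local (ringRel_localOn P _ _)).mono
        ((nbhd_star_annulus_subset fun p hp => ?_).trans (P.star_mono fun p hp => ?_)))
      (conj_mulVec_eq_self hUu hz hUΨ (vacuum_of_isGroundState (r := r) hΨ (by omega) hn).1)) <;>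
    simp only [Set.mem_sdiff, mem_sq, Prod.fst_zero, Prod.snd_zero] at * <;> omega
  obtain ⟨hring1, hring2⟩ := ringRel_mulVec.1 hring
  refine ⟨GaugeInv.of_single P ((sq_finite _ _).subset Set.sdiff_subset) fun p hp g x => ?_,
    fun x hx => ?_, hring2⟩
  · refine gaugeRel_mulVec.1 (ball p ?_ hp.2 _ (gaugeRel_isProj P p) (gaugeRel_localOn P p)
      (gaugeRel_mulVec.2 fun g x => ?_)) g x
    · simp only [Set.mem_sdiff, mem_sq] at *; omega
    · have hpR : p ∈ sq 0 (R : ℤ) := by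
        simp only [Set.mem_sdiff, mem_sq, Prod.fst_zero, Prod.snd_zero] at *; omega
      rw [P.gact_mulSingle hpR]
      exact hΨ.vertexAct _ _ _
  · obtain ⟨κ₀, hκ₀⟩ := hring1 x hx
    -- Flatness comes plaquette by plaquette; the absence of holonomy around the hole comes from the
    -- annulus projection on the outermost ring.
    refine exists_isPotential_annulus (κ₀ := κ₀) (by omega) (by omega) (fun i j h1 h2 h3 h4 h5 => ?_)
      (hκ₀.mono fun p hp => by simp only [Set.mem_sdiff, mem_sq] at *; omega)
    refine flatRel_mulVec.1 (ball (i, j) ?_ h5 _ (flatRel_isProj P _) (flatRel_localOn P _)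
      (flatRel_mulVec.2 fun x hx => flat_of_isGroundState hΨ ?_ ?_ hx)) x hx <;>
      simp only [mem_sq, Prod.fst_zero, Prod.snd_zero] at * <;> omega

end Lattice.SquarePatch

end Depth

/-! ### The charge in a shallow-circuit state is conjugation invariant -/

section Main

variable {E G : Type*} [Fintype E] [DecidableEq E] [Group G] [Fintype G] [DecidableEq G]
  {L : Lattice E} {s : L.Site} {R : ℕ}

namespace Lattice.SquarePatch

variable {P : L.SquarePatch s R} {h k : G} {Φ Ψ : Vec E G} {M U : Op E G} {ℓ t : ℕ} {x : E → G}

theorem isPotential_of_isFluxPotential {κ : ℤ × ℤ → G} {V : Set (ℤ × ℤ)}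
    (hκ : IsFluxPotential R h (P.east x) (P.north x) κ) (hV : V ⊆ sq 0 (R : ℤ))
    (h0 : ∀ p ∈ V, p.2 < 0) : IsPotential V (P.east x) (P.north x) κ :=
  ⟨fun i j h1 h2 => hκ.2.1 i j (hV h1) (hV h2), fun i j h1 h2 => by
    rw [hκ.2.2 i j (hV h1) (hV h2), if_neg fun h => (h0 _ h1).ne h.1, mul_one]⟩

open Classical in
/-- A covariantly constant gauge transformation inside of a square is implemented by the annulus
projection. -/
theorem ringRel_gact {b : ℤ × ℤ} {n : ℤ} {κ : ℤ × ℤ → G}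
    (hκ : IsPotential (sq b (n + 1)) (P.east x) (P.north x) κ)
    (hn : sq b (n + 1) ⊆ sq 0 ((R : ℤ) - 1)) (c : G) :
    P.ringRel b n x (P.gact (fun p => if p ∈ sq b n then κ p * c * (κ p)⁻¹ else 1) x) := by
  have hnR : sq b (n + 1) ⊆ sq 0 (R : ℤ) := hn.trans fun p hp => by
    simp only [mem_sq] at *; omega
  set lam : ℤ × ℤ → G := fun p => if p ∈ sq b n then κ p * c * (κ p)⁻¹ else 1 with hlam
  have sub : ∀ {p : ℤ × ℤ}, p ∈ sq b (n + 1) → p ∈ sq 0 (R : ℤ) := fun hp => hnR hp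
  have hmid : sq b n \ sq b (n - 1) ⊆ sq 0 (R : ℤ) := fun p hp => hnR (by
      simp only [Set.mem_sdiff, mem_sq] at *; omega)
  refine ⟨⟨κ, hκ.mono Set.sdiff_subset⟩,
    ⟨_, (isPotential_gact hκ hnR lam).mono Set.sdiff_subset⟩, fun e he => ?_⟩
  by_cases heV : e ∈ P.star (sq b n)
  · have hVn : sq b n ⊆ sq 0 ((R : ℤ) - 1) := fun p hp => hn (by
      simp only [mem_sq] at *; omega)
    rcases mem_star_cases hVn heV with ⟨i, j, rfl, hij⟩ | ⟨i, j, rfl, hij⟩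
    · have h1 : (i, j) ∈ sq b (n + 1) := by simp only [mem_sq] at *; omega
      have h2 : (i + 1, j) ∈ sq b (n + 1) := by simp only [mem_sq] at *; omega
      rw [P.east_mem_star hmid (sub h1) (sub h2)] at he
      have h3 : (i, j) ∈ sq b n ∧ (i + 1, j) ∈ sq b n := by
        simp only [Set.mem_sdiff, mem_sq] at *; omega
      rw [← val_eq_iff]
      show P.east x (i, j) = P.east _ (i, j)
      rw [P.east_gact _ _ (sub h1) (sub h2), hκ.1 i j h1 h2]
      simp only [hlam, if_pos h3.1, if_pos h3.2]; group
    · have h1 : (i, j) ∈ sq b (n + 1) := by simp only [mem_sq] at *; omega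
      have h2 : (i, j + 1) ∈ sq b (n + 1) := by simp only [mem_sq] at *; omega
      rw [P.north_mem_star hmid (sub h1) (sub h2)] at he
      have h3 : (i, j) ∈ sq b n ∧ (i, j + 1) ∈ sq b n := by
        simp only [Set.mem_sdiff, mem_sq] at *; omega
      rw [← val_eq_iff]
      show P.north x (i, j) = P.north _ (i, j)
      rw [P.north_gact _ _ (sub h1) (sub h2), hκ.2 i j h1 h2]
      simp only [hlam, if_pos h3.1, if_pos h3.2]; group
  · exact (P.gact_apply_of_not_mem_star (fun p hp => if_neg hp) x heV).symm

/-- Gauge transformations that are trivial at the centre form a normal subgroup. -/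
theorem Excited.gact_commute (hΦ : P.Excited h Φ) {c d : ℤ × ℤ → G} (hd : d 0 = 1) (x : E → G) :
    Φ (P.gact c (P.gact d x)) = Φ (P.gact c x) := by
  rw [← gact_mul, show c * d = c * d * c⁻¹ * c by group, gact_mul]
  exact hΦ.gaugeInv _ (by simp [hd]) _

/-- In a state prepared by a shallow circuit, the charge at the centre of the patch does not
distinguish conjugate elements of the centralizer of the flux. -/
theorem Excited.apply_conj (hΦ : P.Excited h Φ) (hΨ : L.IsGroundState Ψ)
    (hU : L.IsLocalCircuit ℓ t U) {z : ℂ} (hz : z ≠ 0) (hUΨ : U *ᵥ Ψ = z • Φ)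
    (hR : 20 * (t * ℓ + 2) ≤ R) {e : G} (he : e * h = h * e) (hk : k * h = h * k) (x : E → G) :
    Φ (P.gact (Pi.mulSingle 0 (e * k * e⁻¹)⁻¹) x) = Φ (P.gact (Pi.mulSingle 0 k⁻¹) x) := by
  have he' : Commute e h := he
  have hk' : Commute k h := hk
  by_cases hx : P.Good h x
  swap
  -- Acting at the centre with elements commuting with `h` preserves good configurations, so both
  -- amplitudes vanish here.
  · have hzero : ∀ g : G, Commute g h → Φ (P.gact (Pi.mulSingle 0 g⁻¹) x) = 0 := fun g hg => by
      by_contra hne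
      have := (hΦ.good _ hne).gact (c := Pi.mulSingle 0 g) (by
        rw [Pi.mulSingle_eq_same]; exact hg)
      rw [Pi.mulSingle_inv, gact_gact_inv] at this
      exact hx this
    rw [hzero _ ((he'.mul_left hk').mul_left he'.inv_left), hzero _ hk']
  obtain ⟨r, hr⟩ : ∃ r : ℤ, r = (t * ℓ : ℕ) + 2 := ⟨_, rfl⟩
  have hrR : 20 * r ≤ R := by omega
  have hUu := hU.mem_unitary
  have hvac := vacuum_conjTranspose_mulVec hΨ hΦ hU hz hUΨ hk hr hrR
  have hn : sq (-(6 * r), -(6 * r)) (8 * r + 1 + 1) ⊆ sq 0 ((R : ℤ) - 1) := fun p hp => by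
    simp only [mem_sq, Prod.fst_zero, Prod.snd_zero] at *; omega
  have hvac' := (vacuum_of_isGroundState (P := P) (r := r) hΨ (by omega) hn).2
  have hn3 : sq (-(6 * r), -(6 * r)) (3 * r + 1 + 1) ⊆ sq 0 ((R : ℤ) - 1) := fun p hp => by
    simp only [mem_sq, Prod.fst_zero, Prod.snd_zero] at *; omega
  have hn3R : sq (-(6 * r), -(6 * r)) (3 * r + 1 + 1) ⊆ sq 0 (R : ℤ) := fun p hp => by
    simp only [mem_sq, Prod.fst_zero, Prod.snd_zero] at *; omega
  have hneg : ∀ p ∈ sq (-(6 * r), -(6 * r)) (3 * r + 1 + 1), p.2 < 0 := fun p hp => by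
    simp only [mem_sq] at *; omega
  -- The square of radius `3 * r + 2` around `b` contains neither the centre nor any point of the
  -- cut, so `Φ` is flat and gauge invariant there.
  have hNΦ : relProj (P.ringRel (-(6 * r), -(6 * r)) (3 * r + 1)) *ᵥ Φ = Φ :=
    ringProj_mulVec_of_pure hn3
      (fun c hc x => hΦ.gaugeInv c (hc 0 (by simp only [mem_sq, Prod.snd_zero]; omega)) x)
      fun x hx => ⟨_, isPotential_of_isFluxPotential (hΦ.good x hx).pot hn3R hneg⟩
  have hUU : Uᴴᴴ = U := Matrix.conjTranspose_conjTranspose U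
  have h1 : Uᴴ * U = 1 := Matrix.mem_unitaryGroup_iff'.1 hUu
  have h2 : U * Uᴴ = 1 := Matrix.mem_unitaryGroup_iff.1 hUu
  have hUu' : Uᴴ ∈ Matrix.unitaryGroup (E → G) ℂ := hU.conjTranspose.mem_unitary
  have hUΦ : Uᴴ *ᵥ Φ = z⁻¹ • Ψ := by
    rw [show Φ = z⁻¹ • (U *ᵥ Ψ) by rw [hUΨ, smul_smul, inv_mul_cancel₀ hz, one_smul],
      Matrix.mulVec_smul, Matrix.mulVec_mulVec, h1, Matrix.one_mulVec]
  -- Pulled back through the circuit, the annulus projection lives between the radii `2 * r + 1` and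
  -- `4 * r`, well between the hole and the outer ring. It fixes `Ψ`, hence the pulled-back twisted
  -- state.
  have hζ := hvac.mulVec_eq hvac' hΨ.1 hn (by omega) (n₁ := 3 * r + 1 - 2 - (t * ℓ : ℕ))
    (n₂ := 3 * r + 1 + 1 + (t * ℓ : ℕ)) (by omega) (by omega)
    ((ringRel_isProj P (-(6 * r), -(6 * r)) (3 * r + 1)).conj hUu')
    ((hU.conjTranspose.conj_local (ringRel_localOn P _ _)).mono
      (nbhd_star_annulus_subset fun p hp => by
        simp only [mem_sq, Prod.fst_zero, Prod.snd_zero] at *; omega))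
    (conj_mulVec_eq_self hUu' (inv_ne_zero hz) hUΦ hNΦ)
  have hζ' := mulVec_conjTranspose_eq_self hUu' hζ
  simp only [hUU, Matrix.mulVec_mulVec, h2, Matrix.one_mulVec] at hζ'
  have hinv := (ringRel_mulVec.1 hζ').2
  set κ := P.pot h x with hκdef
  have hκ : IsFluxPotential R h (P.east x) (P.north x) κ := hx.pot
  -- The right side does not involve `g`, so all conjugates `g * k * g⁻¹` act alike.
  have key : ∀ g : G, g * h = h * g →
      Φ (P.gact (Pi.mulSingle 0 (g * k * g⁻¹)⁻¹) x) =
        P.twistState h (-(6 * r), -(6 * r)) k Φ x := by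
    classical
    intro g hg
    -- The constant is chosen so that the gauge transformation changes the potential at `b` to
    -- `g⁻¹`. The transporter used by the twist becomes `g`, while the twisted amplitude stays the
    -- same.
    have hrel := ringRel_gact (isPotential_of_isFluxPotential hκ hn3R hneg) hn3
      ((κ (-(6 * r), -(6 * r)))⁻¹ * g⁻¹)
    rw [hinv _ _ hrel]
    have hb : (-(6 * r), -(6 * r)) ∈ sq (-(6 * r), -(6 * r)) (3 * r + 1) := by
      simp only [mem_sq]; omega
    have hbR : (-(6 * r), -(6 * r)) ∈ sq 0 (R : ℤ) := by
      simp only [mem_sq, Prod.fst_zero, Prod.snd_zero]; omega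
    have h0 : (0 : ℤ × ℤ) ∉ sq (-(6 * r), -(6 * r)) (3 * r + 1) := by
      simp only [mem_sq, Prod.snd_zero]; omega
    have hpot := pot_unique (flux_gact (m := 1) (c := fun p => if p ∈ sq (-(6 * r), -(6 * r))
      (3 * r + 1) then κ p * ((κ (-(6 * r), -(6 * r)))⁻¹ * g⁻¹) * (κ p)⁻¹ else 1) hκ (by simp)
        (by rw [if_neg h0, one_mul])) hbR
    rw [twistState, hpot, if_pos hb, hΦ.gact_commute (if_neg h0)]
    have e1 : (κ (-(6 * r), -(6 * r)) * ((κ (-(6 * r), -(6 * r)))⁻¹ * g⁻¹) *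
        (κ (-(6 * r), -(6 * r)))⁻¹ * κ (-(6 * r), -(6 * r)) * 1)⁻¹ = g := by group
    rw [e1, twist, if_pos hg]
  have := key 1 (by simp)
  rw [one_mul, inv_one, mul_one] at this
  rw [key e he, this]

end Lattice.SquarePatch

variable {s₀ s₁ : L.Site} {ξ : List (Triangle E)} {ρ : AnyonLabel G}

theorem excited_ribbonState (P : L.SquarePatch s₁ R) {Ψ : Vec E G} (hΨ : L.IsGroundState Ψ)
    (hξ : L.IsRibbon s₀ s₁ ξ) (hs₀ : ∀ p ∈ sq 0 (R : ℤ), ∀ k, P.dart p k ≠ s₀) (hR : 1 ≤ R)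
    (u : Fin ρ.dim → ℂ) : P.Excited ρ.r⁻¹ (ribbonState ρ ξ Ψ u) := by
  refine ⟨fun c hc x => ?_, fun x hx =>
    exists_isFluxPotential_of_ribbonState_ne_zero P hΨ hξ hs₀ hR u hx⟩
  rw [ribbonState_gact P hΨ hξ.1 hs₀ u 1 (by simpa using hc)]
  simp

/-- If the charge at the end of a ribbon does not distinguish conjugate group elements, then all
diagonal matrix elements of the charge have modulus one. -/
theorem norm_entry_eq_one_of_apply_conj (P : L.SquarePatch s₁ R) {Ψ : Vec E G}
    (hΨ : L.IsGroundState Ψ) (hξ : L.IsRibbon s₀ s₁ ξ)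
    (hs₀ : ∀ p ∈ sq 0 (R : ℤ), ∀ k, P.dart p k ≠ s₀) {u : Fin ρ.dim → ℂ}
    (hu : ribbonState ρ ξ Ψ u ≠ 0)
    (h : ∀ e k : G, e * ρ.r⁻¹ = ρ.r⁻¹ * e → k * ρ.r⁻¹ = ρ.r⁻¹ * k → ∀ x,
      ribbonState ρ ξ Ψ u (P.gact (Pi.mulSingle 0 (e * k * e⁻¹)⁻¹) x) =
        ribbonState ρ ξ Ψ u (P.gact (Pi.mulSingle 0 k⁻¹) x))
    (r : Subgroup.centralizer ({ρ.r} : Set G)) : ‖ρ.entry r‖ = 1 := by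
  have hcomm : ∀ g : Subgroup.centralizer ({ρ.r} : Set G), (g : G) * ρ.r⁻¹ = ρ.r⁻¹ * g := by
    intro g
    have h1 : Commute ρ.r (g : G) := Subgroup.mem_centralizer_singleton_iff.1 g.2 |>.symm
    exact h1.symm.inv_right
  refine norm_entry_eq_one_of_conj ρ.irreducible (u := u) ?_ (fun e k => ?_) r 0
  · rintro rfl
    apply hu
    have := ribbonState_smul (ψ := Ψ) (ξ := ξ) (ρ := ρ) 0 0
    simpa using this
  -- The amplitude identities are an equality of states, which injectivity turns into an equality of
  -- charge vectors.
  · apply ribbonState_injective P hΨ hξ.1 hs₀ hu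
    funext x
    have h1 := h e k (hcomm e) (hcomm k) x
    rw [ribbonState_gact P hΨ hξ.1 hs₀ u (e * k * e⁻¹)⁻¹ (by simp),
      ribbonState_gact P hΨ hξ.1 hs₀ u k⁻¹ (by simp), inv_inv, inv_inv] at h1
    exact h1

end Main

end QuantumDouble

open QuantumDouble in
theorem mainTheorem1 (ℓ : ℕ) :
    ∃ c : ℝ, 0 < c ∧
      ∀ (G : Type*) [Group G] [Fintype G] [DecidableEq G]
        (E : Type*) [Fintype E] [DecidableEq E] (L : QuantumDouble.Lattice E)
        (ρ : QuantumDouble.AnyonLabel G),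
        (∃ r : Subgroup.centralizer ({ρ.r} : Set G), ‖ρ.entry r‖ < 1) →
        ∀ (s₀ s₁ : L.Site) (ξ : List (QuantumDouble.Triangle E)), L.IsRibbon s₀ s₁ ξ →
        ∀ (R : ℕ) (P : L.SquarePatch s₁ R),
        (∀ p ∈ QuantumDouble.box R, ∀ k : Fin 4, P.dart p k ≠ s₀) →
        ∀ Ψ : QuantumDouble.Vec E G, L.IsGroundState Ψ →
        ∀ (t : ℕ) (U : QuantumDouble.Op E G), L.IsLocalCircuit ℓ t U →
        (∃ z : ℂ, Matrix.mulVec U Ψ =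
          z • Matrix.mulVec (QuantumDouble.anyonRibbonOp ρ ξ) Ψ) →
        c * (R : ℝ) ≤ (t : ℝ) := by
  -- The argument needs a patch of radius `20 * (t * ℓ + 2)`, which is at most `20 * (ℓ + 2) * t`
  -- for `t ≥ 1`.
  refine ⟨1 / (20 * (ℓ + 2)), by positivity, ?_⟩
  intro G _ _ _ E _ _ L ρ hρ s₀ s₁ ξ hξ R P hs₀ Ψ hΨ t U hU hz
  obtain ⟨r, hr⟩ := hρ
  obtain ⟨z, hz⟩ := hz
  by_contra hlt
  rw [not_le, div_mul_eq_mul_div, one_mul, lt_div_iff₀ (by positivity)] at hlt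
  have hlt' : t * (20 * (ℓ + 2)) < R := by exact_mod_cast hlt
  have hs₀' : ∀ p ∈ sq 0 (R : ℤ), ∀ k, P.dart p k ≠ s₀ := fun p hp => hs₀ p (mem_box_iff.2 hp)
  have hUu := hU.mem_unitary
  have hne : U *ᵥ Ψ ≠ 0 := by
    intro h
    have h1 : Uᴴ * U = 1 := Matrix.mem_unitaryGroup_iff'.1 hUu
    apply hΨ.1
    rw [← Matrix.one_mulVec Ψ, ← h1, ← Matrix.mulVec_mulVec, h, Matrix.mulVec_zero]
  rw [anyonRibbonOp_mulVec, smul_smul] at hz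
  -- Unitarity makes the image of `Ψ` nonzero, hence both the scalar and the ribbon state.
  have hc := left_ne_zero_of_smul (hz ▸ hne)
  have hΦ0 := right_ne_zero_of_smul (hz ▸ hne)
  refine hr.ne (norm_entry_eq_one_of_apply_conj P hΨ hξ hs₀' hΦ0 (fun e k he hk x => ?_) r)
  have hΦ := excited_ribbonState (ρ := ρ) P hΨ hξ hs₀' (by omega) (Pi.single 0 1)
  -- At depth zero the estimate `t * ℓ + 2 ≤ t * (ℓ + 2)` fails. There the ribbon state is a
  -- multiple of `Ψ`, so it is gauge invariant at the centre as well.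
  rcases Nat.eq_zero_or_pos t with rfl | ht
  · obtain ⟨layers, h1, -, rfl⟩ := hU
    rw [List.length_eq_zero_iff.1 h1, List.prod_nil, Matrix.one_mulVec] at hz
    have hinv : ∀ c y, Ψ (P.gact (Pi.mulSingle 0 c) y) = Ψ y := fun c y => by
      rw [P.gact_mulSingle (by simp only [mem_sq, Prod.fst_zero, Prod.snd_zero]; omega)]
      exact hΨ.vertexAct _ _ _
    refine mul_left_cancel₀ hc ?_
    have h2 := fun y => congrFun hz y
    simp only [Pi.smul_apply, smul_eq_mul] at h2
    rw [← h2, ← h2, hinv, hinv]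
  · refine hΦ.apply_conj hΨ hU hc hz ?_ he hk x
    have h3 : t * ℓ + 2 ≤ t * (ℓ + 2) := by rw [mul_add]; omega
    calc 20 * (t * ℓ + 2) ≤ 20 * (t * (ℓ + 2)) := Nat.mul_le_mul_left _ h3
      _ = t * (20 * (ℓ + 2)) := by ring
      _ ≤ R := hlt'.le
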